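/- **Setting.** $\mathrm{ZFC}^-$ is ZFC without the power set axiom plus "$\beth_\omega$ exists". Reals are elements of $\omega^\omega$; finite sequences, pairs and $\omega$-sequences of reals, and subsets of $\omega^{<\omega}$ (through characteristic functions), are coded by reals. Given a theory $T$ in the language $\{\in\}$ and a real $r$, a *candidate* is a countable transitive model $M\models T$ with $r\in M$. A real $r$ codes a forcing definition: $\Sigma^1_1$ relations "$x\in Q$", "$q\le p$", and $\Sigma^1_2$ relations $\mathrm{epd}(b_i,p)$ (an $(\omega+1)$-place relation) and $q\le_n p$ ($n\in\omega$). A superscript $M$ denotes evaluation in $M$. Consider the requirement (A) In $V$ and in every candidate, $\le$ is a partial order on $Q$ and $\mathrm{epd}(b_i,p)$ implies that $\{b_i:i\in\omega\}\subseteq Q$ is predense below $p\in Q$; moreover $Q^M$ is a set in every candidate $M$. $Q$ satisfies *effective Axiom A* (in the parameter $r$, with respect to $T$) if (A) holds and * (Fusion) for all $(a_n)_{n\in\omega}$ in $Q$ with $a_{n+1}\le_n a_n$ for all $n$ there is $a_\omega\in Q$ with $a_\omega\le a_n$ for all $n$; * in every candidate: if $p\in Q$, $n\in\omega$ and $D\subseteq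 Q$ is dense, then there are $q\le_n p$ in $Q$ and a sequence $(b_i)_{i\in\omega}$ of elements of $D$ with $\mathrm{epd}(b_i,q)$. $Q$ is *Suslin$^+$* (in the parameter $r$, with respect to $T$) if (A) holds for $\in_Q,\le,\mathrm{epd}$ and for every candidate $M$ and every $p\in Q^M$ there is $q\in Q$, $q\le p$, such that every $D\in M$ that is in $M$ a dense subset of $Q^M$ has an enumeration $\{d_i:i\in\omega\}$ with $\mathrm{epd}(d_i,q)$ (in $V$). **The forcings.** Conditions are nonempty trees $p\subseteq\omega^{<\omega}$ ordered by inclusion. * Sacks: every $s\in p$ has an extension $t\in p$ with at least two immediate successors in $p$. * Miller: every node has exactly one or infinitely many immediate successors in $p$, and every $s\in p$ has an extension in $p$ of the latter kind. * Rosłanowski: every node $t$ has exactly one immediate successor in $p$ or all $t^\frown n$ ($n\in\omega$) are in $p$, and every $s\in p$ has an extension in $p$ of the latter kind. * Laver: $p$ has a stem $s$ (a node with at least two immediate successors in $p$ that is comparable with all nodes of $p$), and every $t\in p$ extending $s$ has infinitely many immediate successors in $p$. Let $\mathrm{spl}(p)$ be the set of nodes of $p$ with at least two immediate successors in $p$;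 let $\mathrm{spl}(p,n)$ be the set of $s\in\mathrm{spl}(p)$ with exactly $n$ proper initial segments in $\mathrm{spl}(p)$; let $p^{[s]}$ be the set of nodes of $p$ comparable with $s$. Write $q\le_n p$ if $q\subseteq p$ and $\mathrm{spl}(q,n)=\mathrm{spl}(p,n)$. A *front* in $p$ is an antichain $F\subseteq p$ that meets every branch of $p$. Let $\mathrm{epd}(b_i,p)$ say that there is a front $F$ in $p$ such that for each $t\in F$ there is $i$ with $b_i=p^{[t]}$, and let $\mathrm{epd}'(b_i,p)$ say that there is $n$ such that for each $s\in\mathrm{spl}(p,n)$ there is $i$ with $b_i=p^{[s]}$. **Theorem.** There is a finite set $T_0$ of axioms of $\mathrm{ZFC}^-$ such that the following holds for every theory $T\supseteq T_0$ and for $Q$ each of Sacks, Miller, Rosłanowski and Laver forcing. 1. There is a real $r$ that in $V$ and in every candidate defines $Q$, $\subseteq$ and the relations $\le_n$ and $\mathrm{epd}$ above (evaluated there, for conditions in $Q$), and with this definition $Q$ satisfies effective Axiom A in the parameter $r$ with respect to $T$. 2. If $Q$ is Sacks, Miller or Rosłanowski forcing, then the same holds with $\mathrm{epd}'$ in place of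 $\mathrm{epd}$. 3. $Q$ is Suslin$^+$: there is a real $r$ that in $V$ and in every candidate defines $Q$ and $\subseteq$ and, together with some $\Sigma^1_2$ relation coded by $r$ in the role of $\mathrm{epd}$, is Suslin$^+$ with respect to $T$. -/

import Mathlib

open FirstOrder

universe u

noncomputable section

namespace EffAxiomA

/-! ### The language of set theory and the theory `ZFC⁻` -/

/-- The only symbol of the language of set theory is the binary relation symbol for membership. -/
inductive MemRel : ℕ → Type
  | mem : MemRel 2

/-- The language `{∈}` of set theory. -/
def setLang : FirstOrder.Language.{0, 0} := ⟨fun _ => Empty, MemRel⟩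

/-- Formulas of set theory whose free variables are `v₀, …, v_{n-1}` (de Bruijn levels). -/
abbrev Fm (n : ℕ) := setLang.BoundedFormula Empty n

/-- The formula `v_i ∈ v_j`. -/
def fMem {n : ℕ} (i j : Fin n) : Fm n :=
  FirstOrder.Language.Relations.boundedFormula₂ (L := setLang) MemRel.mem
    (FirstOrder.Language.Term.var (Sum.inr i)) (FirstOrder.Language.Term.var (Sum.inr j))

/-- The formula `v_i = v_j`. -/
def fEq {n : ℕ} (i j : Fin n) : Fm n :=
  FirstOrder.Language.Term.bdEqual (FirstOrder.Language.Term.var (Sum.inr i)) (FirstOrder.Language.Term.var (Sum.inr j))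

/-- Substitution of the variables `σ k` for the free variables `k` of `φ`. -/
def fSubst {κ : Type} {n : ℕ} (φ : setLang.Formula κ) (σ : κ → Fin n) : Fm n :=
  FirstOrder.Language.BoundedFormula.relabel (n := n) (k := 0) (fun k => Sum.inr (σ k)) φ

/-- `v_x` is empty. -/
def fEmpty {n : ℕ} (x : Fin n) : Fm n :=
  ∀' ∼(fMem (Fin.last n) x.castSucc)

/-- `v_s = v_y ∪ {v_y}`. -/
def fSucc {n : ℕ} (s y : Fin n) : Fm n :=
  ∀' (fMem (Fin.last n) s.castSucc ⇔
    (fMem (Fin.last n) y.castSucc ⊔ fEq (Fin.last n) y.castSucc))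

/-- `v_w` is inductive: it contains `∅` and is closed under `y ↦ y ∪ {y}`. -/
def fInductive {n : ℕ} (w : Fin n) : Fm n :=
  (∃' (fMem (Fin.last n) w.castSucc ⊓ fEmpty (Fin.last n))) ⊓
  ∀' (fMem (Fin.last n) w.castSucc ⟹
    ∃' (fMem (Fin.last (n + 1)) w.castSucc.castSucc ⊓
      fSucc (Fin.last (n + 1)) (Fin.last n).castSucc))

/-- `v_w` is the least inductive set, i.e. `v_w = ω`. -/
def fOmega {n : ℕ} (w : Fin n) : Fm n :=
  fInductive w ⊓
  ∀' (fInductive (Fin.last n) ⟹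
    ∀' (fMem (Fin.last (n + 1)) w.castSucc.castSucc ⟹
      fMem (Fin.last (n + 1)) (Fin.last n).castSucc))

/-- `v_y` is the power set of `v_x`. -/
def fPower {n : ℕ} (y x : Fin n) : Fm n :=
  ∀' (fMem (Fin.last n) y.castSucc ⇔
    ∀' (fMem (Fin.last (n + 1)) (Fin.last n).castSucc ⟹
      fMem (Fin.last (n + 1)) x.castSucc.castSucc))

/-- `∀ x y, (∀ z, z ∈ x ↔ z ∈ y) → x = y`. -/
def axExtensionality : setLang.Sentence :=
  ((∀' (∀' ((∀' (fMem 2 0 ⇔ fMem 2 1)) ⟹ fEq 0 1))) : Fm 0)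

/-- `∀ x, (∃ y, y ∈ x) → ∃ y, y ∈ x ∧ ∀ z, z ∈ y → z ∉ x`. -/
def axFoundation : setLang.Sentence :=
  ((∀' ((∃' (fMem 1 0)) ⟹
    ∃' (fMem 1 0 ⊓ ∀' (fMem 2 1 ⟹ ∼(fMem 2 0))))) : Fm 0)

/-- `∀ x y, ∃ z, ∀ w, w ∈ z ↔ (w = x ∨ w = y)`. -/
def axPairing : setLang.Sentence :=
  ((∀' (∀' (∃' (∀' (fMem 3 2 ⇔ (fEq 3 0 ⊔ fEq 3 1)))))) : Fm 0)

/-- `∀ x, ∃ z, ∀ w, w ∈ z ↔ ∃ y, y ∈ x ∧ w ∈ y`. -/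
def axUnion : setLang.Sentence :=
  ((∀' (∃' (∀' (fMem 2 1 ⇔ ∃' (fMem 3 0 ⊓ fMem 2 3))))) : Fm 0)

/-- There is an inductive set. -/
def axInfinity : setLang.Sentence :=
  ((∃' (fInductive 0)) : Fm 0)

/-- The separation axiom for `φ` (with `m` parameters and one further variable):
`∀ params, ∀ a, ∃ b, ∀ x, x ∈ b ↔ (x ∈ a ∧ φ(params, x))`. -/
def axSeparation (m : ℕ) (φ : setLang.Formula (Fin m ⊕ Fin 1)) : setLang.Sentence :=
  FirstOrder.Language.BoundedFormula.alls (n := m)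
    (∀' (∃' (∀' (fMem (Fin.last (m + 2)) (Fin.last (m + 1)).castSucc ⇔
      (fMem (Fin.last (m + 2)) (Fin.last m).castSucc.castSucc ⊓
        fSubst φ (Sum.elim (fun i => Fin.castAdd 3 i) ![Fin.last (m + 2)]))))))

/-- The replacement axiom for `φ` (with `m` parameters and two further variables):
`∀ params, ∀ a, (∀ x, x ∈ a → ∃ y, ∀ z, φ(params, x, z) ↔ z = y) →
  ∃ b, ∀ y, y ∈ b ↔ ∃ x, x ∈ a ∧ φ(params, x, y)`. -/
def axReplacement (m : ℕ) (φ : setLang.Formula (Fin m ⊕ Fin 2)) : setLang.Sentence :=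
  FirstOrder.Language.BoundedFormula.alls (n := m)
    (∀' ((∀' (fMem (Fin.last (m + 1)) (Fin.last m).castSucc ⟹
        ∃' (∀' (fSubst φ (Sum.elim (fun i => Fin.castAdd 4 i)
            ![(Fin.last (m + 1)).castSucc.castSucc, Fin.last (m + 3)]) ⇔
          fEq (Fin.last (m + 3)) (Fin.last (m + 2)).castSucc)))) ⟹
      ∃' (∀' (fMem (Fin.last (m + 2)) (Fin.last (m + 1)).castSucc ⇔
        ∃' (fMem (Fin.last (m + 3)) (Fin.last m).castSucc.castSucc.castSucc ⊓
          fSubst φ (Sum.elim (fun i => Fin.castAdd 4 i)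
            ![Fin.last (m + 3), (Fin.last (m + 2)).castSucc]))))))

/-- The axiom of choice: every family of nonempty pairwise disjoint sets has a transversal. -/
def axChoice : setLang.Sentence :=
  ((∀' (((∀' (fMem 1 0 ⟹ ∃' (fMem 2 1))) ⊓
      (∀' (∀' (fMem 1 0 ⟹ (fMem 2 0 ⟹
        ∀' ((fMem 3 1 ⊓ fMem 3 2) ⟹ fEq 1 2)))))) ⟹
    ∃' (∀' (fMem 2 0 ⟹
      ∃' (∀' ((fMem 4 1 ⊓ fMem 4 2) ⇔ fEq 4 3)))))) : Fm 0)

/-- "`ℶ_ω` exists": there is a set that contains `ω` and, with each of its elements, also the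
power set of this element; equivalently (over the other axioms), the iterated power sets `ω`,
`𝒫(ω)`, `𝒫(𝒫(ω))`, … all exist, and so does the supremum `ℶ_ω` of their cardinalities. -/
def axBethOmega : setLang.Sentence :=
  ((∃' ((∃' (fMem 1 0 ⊓ fOmega 1)) ⊓
    ∀' (fMem 1 0 ⟹ ∃' (fMem 2 0 ⊓ fPower 2 1)))) : Fm 0)

/-- `ZFC⁻`: ZFC minus the power set axiom plus "`ℶ_ω` exists". -/
def ZFCminus : setLang.Theory :=
  {axExtensionality, axFoundation, axPairing, axUnion, axInfinity, axChoice, axBethOmega} ∪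
  {ψ | ∃ (m : ℕ) (φ : setLang.Formula (Fin m ⊕ Fin 1)), ψ = axSeparation m φ} ∪
  {ψ | ∃ (m : ℕ) (φ : setLang.Formula (Fin m ⊕ Fin 2)), ψ = axReplacement m φ}

/-! ### Reals and candidates -/

/-- Reals are elements of the Baire space `ω^ω`. -/
abbrev Real := ℕ → ℕ

/-- The von Neumann numeral `n` as a set. -/
def natSet : ℕ → ZFSet.{u}
  | 0 => ∅
  | n + 1 => insert (natSet n) (natSet n)

/-- The real `x` as a set: the set of Kuratowski pairs `(n, x n)`. -/
def realSet (x : Real) : ZFSet.{u} :=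
  ZFSet.range (fun n : ℕ => ZFSet.pair (natSet n) (natSet (x n)))

/-- A set with the (true) membership relation as a structure for the language `{∈}`. -/
@[reducible]
def memStructure (M : ZFSet.{u}) : setLang.Structure {x : ZFSet.{u} // x ∈ M} where
  funMap := fun f => f.elim
  RelMap := fun R v => match R with
    | MemRel.mem => (v 0).1 ∈ (v 1).1

/-- `M ⊨ T`. -/
def Satisfies (M : ZFSet.{u}) (T : setLang.Theory) : Prop :=
  letI := memStructure M
  {x : ZFSet.{u} // x ∈ M} ⊨ T

/-- `M` is a candidate: a countable transitive model of `T` that contains the parameter `r`. -/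
structure IsCandidate (T : setLang.Theory) (r : Real) (M : ZFSet.{u}) : Prop where
  transitive : M.IsTransitive
  countable : {x : ZFSet.{u} | x ∈ M}.Countable
  models : Satisfies M T
  param_mem : realSet r ∈ M

/-- The reals of `M`. -/
def realsOf (M : ZFSet.{u}) : Set Real := {x | realSet.{u} x ∈ M}

/-! ### Coded projective relations, evaluated in `V` or in a candidate

In what follows `W` is the set of reals of the model in which a definition is evaluated:
`W = Set.univ` for evaluation in `V`, and `W = realsOf M` for evaluation in a candidate `M`.
By transitivity, relativizing to `M` amounts to restricting real quantifiers to `realsOf M`. -/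

/-- The initial segment `x ↾ n`. -/
def initSeg (x : Real) (n : ℕ) : List ℕ := List.ofFn (fun i : Fin n => x i)

/-- The `Σ¹₁` set coded by `c`, evaluated in `W`: there is `y ∈ W` such that `(x, y)` is a branch
of the tree `{(s, t) | c(s, t) = 0}`. -/
def Sigma11 (c : Real) (W : Set Real) (x : Real) : Prop :=
  ∃ y ∈ W, ∀ n, c (Encodable.encode (initSeg x n, initSeg y n)) = 0

/-- The `Σ¹₂` set coded by `c`, evaluated in `W`: there is `y ∈ W` such that for no `z ∈ W` is
`(x, y, z)` a branch of the tree `{(s, t, u) | c(s, t, u) = 0}`. -/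
def Sigma12 (c : Real) (W : Set Real) (x : Real) : Prop :=
  ∃ y ∈ W, ∀ z ∈ W, ∃ n, c (Encodable.encode (initSeg x n, initSeg y n, initSeg z n)) ≠ 0

/-- A sequence of reals as one real. -/
def joinSeq (a : ℕ → Real) : Real := fun k => a k.unpair.1 k.unpair.2

/-- A pair of reals as one real. -/
def joinPair (x y : Real) : Real := fun k => if k % 2 = 0 then x (k / 2) else y (k / 2)

/-- An `(ω+1)`-tuple of reals as one real. -/
def joinOmega (b : ℕ → Real) (p : Real) : Real :=
  joinSeq (fun i => match i with
    | 0 => p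
    | i + 1 => b i)

/-- The `j`-th real coded by `r`. -/
def codeAt (r : Real) (j : ℕ) : Real := fun k => r (Nat.pair j k)

/-- The set of conditions `Q` coded by the parameter `r`, evaluated in `W`. -/
def cCond (r : Real) (W : Set Real) : Set Real := {x | x ∈ W ∧ Sigma11 (codeAt r 0) W x}

/-- The order `q ≤ p` coded by `r`, evaluated in `W`. -/
def cLe (r : Real) (W : Set Real) (q p : Real) : Prop := Sigma11 (codeAt r 1) W (joinPair q p)

/-- The `(ω+1)`-place relation `epd(b_i, p)` coded by `r`, evaluated in `W`. -/
def cEpd (r : Real) (W : Set Real) (b : ℕ → Real) (p : Real) : Prop :=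
  Sigma12 (codeAt r 2) W (joinOmega b p)

/-- The relation `q ≤_n p` coded by `r`, evaluated in `W`. -/
def cLeN (r : Real) (W : Set Real) (n : ℕ) (q p : Real) : Prop :=
  Sigma12 (codeAt r (n + 3)) W (joinPair q p)

/-- In `W`, the relation `≤` is a partial order on `Q`. -/
def OrderIn (r : Real) (W : Set Real) : Prop :=
  (∀ p ∈ cCond r W, cLe r W p p) ∧
  (∀ p ∈ cCond r W, ∀ q ∈ cCond r W, cLe r W p q → cLe r W q p → p = q) ∧
  (∀ p ∈ cCond r W, ∀ q ∈ cCond r W, ∀ s ∈ cCond r W, cLe r W p q → cLe r W q s → cLe r W p s)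

/-- In `W`, the set `{b i | i ∈ ω}` is predense below `p`: every `q ≤ p` is compatible with
some `b i`. -/
def PredenseIn (r : Real) (W : Set Real) (b : ℕ → Real) (p : Real) : Prop :=
  ∀ q ∈ cCond r W, cLe r W q p →
    ∃ i, ∃ s ∈ cCond r W, cLe r W s q ∧ cLe r W s (b i)

/-- In `W`, `epd(b_i, p)` implies that `{b i | i ∈ ω}` is predense below `p`. -/
def EpdSoundIn (r : Real) (W : Set Real) : Prop :=
  ∀ (b : ℕ → Real) (p : Real), joinSeq b ∈ W → (∀ i, b i ∈ cCond r W) → p ∈ cCond r W →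
    cEpd r W b p → PredenseIn r W b p

/-- The requirements on a coded forcing that are common to effective Axiom A and Suslin⁺:
in `V` and in all candidates, `≤` is a partial order on `Q` and `epd` implies predensity;
and `Q^M` is a set in every candidate `M`. -/
def IsCodedForcing (T : setLang.Theory) (r : Real) : Prop :=
  OrderIn r Set.univ ∧ EpdSoundIn r Set.univ ∧
  ∀ M : ZFSet.{u}, IsCandidate T r M →
    OrderIn r (realsOf M) ∧ EpdSoundIn r (realsOf M) ∧
    ∃ Z ∈ M, ∀ z, z ∈ Z ↔ ∃ x ∈ cCond r (realsOf M), realSet x = z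

/-- `D ∈ M`, and in `M` the set `D` is a dense subset of `Q`. -/
def IsDenseSubsetIn (r : Real) (M D : ZFSet.{u}) : Prop :=
  D ∈ M ∧
  (∀ z ∈ D, ∃ x ∈ cCond r (realsOf M), realSet x = z) ∧
  ∀ p ∈ cCond r (realsOf M), ∃ d ∈ cCond r (realsOf M), realSet d ∈ D ∧ cLe r (realsOf M) d p

/-- The forcing coded by `r` satisfies effective Axiom A (in the parameter `r`, with respect to
the theory `T`). -/
structure EffectiveAxiomA (T : setLang.Theory) (r : Real) : Prop where
  coded : IsCodedForcing.{u} T r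
  fusion : ∀ a : ℕ → Real, (∀ n, a n ∈ cCond r Set.univ) →
    (∀ n, cLeN r Set.univ n (a (n + 1)) (a n)) →
    ∃ q ∈ cCond r Set.univ, ∀ n, cLe r Set.univ q (a n)
  dense : ∀ M : ZFSet.{u}, IsCandidate T r M →
    ∀ p ∈ cCond r (realsOf M), ∀ (n : ℕ) (D : ZFSet.{u}), IsDenseSubsetIn r M D →
      ∃ q ∈ cCond r (realsOf M), cLeN r (realsOf M) n q p ∧
        ∃ b : ℕ → Real, joinSeq b ∈ realsOf M ∧ (∀ i, realSet (b i) ∈ D) ∧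
          cEpd r (realsOf M) b q

/-- The forcing coded by `r` is Suslin⁺ (in the parameter `r`, with respect to the theory `T`). -/
structure SuslinPlus (T : setLang.Theory) (r : Real) : Prop where
  coded : IsCodedForcing.{u} T r
  generic : ∀ M : ZFSet.{u}, IsCandidate T r M →
    ∀ p ∈ cCond r (realsOf M), ∃ q ∈ cCond r Set.univ, cLe r Set.univ q p ∧
      ∀ D : ZFSet.{u}, IsDenseSubsetIn r M D →
        ∃ d : ℕ → Real, (∀ z, z ∈ D ↔ ∃ i, realSet (d i) = z) ∧ cEpd r Set.univ d q

/-! ### The tree forcings -/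

/-- Nodes: finite sequences of natural numbers. `s <+: t` is "`s` is an initial segment of `t`". -/
abbrev Node := List ℕ

/-- `{n | s⌢n ∈ T}`. -/
def succs (T : Set Node) (s : Node) : Set ℕ := {n | s ++ [n] ∈ T}

/-- A nonempty set of nodes that is closed under initial segments. -/
def IsTree (T : Set Node) : Prop := T ∈ Descriptive.tree ℕ ∧ T.Nonempty

/-- Perfect trees. -/
def IsSacks (T : Set Node) : Prop :=
  IsTree T ∧ ∀ s ∈ T, ∃ t ∈ T, s <+: t ∧ (succs T t).Nontrivial

/-- Superperfect trees. -/
def IsMiller (T : Set Node) : Prop :=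
  IsTree T ∧ (∀ s ∈ T, (∃! n, n ∈ succs T s) ∨ (succs T s).Infinite) ∧
  ∀ s ∈ T, ∃ t ∈ T, s <+: t ∧ (succs T t).Infinite

/-- Rosłanowski trees. -/
def IsRoslanowski (T : Set Node) : Prop :=
  IsTree T ∧ (∀ s ∈ T, (∃! n, n ∈ succs T s) ∨ succs T s = Set.univ) ∧
  ∀ s ∈ T, ∃ t ∈ T, s <+: t ∧ succs T t = Set.univ

/-- `s` is the stem of `T`: a splitting node that is comparable with all nodes of `T`. -/
def IsStem (T : Set Node) (s : Node) : Prop :=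
  s ∈ T ∧ (succs T s).Nontrivial ∧ ∀ t ∈ T, t <+: s ∨ s <+: t

/-- Laver trees. -/
def IsLaver (T : Set Node) : Prop :=
  IsTree T ∧ ∃ s, IsStem T s ∧ ∀ t ∈ T, s <+: t → (succs T t).Infinite

/-- Names of the four forcings. -/
inductive TreeForcing
  | sacks | miller | roslanowski | laver

/-- The conditions of the four forcings; they are ordered by inclusion. -/
def IsCond : TreeForcing → Set Node → Prop
  | .sacks => IsSacks
  | .miller => IsMiller
  | .roslanowski => IsRoslanowski
  | .laver => IsLaver

/-- The splitting nodes `spl(p)`. -/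
def spl (p : Set Node) : Set Node := {s | s ∈ p ∧ (succs p s).Nontrivial}

/-- The `n`-th splitting level `spl(p, n)`: splitting nodes with exactly `n` splitting nodes
strictly below them. -/
def splN (p : Set Node) (n : ℕ) : Set Node :=
  {s | s ∈ spl p ∧ {t | t ∈ spl p ∧ t <+: s ∧ t ≠ s}.ncard = n}

/-- `q ≤_n p`. -/
def LeN (n : ℕ) (q p : Set Node) : Prop := q ⊆ p ∧ splN q n = splN p n

/-- `p^[s]`, the set of nodes of `p` comparable with `s`. -/
def restr (p : Set Node) (s : Node) : Set Node := {t | t ∈ p ∧ (t <+: s ∨ s <+: t)}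

open Classical in
/-- A set of nodes as a real: its characteristic function. -/
def nodeReal (A : Set Node) : Real := fun k => if ∃ s ∈ A, Encodable.encode s = k then 1 else 0

/-- In `W`, the set `F` is a front in `p`: an antichain contained in `p` that meets every
branch of `p`. -/
def FrontIn (W : Set Real) (F p : Set Node) : Prop :=
  F ⊆ p ∧ (∀ s ∈ F, ∀ t ∈ F, s <+: t → s = t) ∧
  ∀ x ∈ W, (∀ n, initSeg x n ∈ p) → ∃ n, initSeg x n ∈ F

/-- A relation between sequences of trees and trees, to be evaluated in each `W`. -/
abbrev EpdRel := Set Real → (ℕ → Set Node) → Set Node → Prop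

/-- Effectively predense, through fronts: there is a front `F ⊆ p` such that every `p^[t]`,
`t ∈ F`, is one of the `b i`. -/
def epdFront : EpdRel := fun W b p =>
  ∃ F : Set Node, nodeReal F ∈ W ∧ FrontIn W F p ∧ ∀ t ∈ F, ∃ i, b i = restr p t

/-- Effectively predense, through a splitting level. -/
def epdSplit : EpdRel := fun _ b p =>
  ∃ n, ∀ s ∈ splN p n, ∃ i, b i = restr p s

/-- In `W`, the parameter `r` defines the partial order of the forcing `Q`, ordered by `⊆`. -/
def DefinesOrderIn (Q : TreeForcing) (r : Real) (W : Set Real) : Prop :=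
  (∀ x, x ∈ cCond r W ↔ x ∈ W ∧ ∃ p, IsCond Q p ∧ nodeReal p = x) ∧
  ∀ p q, IsCond Q p → IsCond Q q → nodeReal p ∈ W → nodeReal q ∈ W →
    (cLe r W (nodeReal q) (nodeReal p) ↔ q ⊆ p)

/-- In `W`, the relations `≤_n` and `epd` that are coded by `r` are the relations `LeN n`
and `E` on the conditions of `Q`. -/
def DefinesAxiomAIn (Q : TreeForcing) (E : EpdRel) (r : Real) (W : Set Real) : Prop :=
  (∀ n p q, IsCond Q p → IsCond Q q → nodeReal p ∈ W → nodeReal q ∈ W →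
    (cLeN r W n (nodeReal q) (nodeReal p) ↔ LeN n q p)) ∧
  ∀ (b : ℕ → Set Node) (p : Set Node), (∀ i, IsCond Q (b i)) → IsCond Q p →
    joinSeq (fun i => nodeReal (b i)) ∈ W → nodeReal p ∈ W →
    (cEpd r W (fun i => nodeReal (b i)) (nodeReal p) ↔ E W b p)

/-- In `V` and in all candidates, `r` defines the forcing `Q`. -/
def DefinesOrder (T : setLang.Theory) (Q : TreeForcing) (r : Real) : Prop :=
  DefinesOrderIn Q r Set.univ ∧
  ∀ M : ZFSet.{u}, IsCandidate T r M → DefinesOrderIn Q r (realsOf M)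

/-- In `V` and in all candidates, `r` defines the relations `≤_n` and the relation `E`. -/
def DefinesAxiomA (T : setLang.Theory) (Q : TreeForcing) (E : EpdRel) (r : Real) : Prop :=
  DefinesAxiomAIn Q E r Set.univ ∧
  ∀ M : ZFSet.{u}, IsCandidate T r M → DefinesAxiomAIn Q E r (realsOf M)

end EffAxiomA

end

/-!
The proof has a set-theoretic half, which says what a candidate `M` knows about its reals, and a
combinatorial half about trees, which is then carried out inside `M`.

**Finitely many axioms.** `UDef` collects the predicates that one formula defines in all transitive
sets, and `Ensured P` says that `P` holds in all transitive models of some finite part of `ZFC⁻`.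
Since `Ensured` is closed under conjunction, it suffices to use separation, replacement, choice and
the power set tower finitely often, for predicates that are given in advance.

**The parameter.** The reals of a candidate have to be closed under arithmetical definability, that
is, form a set `W` with `ArithClosed W`. The generating operations come from separation, but a
number of recursive functions have to belong to `M` as well. Instead of defining recursive functions
inside `M`, their values are stored in the parameter. A code of a binary relation is only evaluated
at pairs of finite sequences of equal length, so other positions (`freePos`) are free to hold a
table, and `mkParam` merges codes and table into one real from which `M` can read the table
(`Ensured.table`). The table also holds the codes by which `M` recognizes the relations to which
comprehension is applied.

**Codes.** Codes have to be correct in `V` and in all candidates at once. An arithmetical predicate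
is handled semantically, through `IsArith`: it and its negation are projections of closed sets, and
for true instances a witness is found in every arithmetically closed set. This makes these
projections absolute between arithmetically closed sets and yields `exists_sigma11_code` and
`exists_sigma12_code`. In terms of immediate successors, being a condition, the order, `≤_n` and
`epd'` are arithmetical (`isCond_iff`), and `epd` has the form `∃ F (arithmetical ∧ no branch of the
tree avoids F)`, which is `Σ¹₂`.

**Fusion.** A node of length `k` has at most `k` splitting nodes below it, so after stage `k + 1` of
a fusion sequence nothing changes around it, and the intersection is a condition (`isCond_iInter`).

**Dense sets.** Let `D ∈ M` be dense. For Sacks, Miller and Rosłanowski forcing, choose in `M` an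
element of `D` below `p^[t]` for each immediate successor `t` of a node of the `n`-th splitting
level and take the union (`exists_leN_of_ne_laver`). These `t` form a front of the union, which also
shows `epd'` at level `n + 1`. For Laver forcing, let `A` be the set of stems of conditions in `D`
below `p`, and call a node `s` good if some condition below `p` with stem `s` has `A` as a bar. A
node with infinitely many good immediate successors is good; hence below a bad node there would be a
Laver condition all of whose nodes above the stem are bad, although its extension in `D` has a good
stem. So all nodes above the stem of `p` are good, and `p` can be thinned out along the minimal
nodes of the bars above its `n`-th splitting level (`exists_leN_laver`). The closure properties of
`M` behind this are comprehension with one real quantifier and countable choice for reals, stated in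
`IsRich`.

**Suslin⁺.** The relation `epdSub` weakens `epd`: every `p^[t]`, for `t` in the front, is
*contained* in some `b_i`. It therefore passes to stronger conditions. As `M` is countable, a fusion
that treats the sets of `M` one by one produces one condition below `p` for all dense sets of `M`.
Fronts in `M` remain fronts in `V`: the nodes not beyond the front form a tree in `M`, and a tree in
`M` with a branch in `V` has a branch in `M`, because `M` contains the well-founded part of the
tree, being able to collapse it by replacement (`Ensured.acc_mem`, `IsRich.exists_branch`).
-/

namespace EffAxiomA

open Denumerable (ofNat)

/-! ### Uniformly definable predicates over transitive sets -/

/-- The elements of the set `M`, the universe of the structure `memStructure M`. -/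
abbrev El (M : ZFSet.{u}) := {x : ZFSet.{u} // x ∈ M}

/-- A family of `n`-ary predicates, one on each set `M`, is uniformly definable if one and the
same formula defines it in all transitive `M`. -/
def UDef (n : ℕ) (P : ∀ M : ZFSet.{u}, (Fin n → El M) → Prop) : Prop :=
  ∃ φ : setLang.Formula (Fin n), ∀ M : ZFSet.{u}, M.IsTransitive → ∀ v : Fin n → El M,
    (letI := memStructure M; φ.Realize v) ↔ P M v

namespace UDef

variable {n : ℕ} {P Q : ∀ M : ZFSet.{u}, (Fin n → El M) → Prop}

theorem congr (h : UDef n P) (e : ∀ M : ZFSet.{u}, M.IsTransitive → ∀ v, P M v ↔ Q M v) :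
    UDef n Q := by
  obtain ⟨φ, hφ⟩ := h
  exact ⟨φ, fun M hM v => (hφ M hM v).trans (e M hM v)⟩

theorem mem (i j : Fin n) : UDef.{u} n (fun _ v => (v i).1 ∈ (v j).1) := by
  refine ⟨FirstOrder.Language.Relations.formula₂ (L := setLang) MemRel.mem
    (FirstOrder.Language.Term.var i) (FirstOrder.Language.Term.var j), fun M _ v => ?_⟩
  let _ := memStructure M
  exact Language.Formula.realize_rel₂

theorem eq (i j : Fin n) : UDef.{u} n (fun _ v => (v i).1 = (v j).1) := by
  refine ⟨FirstOrder.Language.Term.equal (FirstOrder.Language.Term.var i)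
    (FirstOrder.Language.Term.var j), fun M _ v => ?_⟩
  let _ := memStructure M
  rw [Language.Formula.realize_equal]
  exact Subtype.ext_iff

theorem not (h : UDef n P) : UDef n (fun M v => ¬ P M v) := by
  obtain ⟨φ, hφ⟩ := h
  refine ⟨φ.not, fun M hM v => ?_⟩
  let _ := memStructure M
  rw [Language.Formula.realize_not]
  exact not_congr (hφ M hM v)

theorem imp (h : UDef n P) (h' : UDef n Q) : UDef n (fun M v => P M v → Q M v) := by
  obtain ⟨φ, hφ⟩ := h
  obtain ⟨ψ, hψ⟩ := h'
  refine ⟨φ.imp ψ, fun M hM v => ?_⟩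
  let _ := memStructure M
  rw [Language.Formula.realize_imp]
  exact imp_congr (hφ M hM v) (hψ M hM v)

theorem and (h : UDef n P) (h' : UDef n Q) : UDef n (fun M v => P M v ∧ Q M v) :=
  (h.imp h'.not).not.congr fun _ _ _ => by tauto

theorem or (h : UDef n P) (h' : UDef n Q) : UDef n (fun M v => P M v ∨ Q M v) :=
  (h.not.imp h').congr fun _ _ _ => by tauto

theorem iff (h : UDef n P) (h' : UDef n Q) : UDef n (fun M v => P M v ↔ Q M v) :=
  ((h.imp h').and (h'.imp h)).congr fun _ _ _ => by tauto

theorem ex {P : ∀ M : ZFSet.{u}, El M → (Fin n → El M) → Prop}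
    (h : UDef (n + 1) (fun M w => P M (w 0) (fun i => w i.succ))) :
    UDef n (fun M v => ∃ x : El M, P M x v) := by
  obtain ⟨φ, hφ⟩ := h
  refine ⟨(FirstOrder.Language.BoundedFormula.relabel (n := 1) (k := 0)
    (Fin.cases (Sum.inr 0) Sum.inl : Fin (n + 1) → Fin n ⊕ Fin 1) φ :
      setLang.BoundedFormula (Fin n) 1).ex, fun M hM v => ?_⟩
  let _ := memStructure M
  rw [Language.Formula.Realize, Language.BoundedFormula.realize_ex]
  refine exists_congr fun a => ?_
  have := hφ M hM (Fin.cons a v)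
  refine Iff.trans ?_ this
  rw [Language.Formula.Realize]
  refine Language.BoundedFormula.realize_relabel.trans (iff_of_eq ?_)
  congr 1
  · funext i
    refine Fin.cases ?_ (fun i => ?_) i
    · rfl
    · rfl
  · exact Subsingleton.elim _ _

theorem all {P : ∀ M : ZFSet.{u}, El M → (Fin n → El M) → Prop}
    (h : UDef (n + 1) (fun M w => P M (w 0) (fun i => w i.succ))) :
    UDef n (fun M v => ∀ x : El M, P M x v) :=
  (UDef.ex (P := fun M x v => ¬ P M x v) h.not).not.congr fun _ _ _ => by
    simp only [not_exists, not_not]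

/-- Renaming of variables, not necessarily injective. -/
theorem reindex {m : ℕ} (h : UDef n P) (σ : Fin n → Fin m) :
    UDef m (fun M v => P M (fun i => v (σ i))) := by
  obtain ⟨φ, hφ⟩ := h
  refine ⟨φ.relabel σ, fun M hM v => ?_⟩
  let _ := memStructure M
  rw [Language.Formula.realize_relabel]
  exact hφ M hM _

theorem singleton (i j : Fin n) : UDef.{u} n (fun _ v => (v j).1 = {(v i).1}) := by
  refine (UDef.all (P := fun M x v => x.1 ∈ (v j).1 ↔ x.1 = (v i).1)
    (UDef.iff (UDef.mem _ _) (UDef.eq _ _))).congr fun M hM v => ?_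
  constructor
  · intro h
    ext z
    rw [ZFSet.mem_singleton]
    constructor
    · intro hz
      exact (h ⟨z, hM.mem_trans hz (v j).2⟩).1 hz
    · rintro rfl
      exact (h (v i)).2 rfl
  · intro h x
    rw [h, ZFSet.mem_singleton]

theorem doubleton (i j k : Fin n) : UDef.{u} n (fun _ v => (v k).1 = {(v i).1, (v j).1}) := by
  refine (UDef.all (P := fun M x v => x.1 ∈ (v k).1 ↔ (x.1 = (v i).1 ∨ x.1 = (v j).1))
    (UDef.iff (UDef.mem _ _) (UDef.or (UDef.eq _ _) (UDef.eq _ _)))).congr fun M hM v => ?_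
  constructor
  · intro h
    ext z
    rw [ZFSet.mem_pair]
    constructor
    · intro hz
      exact (h ⟨z, hM.mem_trans hz (v k).2⟩).1 hz
    · rintro (rfl | rfl)
      · exact (h (v i)).2 (Or.inl rfl)
      · exact (h (v j)).2 (Or.inr rfl)
  · intro h x
    rw [h, ZFSet.mem_pair]

/-- The components of a pair in a transitive set belong to the set, and so do the singleton and
the doubleton of which the pair consists. -/
theorem pair (i j k : Fin n) :
    UDef.{u} n (fun _ v => (v k).1 = ZFSet.pair (v i).1 (v j).1) := by
  refine (UDef.ex (P := fun M a v => ∃ b : El M, a.1 = {(v i).1} ∧ b.1 = {(v i).1, (v j).1} ∧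
    (v k).1 = {a.1, b.1}) (UDef.ex (UDef.and (UDef.singleton i.succ.succ 1)
      (UDef.and (UDef.doubleton i.succ.succ j.succ.succ 0)
        (UDef.doubleton 1 0 k.succ.succ))))).congr fun M hM v => ?_
  constructor
  · rintro ⟨a, b, ha, hb, h⟩
    rw [h, ha, hb]
    rfl
  · intro h
    have h1 : ({(v i).1} : ZFSet) ∈ (v k).1 := by
      rw [h, ZFSet.pair, ZFSet.mem_pair]; exact Or.inl rfl
    have h2 : ({(v i).1, (v j).1} : ZFSet) ∈ (v k).1 := by
      rw [h, ZFSet.pair, ZFSet.mem_pair]; exact Or.inr rfl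
    exact ⟨⟨_, hM.mem_trans h1 (v k).2⟩, ⟨_, hM.mem_trans h2 (v k).2⟩, rfl, rfl, h⟩

/-- The predicate `f(a) = b` for functions as sets of Kuratowski pairs. -/
theorem app (f a b : Fin n) :
    UDef.{u} n (fun _ v => ZFSet.pair (v a).1 (v b).1 ∈ (v f).1) := by
  refine (UDef.ex (P := fun M p v => p.1 = ZFSet.pair (v a).1 (v b).1 ∧ p.1 ∈ (v f).1)
    (UDef.and (UDef.pair a.succ b.succ 0) (UDef.mem _ _))).congr fun M hM v => ?_
  constructor
  · rintro ⟨p, hp, h⟩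
    rwa [← hp]
  · intro h
    exact ⟨⟨_, hM.mem_trans h (v f).2⟩, rfl, h⟩

theorem succ (i j : Fin n) : UDef.{u} n (fun _ v => (v j).1 = insert (v i).1 (v i).1) := by
  refine (UDef.all (P := fun M x v => x.1 ∈ (v j).1 ↔ (x.1 = (v i).1 ∨ x.1 ∈ (v i).1))
    (UDef.iff (UDef.mem _ _) (UDef.or (UDef.eq _ _) (UDef.mem _ _)))).congr fun M hM v => ?_
  constructor
  · intro h
    ext z
    rw [ZFSet.mem_insert_iff]
    constructor
    · intro hz
      exact (h ⟨z, hM.mem_trans hz (v j).2⟩).1 hz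
    · rintro (rfl | hz)
      · exact (h (v i)).2 (Or.inl rfl)
      · exact (h ⟨z, hM.mem_trans hz (v i).2⟩).2 (Or.inr hz)
  · intro h x
    rw [h, ZFSet.mem_insert_iff]

end UDef

/-! ### Consequences of finitely many axioms -/

/-- The property `P` of transitive sets follows from finitely many axioms of `ZFC⁻`. -/
def Ensured (P : ZFSet.{u} → Prop) : Prop :=
  ∃ T₀ : setLang.Theory, T₀.Finite ∧ T₀ ⊆ ZFCminus ∧
    ∀ M : ZFSet.{u}, M.IsTransitive → Satisfies M T₀ → P M

namespace Ensured

variable {P Q : ZFSet.{u} → Prop}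

theorem mono (h : Ensured P) (f : ∀ M : ZFSet.{u}, M.IsTransitive → P M → Q M) : Ensured Q := by
  obtain ⟨T, h1, h2, h3⟩ := h
  exact ⟨T, h1, h2, fun M hM hT => f M hM (h3 M hM hT)⟩

theorem _root_.EffAxiomA.Satisfies.weaken {M : ZFSet.{u}} {T T' : setLang.Theory}
    (h : Satisfies M T') (hT : T ⊆ T') : Satisfies M T := by
  let _ := memStructure M
  have : El M ⊨ T' := h
  exact this.mono hT

theorem and (h : Ensured P) (h' : Ensured Q) : Ensured (fun M => P M ∧ Q M) := by
  obtain ⟨T, h1, h2, h3⟩ := h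
  obtain ⟨T', h1', h2', h3'⟩ := h'
  refine ⟨T ∪ T', h1.union h1', Set.union_subset h2 h2', fun M hM hT => ⟨?_, ?_⟩⟩
  · exact h3 M hM (hT.weaken Set.subset_union_left)
  · exact h3' M hM (hT.weaken Set.subset_union_right)

/-- A single axiom of `ZFC⁻` ensures its consequences in transitive models. -/
theorem of_axiom {ψ : setLang.Sentence} (hψ : ψ ∈ ZFCminus) (h : ∀ M : ZFSet.{u}, M.IsTransitive →
    (letI := memStructure M; El M ⊨ ψ) → P M) : Ensured P := by
  refine ⟨{ψ}, Set.finite_singleton _, by simpa using hψ, fun M hM hT => h M hM ?_⟩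
  let _ := memStructure M
  have : El M ⊨ ({ψ} : setLang.Theory) := hT
  exact this.realize_of_mem ψ rfl

end Ensured

section Realize

variable (M : ZFSet.{u})

theorem realize_fMem {n : ℕ} (i j : Fin n) (v : Empty → El M) (xs : Fin n → El M) :
    letI := memStructure M
    (fMem i j).Realize v xs ↔ (xs i).1 ∈ (xs j).1 := by
  let _ := memStructure M
  exact Language.BoundedFormula.realize_rel₂

theorem realize_fEq {n : ℕ} (i j : Fin n) (v : Empty → El M) (xs : Fin n → El M) :
    letI := memStructure M
    (fEq i j).Realize v xs ↔ xs i = xs j := by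
  let _ := memStructure M
  exact Iff.rfl

theorem realize_fSubst {κ : Type} {n : ℕ} (φ : setLang.Formula κ) (σ : κ → Fin n)
    (v : Empty → El M) (xs : Fin n → El M) :
    letI := memStructure M
    (fSubst φ σ).Realize v xs ↔ φ.Realize (fun k => xs (σ k)) := by
  let _ := memStructure M
  unfold fSubst
  refine (Language.BoundedFormula.realize_relabel (n := 0) (φ := φ)).trans (iff_of_eq ?_)
  rw [Language.Formula.Realize]
  congr 1
  exact Subsingleton.elim _ _

/-- The separation schema for uniformly definable predicates; the variable `0` is the element. -/
theorem Ensured.separation {m : ℕ} {P : ∀ M : ZFSet.{u}, (Fin (m + 1) → El M) → Prop}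
    (h : UDef (m + 1) P) : Ensured (fun M => ∀ (v : Fin m → El M) (a : El M), ∃ b : El M,
      ∀ x : El M, x.1 ∈ b.1 ↔ x.1 ∈ a.1 ∧ P M (Fin.cons x v)) := by
  obtain ⟨φ, hφ⟩ := h
  let ψ : setLang.Formula (Fin m ⊕ Fin 1) := φ.relabel (Fin.cases (Sum.inr 0) Sum.inl)
  refine Ensured.of_axiom (ψ := axSeparation m ψ) (Or.inl (Or.inr ⟨m, ψ, rfl⟩)) fun M hM hT => ?_
  intro v a
  let _ := memStructure M
  have h1 := (Language.BoundedFormula.realize_alls (M := El M)).1 hT v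
  have h2 := h1 a
  rw [Language.BoundedFormula.realize_ex] at h2
  obtain ⟨b, hb⟩ := h2
  refine ⟨b, fun x => ?_⟩
  have h3 := hb x
  rw [Language.BoundedFormula.realize_iff, Language.BoundedFormula.realize_inf, realize_fMem,
    realize_fMem, realize_fSubst] at h3
  have e : (Fin.snoc (Fin.snoc (Fin.snoc v a : Fin (m + 1) → El M) b : Fin (m + 2) → El M) x :
      Fin (m + 3) → El M) (Fin.last (m + 1)).castSucc = b := by
    rw [Fin.snoc_castSucc, Fin.snoc_last]
  have e' : (Fin.snoc (Fin.snoc (Fin.snoc v a : Fin (m + 1) → El M) b : Fin (m + 2) → El M) x :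
      Fin (m + 3) → El M) (Fin.last m).castSucc.castSucc = a := by
    rw [Fin.snoc_castSucc, Fin.snoc_castSucc, Fin.snoc_last]
  rw [Fin.snoc_last, e, e'] at h3
  rw [h3, ← hφ M hM]
  refine and_congr_right fun _ => ?_
  rw [Language.Formula.realize_relabel]
  refine iff_of_eq (congrArg _ ?_)
  funext i
  refine Fin.cases ?_ (fun i => ?_) i
  · change (Fin.snoc (Fin.snoc (Fin.snoc v a : Fin (m + 1) → El M) b : Fin (m + 2) → El M) x :
      Fin (m + 3) → El M) (Fin.last (m + 2)) = x
    rw [Fin.snoc_last]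
  · change (Fin.snoc (Fin.snoc (Fin.snoc v a : Fin (m + 1) → El M) b : Fin (m + 2) → El M) x :
      Fin (m + 3) → El M) i.castSucc.castSucc.castSucc = v i
    rw [Fin.snoc_castSucc, Fin.snoc_castSucc, Fin.snoc_castSucc]

/-- The replacement schema for uniformly definable predicates; the variables `0` and `1` are
the argument and the value. -/
theorem Ensured.replacement {m : ℕ} {P : ∀ M : ZFSet.{u}, (Fin (m + 2) → El M) → Prop}
    (h : UDef (m + 2) P) : Ensured (fun M => ∀ (v : Fin m → El M) (a : El M),
      (∀ x : El M, x.1 ∈ a.1 → ∃ y : El M, ∀ z : El M,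
        P M (Fin.cons x (Fin.cons z v)) ↔ z = y) → ∃ b : El M,
      ∀ y : El M, y.1 ∈ b.1 ↔ ∃ x : El M, x.1 ∈ a.1 ∧ P M (Fin.cons x (Fin.cons y v))) := by
  obtain ⟨φ, hφ⟩ := h
  let ψ : setLang.Formula (Fin m ⊕ Fin 2) :=
    φ.relabel (Fin.cases (Sum.inr 0) (Fin.cases (Sum.inr 1) Sum.inl))
  refine Ensured.of_axiom (ψ := axReplacement m ψ) (Or.inr ⟨m, ψ, rfl⟩) fun M hM hT => ?_
  intro v a
  let _ := memStructure M
  have key : ∀ (x z : El M) (f : Fin m ⊕ Fin 2 → El M), (∀ i, f (Sum.inl i) = v i) →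
      f (Sum.inr 0) = x → f (Sum.inr 1) = z →
      (ψ.Realize f ↔ P M (Fin.cons x (Fin.cons z v))) := by
    intro x z f h1 h2 h3
    rw [← hφ M hM, Language.Formula.realize_relabel]
    refine iff_of_eq (congrArg _ ?_)
    funext i
    refine Fin.cases ?_ (Fin.cases ?_ fun i => ?_) i
    · exact h2
    · exact h3
    · exact h1 i
  have h1 := (Language.BoundedFormula.realize_alls (M := El M)).1 hT v a
  rw [Language.BoundedFormula.realize_imp] at h1
  intro hfun
  have h2 := h1 (by
    intro x
    rw [Language.BoundedFormula.realize_imp, realize_fMem, Fin.snoc_last, Fin.snoc_castSucc,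
      Fin.snoc_last, Language.BoundedFormula.realize_ex]
    intro hx
    obtain ⟨y, hy⟩ := hfun x hx
    refine ⟨y, fun z => ?_⟩
    rw [Language.BoundedFormula.realize_iff, realize_fSubst, realize_fEq, Fin.snoc_last,
      Fin.snoc_castSucc, Fin.snoc_last, ← hy z]
    refine key x z _ (fun i => ?_) ?_ ?_
    · change (Fin.snoc (Fin.snoc (Fin.snoc (Fin.snoc v a : Fin (m + 1) → El M) x :
        Fin (m + 2) → El M) y : Fin (m + 3) → El M) z :
        Fin (m + 4) → El M) i.castSucc.castSucc.castSucc.castSucc = v i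
      simp only [Fin.snoc_castSucc]
    · simp [Fin.snoc_castSucc, Fin.snoc_last]
    · simp [Fin.snoc_last])
  rw [Language.BoundedFormula.realize_ex] at h2
  obtain ⟨b, hb⟩ := h2
  refine ⟨b, fun y => ?_⟩
  have h3 := hb y
  rw [Language.BoundedFormula.realize_iff, realize_fMem, Fin.snoc_last, Fin.snoc_castSucc,
      Fin.snoc_last, Language.BoundedFormula.realize_ex] at h3
  rw [h3]
  refine exists_congr fun x => ?_
  rw [Language.BoundedFormula.realize_inf, realize_fMem, realize_fSubst]
  refine and_congr ?_ (key x y _ (fun i => ?_) ?_ ?_)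
  · simp only [Fin.snoc_castSucc, Fin.snoc_last]
  · change (Fin.snoc (Fin.snoc (Fin.snoc (Fin.snoc v a : Fin (m + 1) → El M) b :
        Fin (m + 2) → El M) y : Fin (m + 3) → El M) x :
        Fin (m + 4) → El M) i.castSucc.castSucc.castSucc.castSucc = v i
    simp only [Fin.snoc_castSucc]
  · simp [Fin.snoc_last]
  · simp [Fin.snoc_castSucc, Fin.snoc_last]

theorem Ensured.pairing : Ensured.{u} (fun M => ∀ x ∈ M, ∀ y ∈ M, ({x, y} : ZFSet) ∈ M) := by
  refine Ensured.of_axiom (ψ := axPairing) (Or.inl (Or.inl (by simp))) fun M hM hT x hx y hy => ?_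
  let _ := memStructure M
  have h1 : (∃' (∀' (fMem 3 2 ⇔ (fEq 3 0 ⊔ fEq 3 1))) : Fm 2).Realize (M := El M) default
    (Fin.snoc (Fin.snoc default ⟨x, hx⟩ : Fin 1 → El M) ⟨y, hy⟩ : Fin 2 → El M) :=
    hT ⟨x, hx⟩ ⟨y, hy⟩
  rw [Language.BoundedFormula.realize_ex] at h1
  obtain ⟨z, hz⟩ := h1
  have : z.1 = {x, y} := by
    ext w
    rw [ZFSet.mem_pair]
    have key : ∀ w : El M, w.1 ∈ z.1 ↔ w = ⟨x, hx⟩ ∨ w = ⟨y, hy⟩ := by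
      intro w
      have := hz w
      rw [Language.BoundedFormula.realize_iff, Language.BoundedFormula.realize_sup, realize_fMem,
        realize_fEq, realize_fEq] at this
      exact this
    constructor
    · intro hw
      have := (key ⟨w, hM.mem_trans hw z.2⟩).1 hw
      simpa [Subtype.ext_iff] using this
    · rintro (rfl | rfl)
      · exact (key ⟨w, hx⟩).2 (Or.inl rfl)
      · exact (key ⟨w, hy⟩).2 (Or.inr rfl)
  rw [← this]
  exact z.2

theorem Ensured.union : Ensured.{u} (fun M => ∀ x ∈ M, (ZFSet.sUnion x) ∈ M) := by
  refine Ensured.of_axiom (ψ := axUnion) (Or.inl (Or.inl (by simp))) fun M hM hT x hx => ?_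
  let _ := memStructure M
  have h1 : (∃' (∀' (fMem 2 1 ⇔ ∃' (fMem 3 0 ⊓ fMem 2 3))) : Fm 1).Realize (M := El M) default
    (Fin.snoc default ⟨x, hx⟩ : Fin 1 → El M) := hT ⟨x, hx⟩
  rw [Language.BoundedFormula.realize_ex] at h1
  obtain ⟨z, hz⟩ := h1
  have : z.1 = ZFSet.sUnion x := by
    ext w
    rw [ZFSet.mem_sUnion]
    have key : ∀ w : El M, w.1 ∈ z.1 ↔ ∃ t : El M, t.1 ∈ x ∧ w.1 ∈ t.1 := by
      intro w
      have := hz w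
      rw [Language.BoundedFormula.realize_iff, Language.BoundedFormula.realize_ex,
        realize_fMem] at this
      refine this.trans (exists_congr fun t => ?_)
      rw [Language.BoundedFormula.realize_inf, realize_fMem, realize_fMem]
      exact Iff.rfl
    constructor
    · intro hw
      obtain ⟨t, h1, h2⟩ := (key ⟨w, hM.mem_trans hw z.2⟩).1 hw
      exact ⟨t, h1, h2⟩
    · rintro ⟨t, h1, h2⟩
      have ht := hM.mem_trans h1 hx
      exact (key ⟨w, hM.mem_trans h2 ht⟩).2 ⟨⟨t, ht⟩, h1, h2⟩
  rw [← this]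
  exact z.2

/-- The axiom of choice in the form of transversals of families of disjoint nonempty sets. -/
theorem Ensured.choice : Ensured.{u} (fun M => ∀ A ∈ M, (∀ a ∈ A, ∃ y, y ∈ a) →
    (∀ a ∈ A, ∀ b ∈ A, ∀ y, y ∈ a → y ∈ b → a = b) →
    ∃ C ∈ M, ∀ a ∈ A, ∃ y, ∀ z, (z ∈ a ∧ z ∈ C) ↔ z = y) := by
  refine Ensured.of_axiom (ψ := axChoice) (Or.inl (Or.inl (by simp))) fun M hM hT A hA hne hd => ?_
  let _ := memStructure M
  have h1 := hT ⟨A, hA⟩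
  rw [Language.BoundedFormula.realize_imp] at h1
  have h2 := h1 (by
    rw [Language.BoundedFormula.realize_inf]
    constructor
    · intro a
      rw [Language.BoundedFormula.realize_imp, realize_fMem, Language.BoundedFormula.realize_ex]
      intro ha
      obtain ⟨y, hy⟩ := hne a.1 ha
      refine ⟨⟨y, hM.mem_trans hy a.2⟩, ?_⟩
      rw [realize_fMem]
      exact hy
    · intro a b
      rw [Language.BoundedFormula.realize_imp, Language.BoundedFormula.realize_imp, realize_fMem,
        realize_fMem]
      intro ha hb y
      rw [Language.BoundedFormula.realize_imp, Language.BoundedFormula.realize_inf, realize_fMem,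
        realize_fMem, realize_fEq]
      rintro ⟨h1, h2⟩
      exact Subtype.ext (hd a.1 ha b.1 hb y.1 h1 h2))
  rw [Language.BoundedFormula.realize_ex] at h2
  obtain ⟨C, hC⟩ := h2
  refine ⟨C.1, C.2, fun a ha => ?_⟩
  have haM := hM.mem_trans ha hA
  have h3 := hC ⟨a, haM⟩
  rw [Language.BoundedFormula.realize_imp, realize_fMem, Language.BoundedFormula.realize_ex] at h3
  obtain ⟨y, hy⟩ := h3 ha
  have key : ∀ z : El M, (z.1 ∈ a ∧ z.1 ∈ C.1) ↔ z = y := by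
    intro z
    have := hy z
    rw [Language.BoundedFormula.realize_iff, Language.BoundedFormula.realize_inf, realize_fMem,
      realize_fMem, realize_fEq] at this
    exact and_comm.trans this
  refine ⟨y.1, fun z => ⟨fun hz => ?_, ?_⟩⟩
  · exact congrArg Subtype.val ((key ⟨z, hM.mem_trans hz.1 haM⟩).1 hz)
  · rintro rfl
    exact (key y).2 rfl

end Realize

/-! ### Natural numbers and reals as sets -/

theorem mem_natSet {x : ZFSet.{u}} {n : ℕ} : x ∈ natSet n ↔ ∃ m < n, x = natSet m := by
  induction n with
  | zero => simp [natSet]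
  | succ n ih =>
    rw [natSet, ZFSet.mem_insert_iff, ih]
    constructor
    · rintro (rfl | ⟨m, hm, rfl⟩)
      · exact ⟨n, by omega, rfl⟩
      · exact ⟨m, by omega, rfl⟩
    · rintro ⟨m, hm, rfl⟩
      rcases Nat.lt_succ_iff_lt_or_eq.1 hm with h | rfl
      · exact Or.inr ⟨m, h, rfl⟩
      · exact Or.inl rfl

theorem natSet_injective : Function.Injective natSet.{u} := by
  intro m n h
  rcases lt_trichotomy m n with hl | rfl | hl
  · have h' : natSet.{u} m ∈ natSet n := mem_natSet.2 ⟨m, hl, rfl⟩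
    exact absurd (h ▸ h') (ZFSet.mem_irrefl _)
  · rfl
  · have h' : natSet.{u} n ∈ natSet m := mem_natSet.2 ⟨n, hl, rfl⟩
    exact absurd (h ▸ h') (ZFSet.mem_irrefl _)

@[simp] theorem natSet_inj {m n : ℕ} : natSet.{u} m = natSet n ↔ m = n := natSet_injective.eq_iff

@[simp] theorem natSet_mem_natSet {m n : ℕ} : natSet.{u} m ∈ natSet n ↔ m < n := by
  rw [mem_natSet]
  constructor
  · rintro ⟨k, hk, h⟩
    rwa [natSet_inj.1 h]
  · exact fun h => ⟨m, h, rfl⟩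

/-- The set `ω` of von Neumann numerals. -/
noncomputable def omegaSet : ZFSet.{u} := ZFSet.range natSet.{u}

theorem mem_omegaSet {x : ZFSet.{u}} : x ∈ omegaSet ↔ ∃ n, natSet n = x := ZFSet.mem_range

theorem natSet_mem_omegaSet (n : ℕ) : natSet.{u} n ∈ omegaSet := mem_omegaSet.2 ⟨n, rfl⟩

theorem omegaSet_transitive : omegaSet.{u}.IsTransitive := by
  intro y hy x hx
  obtain ⟨n, rfl⟩ := mem_omegaSet.1 hy
  obtain ⟨m, -, rfl⟩ := mem_natSet.1 hx
  exact natSet_mem_omegaSet m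

theorem mem_realSet {z : ZFSet.{u}} {x : Real} :
    z ∈ realSet x ↔ ∃ n, ZFSet.pair (natSet n) (natSet (x n)) = z := ZFSet.mem_range

@[simp] theorem pair_mem_realSet {x : Real} {a b : ℕ} :
    ZFSet.pair (natSet.{u} a) (natSet b) ∈ realSet x ↔ x a = b := by
  rw [mem_realSet]
  constructor
  · rintro ⟨n, h⟩
    rw [ZFSet.pair_inj, natSet_inj, natSet_inj] at h
    rw [← h.1, h.2]
  · rintro rfl
    exact ⟨a, rfl⟩

theorem realSet_injective : Function.Injective realSet.{u} := by
  intro x y h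
  funext n
  have : ZFSet.pair (natSet.{u} n) (natSet (x n)) ∈ realSet y := h ▸ pair_mem_realSet.2 rfl
  exact (pair_mem_realSet.1 this).symm

@[simp] theorem realSet_inj {x y : Real} : realSet.{u} x = realSet y ↔ x = y :=
  realSet_injective.eq_iff

/-- A set is (the graph of) a real if and only if it is a function from `ω` to `ω`. -/
theorem exists_realSet_eq_iff {z : ZFSet.{u}} : (∃ x, realSet x = z) ↔
    (∀ p ∈ z, ∃ a ∈ omegaSet.{u}, ∃ b ∈ omegaSet.{u}, p = ZFSet.pair a b) ∧
    ∀ a ∈ omegaSet.{u}, ∃ b ∈ omegaSet.{u}, ∀ c ∈ omegaSet.{u}, ZFSet.pair a c ∈ z ↔ c = b := by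
  constructor
  · rintro ⟨x, rfl⟩
    refine ⟨fun p hp => ?_, fun a ha => ?_⟩
    · obtain ⟨n, rfl⟩ := mem_realSet.1 hp
      exact ⟨_, natSet_mem_omegaSet _, _, natSet_mem_omegaSet _, rfl⟩
    · obtain ⟨n, rfl⟩ := mem_omegaSet.1 ha
      refine ⟨_, natSet_mem_omegaSet (x n), fun c hc => ?_⟩
      obtain ⟨m, rfl⟩ := mem_omegaSet.1 hc
      rw [pair_mem_realSet, natSet_inj, eq_comm]
  · rintro ⟨h1, h2⟩
    have h3 : ∀ n : ℕ, ∃ m : ℕ, ∀ k : ℕ, ZFSet.pair (natSet n) (natSet k) ∈ z ↔ k = m := by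
      intro n
      obtain ⟨b, hb, h⟩ := h2 _ (natSet_mem_omegaSet n)
      obtain ⟨m, rfl⟩ := mem_omegaSet.1 hb
      refine ⟨m, fun k => ?_⟩
      rw [h _ (natSet_mem_omegaSet k), natSet_inj]
    choose x hx using h3
    refine ⟨x, ?_⟩
    ext p
    rw [mem_realSet]
    constructor
    · rintro ⟨n, rfl⟩
      exact (hx n _).2 rfl
    · intro hp
      obtain ⟨a, ha, b, hb, rfl⟩ := h1 p hp
      obtain ⟨n, rfl⟩ := mem_omegaSet.1 ha
      obtain ⟨m, rfl⟩ := mem_omegaSet.1 hb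
      exact ⟨n, by rw [(hx n m).1 hp]⟩

/-! ### The first infinite power sets in a model -/

/-- `w` contains `∅` and is closed under the successor `y ↦ y ∪ {y}`. -/
def IsInductive (w : ZFSet.{u}) : Prop := ∅ ∈ w ∧ ∀ y ∈ w, insert y y ∈ w

theorem IsInductive.natSet_mem {w : ZFSet.{u}} (h : IsInductive w) (n : ℕ) : natSet n ∈ w := by
  induction n with
  | zero => exact h.1
  | succ n ih => exact h.2 _ ih

section Realize

variable {M : ZFSet.{u}} (hM : M.IsTransitive)
include hM

theorem realize_fEmpty {n : ℕ} (i : Fin n) (v : Empty → El M) (xs : Fin n → El M) :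
    letI := memStructure M
    (fEmpty i).Realize v xs ↔ (xs i).1 = ∅ := by
  let _ := memStructure M
  rw [ZFSet.eq_empty]
  constructor
  · intro h y hy
    have := h ⟨y, hM.mem_trans hy (xs i).2⟩
    rw [Language.BoundedFormula.realize_not, realize_fMem, Fin.snoc_last, Fin.snoc_castSucc] at this
    exact this hy
  · intro h y
    rw [Language.BoundedFormula.realize_not, realize_fMem, Fin.snoc_last, Fin.snoc_castSucc]
    exact h y.1

theorem realize_fSucc {n : ℕ} (s y : Fin n) (v : Empty → El M) (xs : Fin n → El M) :
    letI := memStructure M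
    (fSucc s y).Realize v xs ↔ (xs s).1 = insert (xs y).1 (xs y).1 := by
  let _ := memStructure M
  have key : (fSucc s y).Realize v xs ↔
      ∀ z : El M, z.1 ∈ (xs s).1 ↔ (z.1 ∈ (xs y).1 ∨ z = xs y) := by
    refine forall_congr' fun z => ?_
    rw [Language.BoundedFormula.realize_iff, Language.BoundedFormula.realize_sup, realize_fMem,
      realize_fMem, realize_fEq]
    simp only [Fin.snoc_last, Fin.snoc_castSucc]
  rw [key]
  constructor
  · intro h
    ext z
    rw [ZFSet.mem_insert_iff]
    constructor
    · intro hz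
      have := (h ⟨z, hM.mem_trans hz (xs s).2⟩).1 hz
      rcases this with h | h
      · exact Or.inr h
      · exact Or.inl (congrArg Subtype.val h)
    · rintro (rfl | hz)
      · exact (h _).2 (Or.inr rfl)
      · exact (h ⟨z, hM.mem_trans hz (xs y).2⟩).2 (Or.inl hz)
  · intro h z
    rw [h, ZFSet.mem_insert_iff, or_comm, Subtype.ext_iff]

theorem realize_fInductive {n : ℕ} (w : Fin n) (v : Empty → El M) (xs : Fin n → El M) :
    letI := memStructure M
    (fInductive w).Realize v xs ↔ IsInductive (xs w).1 := by
  let _ := memStructure M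
  unfold fInductive IsInductive
  rw [Language.BoundedFormula.realize_inf, Language.BoundedFormula.realize_ex]
  refine and_congr ?_ ?_
  · constructor
    · rintro ⟨a, ha⟩
      rw [Language.BoundedFormula.realize_inf, realize_fMem, realize_fEmpty hM] at ha
      simp only [Fin.snoc_last, Fin.snoc_castSucc] at ha
      rw [← ha.2]
      exact ha.1
    · intro h
      refine ⟨⟨∅, hM.mem_trans h (xs w).2⟩, ?_⟩
      rw [Language.BoundedFormula.realize_inf, realize_fMem, realize_fEmpty hM]
      simp only [Fin.snoc_last, Fin.snoc_castSucc]
      exact ⟨h, trivial⟩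
  · constructor
    · intro h y hy
      have h1 := h ⟨y, hM.mem_trans hy (xs w).2⟩
      rw [Language.BoundedFormula.realize_imp, realize_fMem,
        Language.BoundedFormula.realize_ex] at h1
      simp only [Fin.snoc_last, Fin.snoc_castSucc] at h1
      obtain ⟨s, hs⟩ := h1 hy
      rw [Language.BoundedFormula.realize_inf, realize_fMem, realize_fSucc hM] at hs
      simp only [Fin.snoc_last, Fin.snoc_castSucc] at hs
      rw [← hs.2]
      exact hs.1
    · intro h y
      rw [Language.BoundedFormula.realize_imp, realize_fMem,
        Language.BoundedFormula.realize_ex]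
      simp only [Fin.snoc_last, Fin.snoc_castSucc]
      intro hy
      refine ⟨⟨_, hM.mem_trans (h y.1 hy) (xs w).2⟩, ?_⟩
      rw [Language.BoundedFormula.realize_inf, realize_fMem, realize_fSucc hM]
      simp only [Fin.snoc_last, Fin.snoc_castSucc]
      exact ⟨h y.1 hy, trivial⟩

theorem realize_fOmega {n : ℕ} (w : Fin n) (v : Empty → El M) (xs : Fin n → El M) :
    letI := memStructure M
    (fOmega w).Realize v xs ↔ IsInductive (xs w).1 ∧ ∀ w' ∈ M, IsInductive w' →
      (xs w).1 ⊆ w' := by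
  let _ := memStructure M
  unfold fOmega
  rw [Language.BoundedFormula.realize_inf, realize_fInductive hM]
  refine and_congr_right fun _ => ?_
  constructor
  · intro h w' hw' hi x hx
    have h1 := h ⟨w', hw'⟩
    rw [Language.BoundedFormula.realize_imp, realize_fInductive hM, Fin.snoc_last] at h1
    have h2 := h1 hi ⟨x, hM.mem_trans hx (xs w).2⟩
    rw [Language.BoundedFormula.realize_imp, realize_fMem, realize_fMem] at h2
    simp only [Fin.snoc_last, Fin.snoc_castSucc] at h2
    exact h2 hx
  · intro h w'
    rw [Language.BoundedFormula.realize_imp, realize_fInductive hM, Fin.snoc_last]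
    intro hi x
    rw [Language.BoundedFormula.realize_imp, realize_fMem, realize_fMem]
    simp only [Fin.snoc_last, Fin.snoc_castSucc]
    exact fun hx => h w'.1 w'.2 hi hx

theorem realize_fPower {n : ℕ} (y x : Fin n) (v : Empty → El M) (xs : Fin n → El M) :
    letI := memStructure M
    (fPower y x).Realize v xs ↔ ∀ t ∈ M, t ∈ (xs y).1 ↔ t ⊆ (xs x).1 := by
  let _ := memStructure M
  have key : (fPower y x).Realize v xs ↔
      ∀ t : El M, t.1 ∈ (xs y).1 ↔ ∀ s : El M, s.1 ∈ t.1 → s.1 ∈ (xs x).1 := by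
    refine forall_congr' fun z => ?_
    rw [Language.BoundedFormula.realize_iff, realize_fMem]
    simp only [Fin.snoc_last, Fin.snoc_castSucc]
    refine iff_congr Iff.rfl (forall_congr' fun s => ?_)
    rw [Language.BoundedFormula.realize_imp, realize_fMem, realize_fMem]
    simp only [Fin.snoc_last, Fin.snoc_castSucc]
  rw [key, Subtype.forall]
  refine forall₂_congr fun t ht => iff_congr Iff.rfl ?_
  exact ⟨fun h s hs => h ⟨s, hM.mem_trans hs ht⟩ hs, fun h s hs => h hs⟩

end Realize

/-- `z` is the power set of `y`, in `M`. -/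
def IsPowerIn (M z y : ZFSet.{u}) : Prop := ∀ t ∈ M, t ∈ z ↔ t ⊆ y

/-- The axiom that `ℶ_ω` exists, in transitive models: a set `B` contains the least inductive set
of the model and is closed under power sets in the sense of the model. -/
theorem Ensured.power_tower : Ensured.{u} (fun M => ∃ B ∈ M,
    (∃ w ∈ B, IsInductive w ∧ ∀ w' ∈ M, IsInductive w' → w ⊆ w') ∧
    ∀ y ∈ B, ∃ z ∈ B, IsPowerIn M z y) := by
  refine Ensured.of_axiom (ψ := axBethOmega) (Or.inl (Or.inl (by simp))) fun M hM hT => ?_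
  let _ := memStructure M
  unfold Language.Sentence.Realize Language.Formula.Realize axBethOmega at hT
  rw [Language.BoundedFormula.realize_ex] at hT
  obtain ⟨B, hB⟩ := hT
  rw [Language.BoundedFormula.realize_inf, Language.BoundedFormula.realize_ex] at hB
  obtain ⟨⟨w, hw⟩, h⟩ := hB
  rw [Language.BoundedFormula.realize_inf, realize_fMem, realize_fOmega hM] at hw
  refine ⟨B.1, B.2, ⟨w.1, hw.1, hw.2⟩, fun y hy => ?_⟩
  have h1 := h ⟨y, hM.mem_trans hy B.2⟩
  rw [Language.BoundedFormula.realize_imp, realize_fMem,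
    Language.BoundedFormula.realize_ex] at h1
  obtain ⟨z, hz⟩ := h1 hy
  rw [Language.BoundedFormula.realize_inf, realize_fMem, realize_fPower hM] at hz
  exact ⟨z.1, hz.1, hz.2⟩

/-- In a transitive model of separation, a least inductive set is `ω`: if `x` were an
`∈`-minimal element of it that is no numeral, then removing `x` would leave an inductive set. -/
theorem eq_omegaSet {M w : ZFSet.{u}} (hM : M.IsTransitive)
    (hsep : ∀ (v : Fin 1 → El M) (a : El M), ∃ b : El M,
      ∀ x : El M, x.1 ∈ b.1 ↔ x.1 ∈ a.1 ∧ ¬ x.1 = (v 0).1)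
    (hwM : w ∈ M) (hw : IsInductive w) (hmin : ∀ w' ∈ M, IsInductive w' → w ⊆ w') :
    w = omegaSet := by
  ext x
  rw [mem_omegaSet]
  constructor
  · induction x using ZFSet.inductionOn with
    | _ x ih =>
    intro hx
    by_contra hne
    obtain ⟨b, hb⟩ := hsep ![⟨x, hM.mem_trans hx hwM⟩] ⟨w, hwM⟩
    have hb' : ∀ y, y ∈ b.1 ↔ y ∈ w ∧ y ≠ x := by
      intro y
      constructor
      · intro hy
        exact (hb ⟨y, hM.mem_trans hy b.2⟩).1 hy
      · intro hy
        exact (hb ⟨y, hM.mem_trans hy.1 hwM⟩).2 hy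
    have hi : IsInductive b.1 := by
      refine ⟨(hb' _).2 ⟨hw.1, fun h => hne ⟨0, h⟩⟩, fun y hy => ?_⟩
      rw [hb'] at hy ⊢
      refine ⟨hw.2 y hy.1, fun h => hne ?_⟩
      obtain ⟨n, rfl⟩ := ih y (h ▸ ZFSet.mem_insert y y) hy.1
      exact ⟨n + 1, h⟩
    exact ((hb' x).1 (hmin b.1 b.2 hi hx)).2 rfl
  · rintro ⟨n, rfl⟩
    exact hw.natSet_mem n

theorem IsPowerIn.transitive {M z y : ZFSet.{u}} (hM : M.IsTransitive) (h : IsPowerIn M z y)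
    (hz : z ∈ M) (hyM : y ∈ M) (hy : y.IsTransitive) : z.IsTransitive ∧ y ⊆ z := by
  have h1 : y ⊆ z := fun s hs => (h s (hM.mem_trans hs hyM)).2 (hy s hs)
  exact ⟨fun t ht s hs => h1 ((h t (hM.mem_trans ht hz)).1 ht hs), h1⟩

/-- The basic closure properties of the transitive models that are used below. The sets of all pairs
of numerals, of all reals, and a set containing all pairs of a numeral and a real serve as bounds
for separation. -/
structure IsBase (M : ZFSet.{u}) : Prop where
  transitive : M.IsTransitive
  pairing : ∀ x ∈ M, ∀ y ∈ M, ({x, y} : ZFSet) ∈ M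
  union : ∀ x ∈ M, ZFSet.sUnion x ∈ M
  omega : omegaSet ∈ M
  natPairs : ∃ Y ∈ M, ∀ z, z ∈ Y ↔ ∃ a b : ℕ, z = ZFSet.pair (natSet a) (natSet b)
  reals : ∃ R ∈ M, ∀ z, z ∈ R ↔ ∃ x ∈ realsOf M, realSet x = z
  natRealPairs : ∃ Y ∈ M, ∀ k, ∀ x ∈ realsOf M, ZFSet.pair (natSet k) (realSet x) ∈ Y

/-- In `M`, the set `z` is a function from `w` to `w`, as a set of Kuratowski pairs. -/
def IsFunctionOn (M : ZFSet.{u}) (z w : El M) : Prop :=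
  (∀ p : El M, p.1 ∈ z.1 → ∃ a : El M, a.1 ∈ w.1 ∧ ∃ b : El M, b.1 ∈ w.1 ∧
    p.1 = ZFSet.pair a.1 b.1) ∧
  ∀ a : El M, a.1 ∈ w.1 → ∃ b : El M, b.1 ∈ w.1 ∧ ∀ c : El M, c.1 ∈ w.1 →
    (ZFSet.pair a.1 c.1 ∈ z.1 ↔ c.1 = b.1)

theorem UDef.isFunctionOn {n : ℕ} (i j : Fin n) :
    UDef.{u} n (fun M v => IsFunctionOn M (v i) (v j)) := by
  refine UDef.and (UDef.all (UDef.imp (UDef.mem _ _) (UDef.ex (UDef.and (UDef.mem _ _)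
    (UDef.ex (UDef.and (UDef.mem _ _) (UDef.pair 1 0 2)))))))
    (UDef.all (UDef.imp (UDef.mem _ _) (UDef.ex (UDef.and (UDef.mem _ _)
    (UDef.all (UDef.imp (UDef.mem _ _) (UDef.iff (UDef.app i.succ.succ.succ 2 0)
      (UDef.eq _ _))))))))

theorem isFunctionOn_iff {M : ZFSet.{u}} (hM : M.IsTransitive) (ho : omegaSet ∈ M) (z : El M) :
    IsFunctionOn M z ⟨omegaSet, ho⟩ ↔ ∃ x, realSet x = z.1 := by
  rw [exists_realSet_eq_iff]
  refine and_congr ⟨fun h p hp => ?_, fun h p hp => ?_⟩ ⟨fun h a ha => ?_, fun h a ha => ?_⟩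
  · obtain ⟨a, ha, b, hb, h⟩ := h ⟨p, hM.mem_trans hp z.2⟩ hp
    exact ⟨a.1, ha, b.1, hb, h⟩
  · obtain ⟨a, ha, b, hb, h⟩ := h p.1 hp
    exact ⟨⟨a, hM.mem_trans ha ho⟩, ha, ⟨b, hM.mem_trans hb ho⟩, hb, h⟩
  · obtain ⟨b, hb, h⟩ := h ⟨a, hM.mem_trans ha ho⟩ ha
    exact ⟨b.1, hb, fun c hc => h ⟨c, hM.mem_trans hc ho⟩ hc⟩
  · obtain ⟨b, hb, h⟩ := h a.1 ha
    exact ⟨⟨b, hM.mem_trans hb ho⟩, hb, fun c hc => h c.1 hc⟩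

theorem Ensured.isBase : Ensured.{u} IsBase := by
  have s1 : Ensured.{u} (fun M => ∀ (v : Fin 1 → El M) (a : El M), ∃ b : El M,
      ∀ x : El M, x.1 ∈ b.1 ↔ x.1 ∈ a.1 ∧ ¬ x.1 = (v 0).1) :=
    Ensured.separation (m := 1) (UDef.not (UDef.eq 0 1))
  have s2 := Ensured.separation.{u} (m := 1) (UDef.isFunctionOn 0 1)
  have s3 := Ensured.separation.{u} (m := 1) (P := fun M w => ∃ a : El M, a.1 ∈ (w 1).1 ∧
    ∃ b : El M, b.1 ∈ (w 1).1 ∧ (w 0).1 = ZFSet.pair a.1 b.1)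
    (UDef.ex (UDef.and (UDef.mem _ _) (UDef.ex (UDef.and (UDef.mem _ _) (UDef.pair 1 0 2)))))
  refine (((Ensured.pairing.and Ensured.union).and (s1.and (s2.and s3))).and
    Ensured.power_tower).mono fun M hM => ?_
  rintro ⟨⟨⟨hp, hu⟩, h1, h2, h3⟩, B, hB, ⟨w, hwB, hw, hmin⟩, hpow⟩
  have hwM : w ∈ M := hM.mem_trans hwB hB
  have hwo : w = omegaSet := eq_omegaSet hM h1 hwM hw hmin
  subst hwo
  have pairPow : ∀ {y z t a b : ZFSet.{u}}, y ∈ M → IsPowerIn M z y → z ∈ M → IsPowerIn M t z →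
      a ∈ y → b ∈ y → ZFSet.pair a b ∈ t := by
    intro y z t a b hy hz hzM ht ha hb
    have haM := hM.mem_trans ha hy
    have hbM := hM.mem_trans hb hy
    have hs : ({a} : ZFSet) ∈ M := by
      have := hp a haM a haM
      rwa [ZFSet.pair_eq_singleton] at this
    have hd := hp a haM b hbM
    have hpM : ZFSet.pair a b ∈ M := hp _ hs _ hd
    refine (ht _ hpM).2 fun x hx => ?_
    rw [ZFSet.pair, ZFSet.mem_pair] at hx
    rcases hx with rfl | rfl
    · refine (hz _ hs).2 fun x hx => ?_
      rw [ZFSet.mem_singleton] at hx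
      rwa [hx]
    · refine (hz _ hd).2 fun x hx => ?_
      rw [ZFSet.mem_pair] at hx
      rcases hx with rfl | rfl
      · exact ha
      · exact hb
  -- Pairs of numerals lie in the second power set of `ω`, reals in the third, and pairs of a
  -- numeral and a real in the fifth.
  obtain ⟨y1, hy1B, hy1⟩ := hpow _ hwB
  obtain ⟨y2, hy2B, hy2⟩ := hpow _ hy1B
  obtain ⟨y3, hy3B, hy3⟩ := hpow _ hy2B
  obtain ⟨y4, hy4B, hy4⟩ := hpow _ hy3B
  obtain ⟨y5, hy5B, hy5⟩ := hpow _ hy4B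
  have toM : ∀ {y}, y ∈ B → y ∈ M := fun h => hM.mem_trans h hB
  have t1 := hy1.transitive hM (toM hy1B) hwM omegaSet_transitive
  have t2 := hy2.transitive hM (toM hy2B) (toM hy1B) t1.1
  have t3 := hy3.transitive hM (toM hy3B) (toM hy2B) t2.1
  have hpairs : ∀ a b : ℕ, ZFSet.pair (natSet a) (natSet b) ∈ y2 := fun a b =>
    pairPow hwM hy1 (toM hy1B) hy2 (natSet_mem_omegaSet a) (natSet_mem_omegaSet b)
  have hreal : ∀ x ∈ realsOf M, realSet x ∈ y3 := by
    intro x hx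
    refine (hy3 _ hx).2 fun z hz => ?_
    obtain ⟨n, rfl⟩ := mem_realSet.1 hz
    exact hpairs _ _
  refine ⟨hM, hp, hu, hwM, ?_, ?_, y5, toM hy5B, fun k x hx => ?_⟩
  · obtain ⟨Y, hY⟩ := h3 ![⟨omegaSet, hwM⟩] ⟨y2, toM hy2B⟩
    refine ⟨Y.1, Y.2, fun z => ⟨fun hz => ?_, ?_⟩⟩
    · obtain ⟨-, a, ha, b, hb, h⟩ := (hY ⟨z, hM.mem_trans hz Y.2⟩).1 hz
      obtain ⟨n, hn⟩ := mem_omegaSet.1 ha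
      obtain ⟨m, hm⟩ := mem_omegaSet.1 hb
      exact ⟨n, m, by rw [hn, hm]; exact h⟩
    · rintro ⟨a, b, rfl⟩
      have hab := hpairs a b
      exact (hY ⟨_, hM.mem_trans hab (toM hy2B)⟩).2 ⟨hab,
        ⟨natSet a, hM.mem_trans (natSet_mem_omegaSet a) hwM⟩, natSet_mem_omegaSet a,
        ⟨natSet b, hM.mem_trans (natSet_mem_omegaSet b) hwM⟩, natSet_mem_omegaSet b, rfl⟩
  · obtain ⟨R, hR⟩ := h2 ![⟨omegaSet, hwM⟩] ⟨y3, toM hy3B⟩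
    refine ⟨R.1, R.2, fun z => ?_⟩
    constructor
    · intro hz
      have hzM := hM.mem_trans hz R.2
      obtain ⟨x, hx⟩ := (isFunctionOn_iff hM hwM ⟨z, hzM⟩).1 ((hR ⟨z, hzM⟩).1 hz).2
      exact ⟨x, by rwa [realsOf, Set.mem_ofPred_eq, hx], hx⟩
    · rintro ⟨x, hx, rfl⟩
      exact (hR ⟨_, hx⟩).2 ⟨hreal x hx, (isFunctionOn_iff hM hwM ⟨_, hx⟩).2 ⟨x, rfl⟩⟩
  · refine pairPow (toM hy3B) hy4 (toM hy4B) hy5 ?_ (hreal x hx)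
    exact t3.2 (t2.2 (t1.2 (natSet_mem_omegaSet k)))

/-! ### Sets of reals closed under arithmetical definability -/

open Classical in
/-- The characteristic function of a set of natural numbers. -/
noncomputable def chi (P : ℕ → Prop) : Real := fun n => if P n then 1 else 0

@[simp] theorem chi_eq_one {P : ℕ → Prop} {n : ℕ} : chi P n = 1 ↔ P n := by
  unfold chi; split <;> simp_all

/-- The recursive functions from which all arithmetical relations needed below are composed;
pairs and finite sequences are coded by natural numbers. Only the first fifteen are relevant; the
further ones are zero. -/
noncomputable def basic : ℕ → Real
  | 0 => fun k => k.unpair.1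
  | 1 => fun k => k.unpair.2
  | 2 => fun k => k + 1
  | 3 => fun _ => 0
  | 4 => chi fun k => k.unpair.1 = k.unpair.2
  | 5 => chi fun k => k ≠ 1
  | 6 => chi fun k => k.unpair.1 = 1 ∧ k.unpair.2 = 1
  | 7 => chi fun k => k.unpair.1 < k.unpair.2
  | 8 => fun k => 2 * k
  | 9 => fun k => k / 2
  | 10 => fun k => k % 2
  | 11 => fun k => Encodable.encode ((ofNat (Node × ℕ) k).1 ++ [(ofNat (Node × ℕ) k).2])
  | 12 => chi fun k => (ofNat (Node × Node) k).1 <+: (ofNat (Node × Node) k).2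
  | 13 => fun k => (ofNat Node k).length
  | 14 => fun k => (ofNat (Node × ℕ) k).1.getD (ofNat (Node × ℕ) k).2 0
  | _ => fun _ => 0

/-- A set of reals that contains the functions `basic i` and is closed under the operations that
generate arithmetical definability: composition, pairing, number quantification, and the passage
from the graph of a function to the function. -/
structure ArithClosed (W : Set Real) : Prop where
  basic : ∀ i, basic i ∈ W
  comp : ∀ x ∈ W, ∀ y ∈ W, (fun n => x (y n)) ∈ W
  pair : ∀ x ∈ W, ∀ y ∈ W, (fun n => Nat.pair (x n) (y n)) ∈ W
  ex : ∀ x ∈ W, chi (fun n => ∃ k, x (Nat.pair n k) = 1) ∈ W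
  graph : ∀ x ∈ W, ∀ f : Real, (∀ n m, f n = m ↔ x (Nat.pair n m) = 1) → f ∈ W

theorem arithClosed_univ : ArithClosed Set.univ := by constructor <;> simp

/-- The function `f`, transported to natural numbers by the codings, belongs to `W`. -/
def Fn {γ δ : Type} [Denumerable γ] [Denumerable δ] (W : Set Real) (f : γ → δ) : Prop :=
  (fun k => Encodable.encode (f (ofNat γ k))) ∈ W

/-- The characteristic function of `P`, transported to natural numbers by the coding, belongs
to `W`. -/
def Pr {γ : Type} [Denumerable γ] (W : Set Real) (P : γ → Prop) : Prop :=
  chi (fun k => P (ofNat γ k)) ∈ W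

section

variable {W : Set Real} {γ δ ε : Type} [Denumerable γ] [Denumerable δ] [Denumerable ε]

theorem Pr.congr {P Q : γ → Prop} (h : Pr W P) (e : ∀ c, P c ↔ Q c) : Pr W Q := by
  have : P = Q := funext fun c => propext (e c)
  rwa [← this]

theorem Fn.of_real {x : Real} (h : x ∈ W) : Fn W x := h

theorem pr_of_eq_one {x : Real} (hW : ArithClosed W) (h : x ∈ W) : Pr W (fun n => x n = 1) := by
  have h1 := hW.comp _ (hW.basic 5) _ (hW.comp _ (hW.basic 5) _ h)
  unfold Pr
  convert h1 using 1
  funext n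
  simp only [basic, chi, Denumerable.ofNat_nat]
  split_ifs <;> simp_all

variable (hW : ArithClosed W)
include hW

theorem Fn.comp {f : δ → ε} {g : γ → δ} (hf : Fn W f) (hg : Fn W g) :
    Fn W (fun c => f (g c)) := by
  have := hW.comp _ hf _ hg
  simpa [Fn] using this

theorem Fn.pair {f : γ → δ} {g : γ → ε} (hf : Fn W f) (hg : Fn W g) :
    Fn W (fun c => (f c, g c)) := by
  have := hW.pair _ hf _ hg
  simpa [Fn] using this

theorem Fn.fst : Fn W (Prod.fst : γ × δ → γ) := by
  have := hW.basic 0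
  unfold Fn
  convert this using 1
  funext k
  simp [basic]

theorem Fn.snd : Fn W (Prod.snd : γ × δ → δ) := by
  have := hW.basic 1
  unfold Fn
  convert this using 1
  funext k
  simp [basic]

theorem Fn.id : Fn W (fun c : γ => c) := by
  have h := hW.comp _ (hW.basic 0) _ (hW.pair _ (hW.basic 2) _ (hW.basic 2))
  have h0 : (fun n => n) ∈ W := by
    have h1 := hW.graph (chi fun k => k.unpair.1 = k.unpair.2) (hW.basic 4) (fun n => n)
      (fun n m => by simp)
    exact h1
  unfold Fn
  convert h0 using 1
  funext k
  simp

theorem Fn.const (d : δ) : Fn W (fun _ : γ => d) := by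
  have key : ∀ n : ℕ, (fun _ : ℕ => n) ∈ W := by
    intro n
    induction n with
    | zero => exact hW.basic 3
    | succ n ih => exact hW.comp _ (hW.basic 2) _ ih
  exact key _

theorem Fn.encode : Fn W (fun c : γ => Encodable.encode c) := by
  have := Fn.id (γ := ℕ) hW
  unfold Fn at this ⊢
  simpa using this

theorem Fn.decode : Fn W (fun c : ℕ => ofNat γ c) := by
  have := Fn.id (γ := ℕ) hW
  unfold Fn at this ⊢
  simpa using this

theorem Pr.comp {P : δ → Prop} {g : γ → δ} (hP : Pr W P) (hg : Fn W g) :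
    Pr W (fun c => P (g c)) := by
  have : chi (fun k => P (ofNat δ (Encodable.encode (g (ofNat γ k))))) ∈ W := hW.comp _ hP _ hg
  simp only [Denumerable.ofNat_encode] at this
  exact this

theorem Pr.not {P : γ → Prop} (hP : Pr W P) : Pr W (fun c => ¬ P c) := by
  have := hW.comp _ (hW.basic 5) _ hP
  unfold Pr
  convert this using 1
  funext k
  simp only [basic, chi]
  split_ifs <;> simp_all

theorem Pr.and {P Q : γ → Prop} (hP : Pr W P) (hQ : Pr W Q) : Pr W (fun c => P c ∧ Q c) := by
  have := hW.comp _ (hW.basic 6) _ (hW.pair _ hP _ hQ)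
  unfold Pr
  convert this using 1
  funext k
  simp only [basic, chi, Nat.unpair_pair]
  split_ifs <;> simp_all

theorem Pr.or {P Q : γ → Prop} (hP : Pr W P) (hQ : Pr W Q) : Pr W (fun c => P c ∨ Q c) :=
  (Pr.not hW (Pr.and hW (Pr.not hW hP) (Pr.not hW hQ))).congr fun _ => by tauto

theorem Pr.imp {P Q : γ → Prop} (hP : Pr W P) (hQ : Pr W Q) : Pr W (fun c => P c → Q c) :=
  (Pr.or hW (Pr.not hW hP) hQ).congr fun _ => by tauto

theorem Pr.ex {P : γ → δ → Prop} (hP : Pr W (fun c : γ × δ => P c.1 c.2)) :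
    Pr W (fun c => ∃ d, P c d) := by
  have := hW.ex _ hP
  unfold Pr
  convert this using 1
  congr 1
  funext k
  simp only [chi_eq_one, Denumerable.prod_ofNat_val, Nat.unpair_pair, eq_iff_iff]
  exact ⟨fun ⟨d, hd⟩ => ⟨Encodable.encode d, by simpa using hd⟩, fun ⟨m, hm⟩ => ⟨_, hm⟩⟩

theorem Pr.all {P : γ → δ → Prop} (hP : Pr W (fun c : γ × δ => P c.1 c.2)) :
    Pr W (fun c => ∀ d, P c d) :=
  (Pr.not hW (Pr.ex hW (P := fun c d => ¬ P c d) (Pr.not hW hP))).congr fun _ => by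
    simp only [not_exists, not_not]

theorem Pr.const (p : Prop) : Pr W (fun _ : γ => p) := by
  by_cases hp : p
  · refine (Pr.comp hW (Pr.not hW (pr_of_eq_one hW (hW.basic 3))) (Fn.encode hW)).congr fun c => ?_
    simp [basic, hp]
  · refine (Pr.comp hW (pr_of_eq_one hW (hW.basic 3)) (Fn.encode hW)).congr fun c => ?_
    simp [basic, hp]

theorem Pr.eq {f g : γ → δ} (hf : Fn W f) (hg : Fn W g) : Pr W (fun c => f c = g c) := by
  have : chi (fun k => (Nat.pair (Encodable.encode (f (ofNat γ k)))
      (Encodable.encode (g (ofNat γ k)))).unpair.1 = (Nat.pair (Encodable.encode (f (ofNat γ k)))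
      (Encodable.encode (g (ofNat γ k)))).unpair.2) ∈ W :=
    hW.comp _ (hW.basic 4) _ (hW.pair _ hf _ hg)
  simp only [Nat.unpair_pair, Encodable.encode_inj] at this
  exact this

theorem Pr.lt {f g : γ → ℕ} (hf : Fn W f) (hg : Fn W g) : Pr W (fun c => f c < g c) := by
  have : chi (fun k => (Nat.pair (Encodable.encode (f (ofNat γ k)))
      (Encodable.encode (g (ofNat γ k)))).unpair.1 < (Nat.pair (Encodable.encode (f (ofNat γ k)))
      (Encodable.encode (g (ofNat γ k)))).unpair.2) ∈ W :=
    hW.comp _ (hW.basic 7) _ (hW.pair _ hf _ hg)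
  simp only [Nat.unpair_pair, Encodable.encode_nat] at this
  exact this

theorem Pr.le {f g : γ → ℕ} (hf : Fn W f) (hg : Fn W g) : Pr W (fun c => f c ≤ g c) :=
  (Pr.not hW (Pr.lt hW hg hf)).congr fun _ => not_lt

theorem Fn.succ {f : γ → ℕ} (hf : Fn W f) : Fn W (fun c => f c + 1) :=
  hW.comp _ (hW.basic 2) _ hf

theorem Fn.two_mul {f : γ → ℕ} (hf : Fn W f) : Fn W (fun c => 2 * f c) :=
  hW.comp _ (hW.basic 8) _ hf

theorem Fn.half {f : γ → ℕ} (hf : Fn W f) : Fn W (fun c => f c / 2) :=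
  hW.comp _ (hW.basic 9) _ hf

theorem Fn.mod_two {f : γ → ℕ} (hf : Fn W f) : Fn W (fun c => f c % 2) :=
  hW.comp _ (hW.basic 10) _ hf

theorem Fn.natPair {f g : γ → ℕ} (hf : Fn W f) (hg : Fn W g) :
    Fn W (fun c => Nat.pair (f c) (g c)) :=
  hW.pair _ hf _ hg

theorem Fn.unpairFst {f : γ → ℕ} (hf : Fn W f) : Fn W (fun c => (f c).unpair.1) :=
  hW.comp _ (hW.basic 0) _ hf

theorem Fn.unpairSnd {f : γ → ℕ} (hf : Fn W f) : Fn W (fun c => (f c).unpair.2) :=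
  hW.comp _ (hW.basic 1) _ hf

theorem Fn.snoc {f : γ → Node} {g : γ → ℕ} (hf : Fn W f) (hg : Fn W g) :
    Fn W (fun c => f c ++ [g c]) := by
  have := hW.comp _ (hW.basic 11) _ (Fn.pair hW hf hg)
  simpa [Fn, basic] using this

theorem Pr.prefix {f g : γ → Node} (hf : Fn W f) (hg : Fn W g) :
    Pr W (fun c => f c <+: g c) := by
  have : chi (fun k => (ofNat (Node × Node) (Encodable.encode (f (ofNat γ k), g (ofNat γ k)))).1 <+:
      (ofNat (Node × Node) (Encodable.encode (f (ofNat γ k), g (ofNat γ k)))).2) ∈ W :=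
    hW.comp _ (hW.basic 12) _ (Fn.pair hW hf hg)
  simp only [Denumerable.ofNat_encode] at this
  exact this

theorem Fn.length {f : γ → Node} (hf : Fn W f) : Fn W (fun c => (f c).length) := by
  have := hW.comp _ (hW.basic 13) _ hf
  simpa [Fn, basic] using this

theorem Fn.getD {f : γ → Node} {g : γ → ℕ} (hf : Fn W f) (hg : Fn W g) :
    Fn W (fun c => (f c).getD (g c) 0) := by
  have := hW.comp _ (hW.basic 14) _ (Fn.pair hW hf hg)
  simpa [Fn, basic] using this

theorem Fn.real {x : Real} {f : γ → ℕ} (hx : x ∈ W) (hf : Fn W f) : Fn W (fun c => x (f c)) :=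
  Fn.comp hW (Fn.of_real hx) hf

/-- A function whose graph belongs to `W` belongs to `W`. -/
theorem Fn.of_graph {f : γ → δ} (h : Pr W (fun c : γ × δ => f c.1 = c.2)) : Fn W f := by
  refine hW.graph _ h _ fun n m => ?_
  simp only [chi_eq_one, Denumerable.prod_ofNat_val, Nat.unpair_pair]
  constructor
  · rintro rfl
    simp
  · intro h
    rw [h]
    simp

/-- Uniformization of arithmetical relations by the witness with the least code. -/
theorem Fn.exists_choice [Inhabited δ] {P : γ → δ → Prop}
    (hP : Pr W (fun c : γ × δ => P c.1 c.2)) :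
    ∃ f : γ → δ, Fn W f ∧ ∀ c, (∃ d, P c d) → P c (f c) := by
  classical
  have hex : ∀ c, ∃ d, ((∃ d', P c d') → P c d ∧ ∀ d', P c d' →
      Encodable.encode d ≤ Encodable.encode d') ∧ ((¬ ∃ d', P c d') → d = default) := by
    intro c
    by_cases h : ∃ d, P c d
    · have hw : ∃ n, ∃ d, Encodable.encode d = n ∧ P c d := by
        obtain ⟨d, hd⟩ := h
        exact ⟨_, d, rfl, hd⟩
      obtain ⟨d, hd, hd'⟩ := Nat.find_spec hw
      exact ⟨d, ⟨fun _ => ⟨hd', fun d' h' => hd ▸ Nat.find_min' hw ⟨d', rfl, h'⟩⟩,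
        fun h' => absurd h h'⟩⟩
    · exact ⟨default, fun h' => absurd h' h, fun _ => rfl⟩
  choose f hf using hex
  -- `f c` is the witness with the least code, or the default value if there is no witness.
  refine ⟨f, Fn.of_graph hW ?_, fun c h => ((hf c).1 h).1⟩
  have hE : Pr W (fun c : γ × δ => ∃ d', P c.1 d') :=
    Pr.comp hW (P := fun c => ∃ d, P c d) (Pr.ex hW hP) (Fn.fst hW)
  have hall : Pr W (fun c : γ × δ => ∀ d', P c.1 d' →
      Encodable.encode c.2 ≤ Encodable.encode d') := by
    refine Pr.all hW (Pr.imp hW ?_ (Pr.le hW ?_ ?_))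
    · exact Pr.comp hW hP (Fn.pair hW (Fn.comp hW (Fn.fst hW) (Fn.fst hW)) (Fn.snd hW))
    · exact Fn.comp hW (Fn.encode hW) (Fn.comp hW (Fn.snd hW) (Fn.fst hW))
    · exact Fn.comp hW (Fn.encode hW) (Fn.snd hW)
  refine (Pr.or hW (Pr.and hW hE (Pr.and hW hP hall)) (Pr.and hW (Pr.not hW hE)
    (Pr.eq hW (Fn.snd hW) (Fn.const hW default)))).congr fun c => ?_
  obtain ⟨c, d⟩ := c
  by_cases h : ∃ d', P c d'
  · simp only [h, true_and, not_true_eq_false, false_and, or_false]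
    obtain ⟨h1, h2⟩ := (hf c).1 h
    constructor
    · rintro ⟨h3, h4⟩
      exact Encodable.encode_injective (le_antisymm (h2 _ h3) (h4 _ h1))
    · rintro rfl
      exact ⟨h1, h2⟩
  · simp only [h, false_and, not_false_eq_true, true_and, false_or]
    rw [(hf c).2 h, eq_comm]

end

/-! ### Trees and initial segments -/

/-- The set of nodes coded by a real. -/
def treeOf (x : Real) : Set Node := {s | x (Encodable.encode s) = 1}

theorem mem_treeOf {x : Real} {s : Node} : s ∈ treeOf x ↔ x (Encodable.encode s) = 1 := Iff.rfl

theorem nodeReal_eq_chi (A : Set Node) : nodeReal A = chi (fun k => ofNat Node k ∈ A) := by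
  classical
  funext k
  unfold nodeReal chi
  refine if_congr ?_ rfl rfl
  constructor
  · rintro ⟨s, hs, rfl⟩
    simpa using hs
  · intro h
    exact ⟨_, h, by simp⟩

@[simp] theorem treeOf_nodeReal (A : Set Node) : treeOf (nodeReal A) = A := by
  ext s
  rw [mem_treeOf, nodeReal_eq_chi, chi_eq_one]
  simp

theorem nodeReal_injective : Function.Injective nodeReal := fun A B h => by
  rw [← treeOf_nodeReal A, h, treeOf_nodeReal]

theorem nodeReal_treeOf {x : Real} (h : ∀ k, x k = 0 ∨ x k = 1) : nodeReal (treeOf x) = x := by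
  funext k
  rw [nodeReal_eq_chi]
  unfold chi
  simp only [mem_treeOf, Denumerable.encode_ofNat]
  rcases h k with h | h <;> simp [h]

theorem nodeReal_mem_iff {W : Set Real} {A : Set Node} : nodeReal A ∈ W ↔ Pr W (· ∈ A) := by
  rw [nodeReal_eq_chi]; rfl

@[simp] theorem length_initSeg (x : Real) (n : ℕ) : (initSeg x n).length = n := by
  simp [initSeg]

theorem initSeg_getElem {x : Real} {n i : ℕ} (h : i < (initSeg x n).length) :
    (initSeg x n)[i] = x i := by simp [initSeg]

theorem initSeg_getD {x : Real} {n i : ℕ} (h : i < n) : (initSeg x n).getD i 0 = x i := by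
  rw [List.getD_eq_getElem _ _ (by simpa using h), initSeg_getElem]

theorem initSeg_succ (x : Real) (n : ℕ) : initSeg x (n + 1) = initSeg x n ++ [x n] := by
  unfold initSeg
  rw [List.ofFn_succ_last]
  simp

theorem initSeg_prefix (x : Real) {m n : ℕ} (h : m ≤ n) : initSeg x m <+: initSeg x n := by
  induction n, h using Nat.le_induction with
  | base => exact List.prefix_rfl
  | succ n _ ih =>
    rw [initSeg_succ]
    exact ih.trans (List.prefix_append _ _)

theorem prefix_initSeg {x : Real} {n : ℕ} {s : Node} (h : s <+: initSeg x n) :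
    s = initSeg x s.length := by
  have hl : s.length ≤ n := by simpa using h.length_le
  exact List.prefix_of_prefix_length_le h (initSeg_prefix x hl) (by simp) |>.eq_of_length (by simp)

theorem eq_initSeg_iff {x : Real} {n : ℕ} {s : Node} :
    initSeg x n = s ↔ s.length = n ∧ ∀ i < n, s.getD i 0 = x i := by
  constructor
  · rintro rfl
    exact ⟨by simp, fun i hi => initSeg_getD hi⟩
  · rintro ⟨rfl, h⟩
    refine List.ext_getElem (by simp) fun i h1 h2 => ?_
    rw [initSeg_getElem, ← h i h2, List.getD_eq_getElem _ _ h2]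

theorem initSeg_congr {x y : Real} {n : ℕ} : initSeg x n = initSeg y n ↔ ∀ i < n, x i = y i := by
  rw [eq_initSeg_iff]
  simp only [length_initSeg, true_and]
  exact forall₂_congr fun i hi => by rw [initSeg_getD hi, eq_comm]

section

variable {W : Set Real} {γ : Type} [Denumerable γ] (hW : ArithClosed W)
include hW

theorem Fn.initSeg {x : Real} (hx : x ∈ W) : Fn W (initSeg x) := by
  refine Fn.of_graph hW ((Pr.and hW (Pr.eq hW (Fn.length hW (Fn.snd hW)) (Fn.fst hW))
    (Pr.all hW (P := fun (c : ℕ × Node) (i : ℕ) => i < c.1 → c.2.getD i 0 = x i)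
      (Pr.imp hW (Pr.lt hW (Fn.snd hW) (Fn.comp hW (Fn.fst hW) (Fn.fst hW))) (Pr.eq hW
      (Fn.getD hW (Fn.comp hW (Fn.snd hW) (Fn.fst hW)) (Fn.snd hW))
      (Fn.real hW hx (Fn.snd hW)))))).congr fun c => eq_initSeg_iff.symm)

theorem Pr.mem_treeOf {x : Real} (hx : x ∈ W) {f : γ → Node} (hf : Fn W f) :
    Pr W (fun c => f c ∈ treeOf x) :=
  Pr.eq hW (Fn.real hW hx (Fn.comp hW (Fn.encode hW) hf)) (Fn.const hW 1)

theorem joinPair_mem {x y : Real} (hx : x ∈ W) (hy : y ∈ W) : joinPair x y ∈ W := by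
  have : Fn W (joinPair x y) := by
    refine Fn.of_graph hW ((Pr.or hW (Pr.and hW
      (Pr.eq hW (Fn.mod_two hW (Fn.fst hW)) (Fn.const hW 0))
      (Pr.eq hW (Fn.real hW hx (Fn.half hW (Fn.fst hW))) (Fn.snd hW)))
      (Pr.and hW (Pr.not hW (Pr.eq hW (Fn.mod_two hW (Fn.fst hW)) (Fn.const hW 0)))
      (Pr.eq hW (Fn.real hW hy (Fn.half hW (Fn.fst hW))) (Fn.snd hW)))).congr fun c => ?_)
    unfold joinPair
    split_ifs with h <;> simp [h]
  exact this

end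

theorem joinPair_even (x y : Real) (k : ℕ) : joinPair x y (2 * k) = x k := by
  simp [joinPair]

theorem joinPair_odd (x y : Real) (k : ℕ) : joinPair x y (2 * k + 1) = y k := by
  have h1 : (2 * k + 1) % 2 ≠ 0 := by omega
  have h2 : (2 * k + 1) / 2 = k := by omega
  simp [joinPair, h2]

/-! ### Codes of closed sets -/

theorem exists_initSeg_subset {x : Real} {U : Set Real} (hU : U ∈ nhds x) :
    ∃ n, ∀ y, initSeg y n = initSeg x n → y ∈ U := by
  obtain ⟨t, ⟨z, n, rfl⟩, hxt, htU⟩ :=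
    (PiNat.isTopologicalBasis_cylinders (fun _ : ℕ => ℕ)).mem_nhds_iff.1 hU
  refine ⟨n, fun y hy => htU ?_⟩
  rw [PiNat.mem_cylinder_iff] at hxt ⊢
  intro i hi
  rw [initSeg_congr.1 hy i hi, hxt i hi]

/-- A closed set is determined by the codes of the basic neighbourhoods that meet it. Here
`seg p n` is the code of the `n`-th basic neighbourhood of the point `p`. -/
theorem exists_code {X : Type} [TopologicalSpace X] (seg : X → ℕ → ℕ)
    (h1 : ∀ p, ∀ U ∈ nhds p, ∃ n, ∀ q, seg q n = seg p n → q ∈ U)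
    (h2 : ∀ p q n m, seg p n = seg q m → n = m) {K : Set X} (hK : IsClosed K) :
    ∃ c : Real, ∀ p, p ∈ K ↔ ∀ n, c (seg p n) = 0 := by
  classical
  refine ⟨fun k => if ∃ p ∈ K, ∃ n, seg p n = k then 0 else 1, fun p => ⟨fun hp n => ?_, ?_⟩⟩
  · exact if_pos ⟨p, hp, n, rfl⟩
  · intro h
    by_contra hp
    obtain ⟨n, hn⟩ := h1 p _ (hK.isOpen_compl.mem_nhds hp)
    have h3 := h n
    simp only [ite_eq_left_iff, one_ne_zero, imp_false, not_not] at h3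
    obtain ⟨q, hq, m, hm⟩ := h3
    obtain rfl := h2 _ _ _ _ hm
    exact hn q hm hq

theorem exists_code₁ {K : Set Real} (hK : IsClosed K) :
    ∃ c : Real, ∀ x, x ∈ K ↔ ∀ n, c (Encodable.encode (initSeg x n)) = 0 := by
  refine exists_code (fun x n => Encodable.encode (initSeg x n)) (fun x U hU => ?_)
    (fun x y n m h => ?_) hK
  · obtain ⟨n, hn⟩ := exists_initSeg_subset hU
    exact ⟨n, fun y hy => hn y (Encodable.encode_injective hy)⟩
  · simpa using congrArg List.length (Encodable.encode_injective h)

theorem exists_code₂ {K : Set (Real × Real)} (hK : IsClosed K) :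
    ∃ c : Real, ∀ x y, (x, y) ∈ K ↔ ∀ n, c (Encodable.encode (initSeg x n, initSeg y n)) = 0 := by
  suffices h : ∃ c : Real, ∀ p : Real × Real, p ∈ K ↔
      ∀ n, c (Encodable.encode (initSeg p.1 n, initSeg p.2 n)) = 0 by
    obtain ⟨c, hc⟩ := h
    exact ⟨c, fun x y => hc (x, y)⟩
  refine exists_code (fun (p : Real × Real) n =>
    Encodable.encode (initSeg p.1 n, initSeg p.2 n)) (fun p U hU => ?_) (fun p q n m h => ?_) hK
  · obtain ⟨U1, hU1, U2, hU2, h⟩ := mem_nhds_prod_iff.1 hU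
    obtain ⟨n1, h1⟩ := exists_initSeg_subset hU1
    obtain ⟨n2, h2⟩ := exists_initSeg_subset hU2
    refine ⟨max n1 n2, fun q hq => h ?_⟩
    obtain ⟨ha, hb⟩ := Prod.ext_iff.1 (Encodable.encode_injective hq)
    refine ⟨h1 _ ?_, h2 _ ?_⟩
    · exact initSeg_congr.2 fun i hi => initSeg_congr.1 ha i (lt_of_lt_of_le hi (le_max_left _ _))
    · exact initSeg_congr.2 fun i hi => initSeg_congr.1 hb i (lt_of_lt_of_le hi (le_max_right _ _))
  · have := (Prod.ext_iff.1 (Encodable.encode_injective h)).1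
    simpa using congrArg List.length this

theorem exists_code₃ {K : Set (Real × Real × Real)} (hK : IsClosed K) :
    ∃ c : Real, ∀ x y z, (x, y, z) ∈ K ↔
      ∀ n, c (Encodable.encode (initSeg x n, initSeg y n, initSeg z n)) = 0 := by
  suffices h : ∃ c : Real, ∀ p : Real × Real × Real, p ∈ K ↔
      ∀ n, c (Encodable.encode (initSeg p.1 n, initSeg p.2.1 n, initSeg p.2.2 n)) = 0 by
    obtain ⟨c, hc⟩ := h
    exact ⟨c, fun x y z => hc (x, y, z)⟩
  refine exists_code (fun (p : Real × Real × Real) n =>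
    Encodable.encode (initSeg p.1 n, initSeg p.2.1 n, initSeg p.2.2 n))
    (fun p U hU => ?_) (fun p q n m h => ?_) hK
  · obtain ⟨U1, hU1, U', hU', h⟩ := mem_nhds_prod_iff.1 hU
    obtain ⟨U2, hU2, U3, hU3, h'⟩ := mem_nhds_prod_iff.1 hU'
    obtain ⟨n1, h1⟩ := exists_initSeg_subset hU1
    obtain ⟨n2, h2⟩ := exists_initSeg_subset hU2
    obtain ⟨n3, h3⟩ := exists_initSeg_subset hU3
    refine ⟨max n1 (max n2 n3), fun q hq => h ?_⟩
    obtain ⟨ha, hbc⟩ := Prod.ext_iff.1 (Encodable.encode_injective hq)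
    obtain ⟨hb, hc⟩ := Prod.ext_iff.1 hbc
    refine ⟨h1 _ ?_, h' ⟨h2 _ ?_, h3 _ ?_⟩⟩
    · exact initSeg_congr.2 fun i hi => initSeg_congr.1 ha i (by omega)
    · exact initSeg_congr.2 fun i hi => initSeg_congr.1 hb i (by omega)
    · exact initSeg_congr.2 fun i hi => initSeg_congr.1 hc i (by omega)
  · have := (Prod.ext_iff.1 (Encodable.encode_injective h)).1
    simpa using congrArg List.length this

/-- Closed sets can be glued along a continuous map with values in `ℕ`. -/
theorem isClosed_switch {X : Type} [TopologicalSpace X] {f : X → ℕ} (hf : Continuous f)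
    {A : ℕ → Set X} (hA : ∀ k, IsClosed (A k)) : IsClosed {p | p ∈ A (f p)} := by
  have : {p | p ∈ A (f p)} = ⋂ k, ((f ⁻¹' {k})ᶜ ∪ A k) := by
    ext p
    simp only [Set.mem_ofPred_eq, Set.mem_iInter, Set.mem_union, Set.mem_compl_iff,
      Set.mem_preimage, Set.mem_singleton_iff]
    exact ⟨fun h k => (em (f p = k)).elim (fun e => Or.inr (e ▸ h)) Or.inl,
      fun h => (h (f p)).resolve_left (by simp)⟩
  rw [this]
  exact isClosed_iInter fun k =>
    (((isOpen_discrete _).preimage hf).isClosed_compl).union (hA k)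

theorem continuous_postcomp (f : ℕ → ℕ) : Continuous (fun y : Real => (fun n => f (y n) : Real)) :=
  continuous_pi fun n => continuous_of_discreteTopology.comp (continuous_apply n)

theorem continuous_precomp (f : ℕ → ℕ) : Continuous (fun y : Real => (fun n => y (f n) : Real)) :=
  continuous_pi fun n => continuous_apply (f n)

theorem continuous_initSeg {X : Type} [TopologicalSpace X] {F : X → Real} (hF : Continuous F)
    (n : ℕ) (g : Node → ℕ) : Continuous fun p => g (initSeg (F p) n) := by
  have : (fun p => g (initSeg (F p) n)) = (fun t : Fin n → ℕ => g (List.ofFn t)) ∘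
      (fun x : Real => fun i : Fin n => x i) ∘ F := rfl
  rw [this]
  have h : Continuous fun x : Real => fun i : Fin n => x i :=
    continuous_pi fun i => continuous_apply (i : ℕ)
  exact continuous_of_discreteTopology.comp (h.comp hF)

theorem continuous_flag {X : Type} [TopologicalSpace X] {F : X → Real} (hF : Continuous F)
    (k : ℕ) : Continuous fun p => (F p k).unpair.1 := by
  have h : Continuous fun x : Real => (x k).unpair.1 :=
    (continuous_of_discreteTopology (f := fun k : ℕ => k.unpair.1)).comp
      (continuous_apply (A := fun _ : ℕ => ℕ) k)
  exact h.comp hF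

/-! ### Arithmetical predicates of reals -/

/-- The predicate `P`, uniformly in its number argument, is the projection of a closed set, and
if `P` holds then a witness can be found in every arithmetically closed set of reals. The witnesses
for all number arguments are given by one function `Y` of the set, so that they can be joined when
number quantifiers are treated. -/
def HasWitness {γ : Type} [Denumerable γ] (P : γ → Real → Prop) : Prop :=
  ∃ K : γ → Set (Real × Real), (∀ c, IsClosed (K c)) ∧ (∀ c x y, (x, y) ∈ K c → P c x) ∧
    ∀ W, ArithClosed W → ∀ x ∈ W, ∃ Y : γ × ℕ → ℕ, Fn W Y ∧
      ∀ c, P c x → (x, fun n => Y (c, n)) ∈ K c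

/-- Arithmetical predicates of a number and a real, in semantic form: they are evaluated inside
each arithmetically closed set of reals, and both they and their negations have witnesses. -/
structure IsArith {γ : Type} [Denumerable γ] (P : γ → Real → Prop) : Prop where
  pr : ∀ W, ArithClosed W → ∀ x ∈ W, Pr W (fun c => P c x)
  pos : HasWitness P
  neg : HasWitness (fun c x => ¬ P c x)

/-- Functions that belong, up to coding, to every arithmetically closed set of reals. -/
def IsFixedFn {γ δ : Type} [Denumerable γ] [Denumerable δ] (f : γ → δ) : Prop :=
  ∀ W, ArithClosed W → Fn W f

section

variable {γ δ : Type} [Denumerable γ] [Denumerable δ]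

namespace HasWitness

theorem congr {P Q : γ → Real → Prop} (h : HasWitness P) (e : ∀ c x, P c x ↔ Q c x) :
    HasWitness Q := by
  have : P = Q := funext fun c => funext fun x => propext (e c x)
  rwa [← this]

theorem of_isClosed {P : γ → Real → Prop} (h : ∀ c, IsClosed {x | P c x}) : HasWitness P :=
  ⟨fun c => {p | P c p.1}, fun c => (h c).preimage continuous_fst, fun _ _ _ h => h,
    fun _ hW _ _ => ⟨fun _ => 0, Fn.const hW 0, fun _ h => h⟩⟩

theorem and {P Q : γ → Real → Prop} (hP : HasWitness P) (hQ : HasWitness Q) :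
    HasWitness (fun c x => P c x ∧ Q c x) := by
  obtain ⟨K, hK, h1, h2⟩ := hP
  obtain ⟨L, hL, h3, h4⟩ := hQ
  refine ⟨fun c => {p | (p.1, fun n => (p.2 n).unpair.1) ∈ K c ∧
    (p.1, fun n => (p.2 n).unpair.2) ∈ L c}, fun c => ?_, fun c x y h => ⟨h1 _ _ _ h.1,
    h3 _ _ _ h.2⟩, fun W hW x hx => ?_⟩
  · refine ((hK c).preimage ?_).inter ((hL c).preimage ?_)
    · exact continuous_fst.prodMk ((continuous_postcomp fun k => k.unpair.1).comp continuous_snd)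
    · exact continuous_fst.prodMk ((continuous_postcomp fun k => k.unpair.2).comp continuous_snd)
  · obtain ⟨Y, hY, hY'⟩ := h2 W hW x hx
    obtain ⟨Z, hZ, hZ'⟩ := h4 W hW x hx
    refine ⟨fun c => Nat.pair (Y c) (Z c), Fn.natPair hW hY hZ, fun c h => ⟨?_, ?_⟩⟩
    · simpa using hY' c h.1
    · simpa using hZ' c h.2

/-- The first value of the witness decides which of the two disjuncts it proves. -/
theorem or {P Q : γ → Real → Prop} (hP : HasWitness P) (hQ : HasWitness Q)
    (hPr : ∀ W, ArithClosed W → ∀ x ∈ W, Pr W (fun c => P c x)) :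
    HasWitness (fun c x => P c x ∨ Q c x) := by
  obtain ⟨K, hK, h1, h2⟩ := hP
  obtain ⟨L, hL, h3, h4⟩ := hQ
  refine ⟨fun c => {p | p ∈ (fun k : ℕ => {p : Real × Real | (k = 1 ∧
      (p.1, fun n => (p.2 n).unpair.2.unpair.1) ∈ K c) ∨
    (k ≠ 1 ∧ (p.1, fun n => (p.2 n).unpair.2.unpair.2) ∈ L c)}) (p.2 0).unpair.1}, fun c => ?_,
    fun c x y h => ?_, fun W hW x hx => ?_⟩
  · refine isClosed_switch (A := fun k : ℕ => {p : Real × Real | (k = 1 ∧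
      (p.1, fun n => (p.2 n).unpair.2.unpair.1) ∈ K c) ∨
      (k ≠ 1 ∧ (p.1, fun n => (p.2 n).unpair.2.unpair.2) ∈ L c)})
      (continuous_flag (F := Prod.snd) continuous_snd 0) fun k => ?_
    refine (isClosed_const.inter ((hK c).preimage ?_)).union
      (isClosed_const.inter ((hL c).preimage ?_))
    · exact continuous_fst.prodMk
        ((continuous_postcomp fun k => k.unpair.2.unpair.1).comp continuous_snd)
    · exact continuous_fst.prodMk
        ((continuous_postcomp fun k => k.unpair.2.unpair.2).comp continuous_snd)
  · rcases h with h | h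
    · exact Or.inl (h1 _ _ _ h.2)
    · exact Or.inr (h3 _ _ _ h.2)
  · obtain ⟨Y, hY, hY'⟩ := h2 W hW x hx
    obtain ⟨Z, hZ, hZ'⟩ := h4 W hW x hx
    have hp : Fn W (fun c : γ × ℕ => chi (fun k => P (ofNat γ k) x) (Encodable.encode c.1)) :=
      Fn.real hW (hPr W hW x hx) (Fn.comp hW (Fn.encode hW) (Fn.fst hW))
    refine ⟨fun c => Nat.pair _ (Nat.pair (Y c) (Z c)),
      Fn.natPair hW hp (Fn.natPair hW hY hZ), fun c h => ?_⟩
    by_cases hc : P c x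
    · left
      simp [hc, hY' c hc]
    · right
      simp [hc, hZ' c (h.resolve_left hc)]

/-- A witness for a universal number quantifier is the join of witnesses for all instances. -/
theorem all {P : γ → δ → Real → Prop} (h : HasWitness (fun c : γ × δ => P c.1 c.2)) :
    HasWitness (fun c x => ∀ d, P c d x) := by
  obtain ⟨K, hK, h1, h2⟩ := h
  refine ⟨fun c => {p | ∀ d, (p.1, fun n => p.2 (Nat.pair (Encodable.encode d) n)) ∈ K (c, d)},
    fun c => ?_, fun c x y h d => h1 (c, d) _ _ (h d), fun W hW x hx => ?_⟩
  · change IsClosed {p : Real × Real | ∀ d, (p.1, _) ∈ K (c, d)}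
    rw [Set.ofPred_forall]
    refine isClosed_iInter fun d => (hK (c, d)).preimage ?_
    exact continuous_fst.prodMk ((continuous_precomp _).comp continuous_snd)
  · obtain ⟨Y, hY, hY'⟩ := h2 W hW x hx
    refine ⟨fun c => Y ((c.1, ofNat δ c.2.unpair.1), c.2.unpair.2), ?_, fun c h d => ?_⟩
    · refine Fn.comp hW hY (Fn.pair hW (Fn.pair hW (Fn.fst hW) ?_) ?_)
      · exact Fn.comp hW (Fn.decode hW) (Fn.unpairFst hW (Fn.snd hW))
      · exact Fn.unpairSnd hW (Fn.snd hW)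
    · simpa using hY' (c, d) (h d)

/-- The first value of the witness is the instance `d c` that it proves. -/
theorem iUnion {P : γ → ℕ → Real → Prop} {K : γ → ℕ → Set (Real × Real)}
    (hK : ∀ c d, IsClosed (K c d)) (h1 : ∀ c d x y, (x, y) ∈ K c d → P c d x)
    (h2 : ∀ W, ArithClosed W → ∀ x ∈ W, ∃ (d : γ → ℕ) (Y : γ × ℕ → ℕ), Fn W d ∧ Fn W Y ∧
      ∀ c, (∃ d, P c d x) → (x, fun n => Y (c, n)) ∈ K c (d c)) :
    HasWitness (fun c x => ∃ d, P c d x) := by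
  refine ⟨fun c => {p | p ∈ (fun d : ℕ => {p : Real × Real |
    (p.1, fun n => (p.2 n).unpair.2) ∈ K c d}) (p.2 0).unpair.1}, fun c => ?_,
    fun c x y h => ⟨_, h1 _ _ _ _ h⟩, fun W hW x hx => ?_⟩
  · refine isClosed_switch (A := fun d : ℕ => {p : Real × Real |
      (p.1, fun n => (p.2 n).unpair.2) ∈ K c d})
      (continuous_flag (F := Prod.snd) continuous_snd 0) fun k => (hK _ _).preimage ?_
    exact continuous_fst.prodMk ((continuous_postcomp fun k => k.unpair.2).comp continuous_snd)
  · obtain ⟨d, Y, hd, hY, h⟩ := h2 W hW x hx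
    refine ⟨fun c => Nat.pair (d c.1) (Y c), Fn.natPair hW (Fn.comp hW hd (Fn.fst hW)) hY,
      fun c hc => ?_⟩
    simpa using h c hc

/-- As `P` is decidable in `W`, the least instance that holds can be found uniformly. -/
theorem ex {P : γ → δ → Real → Prop} (h : HasWitness (fun c : γ × δ => P c.1 c.2))
    (hPr : ∀ W, ArithClosed W → ∀ x ∈ W, Pr W (fun c : γ × δ => P c.1 c.2 x)) :
    HasWitness (fun c x => ∃ d, P c d x) := by
  obtain ⟨K, hK, h1, h2⟩ := h
  refine (iUnion (P := fun c k x => P c (ofNat δ k) x) (K := fun c k => K (c, ofNat δ k))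
    (fun c k => hK _) (fun c k x y h => h1 _ _ _ h) fun W hW x hx => ?_).congr fun c x =>
    ⟨fun ⟨k, hk⟩ => ⟨_, hk⟩, fun ⟨d, hd⟩ => ⟨Encodable.encode d, by simpa using hd⟩⟩
  obtain ⟨Y, hY, hY'⟩ := h2 W hW x hx
  obtain ⟨d, hd, hd'⟩ := Fn.exists_choice hW (P := fun c k => P c (ofNat δ k) x)
    (Pr.comp hW (hPr W hW x hx) (Fn.pair hW (Fn.fst hW) (Fn.comp hW (Fn.decode hW) (Fn.snd hW))))
  refine ⟨d, fun c => Y ((c.1, ofNat δ (d c.1)), c.2), hd, ?_, fun c h => hY' _ (hd' c h)⟩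
  exact Fn.comp hW hY (Fn.pair hW (Fn.pair hW (Fn.fst hW) (Fn.comp hW (Fn.decode hW)
    (Fn.comp hW hd (Fn.fst hW)))) (Fn.snd hW))

theorem reindex {P : δ → Real → Prop} {f : γ → δ} (h : HasWitness P) (hf : IsFixedFn f) :
    HasWitness (fun c x => P (f c) x) := by
  obtain ⟨K, hK, h1, h2⟩ := h
  refine ⟨fun c => K (f c), fun c => hK _, fun c x y h => h1 _ _ _ h, fun W hW x hx => ?_⟩
  obtain ⟨Y, hY, hY'⟩ := h2 W hW x hx
  exact ⟨fun c => Y (f c.1, c.2), Fn.comp hW hY (Fn.pair hW (Fn.comp hW (hf W hW) (Fn.fst hW))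
    (Fn.snd hW)), fun c h => hY' _ h⟩

theorem precomp {P : γ → Real → Prop} {F : Real → Real} (h : HasWitness P) (hF : Continuous F)
    (hFW : ∀ W, ArithClosed W → ∀ x ∈ W, F x ∈ W) : HasWitness (fun c x => P c (F x)) := by
  obtain ⟨K, hK, h1, h2⟩ := h
  refine ⟨fun c => {p | (F p.1, p.2) ∈ K c}, fun c => (hK c).preimage
    ((hF.comp continuous_fst).prodMk continuous_snd), fun c x y h => h1 _ _ _ h,
    fun W hW x hx => ?_⟩
  obtain ⟨Y, hY, hY'⟩ := h2 W hW _ (hFW W hW x hx)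
  exact ⟨Y, hY, hY'⟩

/-- Countable unions, not necessarily uniform. -/
theorem iUnion_nat {P : ℕ → Real → Prop} (h : ∀ d, HasWitness (fun (_ : ℕ) x => P d x)) :
    HasWitness (fun (_ : ℕ) x => ∃ d, P d x) := by
  choose K hK h1 h2 using h
  refine iUnion (P := fun _ d x => P d x) (K := fun c d => K d c) (fun c d => hK d c)
    (fun c d x y h => h1 _ _ _ _ h) fun W hW x hx => ?_
  by_cases hex : ∃ d, P d x
  · obtain ⟨d, hd⟩ := hex
    obtain ⟨Y, hY, hY'⟩ := h2 d W hW x hx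
    exact ⟨fun _ => d, Y, Fn.const hW d, hY, fun c _ => hY' c hd⟩
  · exact ⟨fun _ => 0, fun _ => 0, Fn.const hW _, Fn.const hW _, fun c h => absurd h hex⟩

end HasWitness

namespace IsArith

theorem congr {P Q : γ → Real → Prop} (h : IsArith P) (e : ∀ c x, P c x ↔ Q c x) :
    IsArith Q := by
  have : P = Q := funext fun c => funext fun x => propext (e c x)
  rwa [← this]

theorem not {P : γ → Real → Prop} (h : IsArith P) : IsArith (fun c x => ¬ P c x) :=
  ⟨fun W hW x hx => Pr.not hW (h.pr W hW x hx), h.neg, h.pos.congr fun _ _ => not_not.symm⟩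

theorem and {P Q : γ → Real → Prop} (hP : IsArith P) (hQ : IsArith Q) :
    IsArith (fun c x => P c x ∧ Q c x) :=
  ⟨fun W hW x hx => Pr.and hW (hP.pr W hW x hx) (hQ.pr W hW x hx), hP.pos.and hQ.pos,
    (hP.neg.or hQ.neg hP.not.pr).congr fun _ _ => by tauto⟩

theorem or {P Q : γ → Real → Prop} (hP : IsArith P) (hQ : IsArith Q) :
    IsArith (fun c x => P c x ∨ Q c x) :=
  (hP.not.and hQ.not).not.congr fun _ _ => by tauto

theorem imp {P Q : γ → Real → Prop} (hP : IsArith P) (hQ : IsArith Q) :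
    IsArith (fun c x => P c x → Q c x) :=
  (hP.and hQ.not).not.congr fun _ _ => by tauto

theorem iff {P Q : γ → Real → Prop} (hP : IsArith P) (hQ : IsArith Q) :
    IsArith (fun c x => P c x ↔ Q c x) :=
  ((hP.imp hQ).and (hQ.imp hP)).congr fun _ _ => by tauto

theorem ex {P : γ → δ → Real → Prop} (h : IsArith (fun c : γ × δ => P c.1 c.2)) :
    IsArith (fun c x => ∃ d, P c d x) :=
  ⟨fun W hW x hx => Pr.ex hW (P := fun c d => P c d x) (h.pr W hW x hx), h.pos.ex h.pr,
    (HasWitness.all (P := fun c d x => ¬ P c d x) h.neg).congr fun _ _ => by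
      simp only [not_exists]⟩

theorem all {P : γ → δ → Real → Prop} (h : IsArith (fun c : γ × δ => P c.1 c.2)) :
    IsArith (fun c x => ∀ d, P c d x) :=
  (IsArith.ex (P := fun c d x => ¬ P c d x) h.not).not.congr fun _ _ => by
    simp only [not_exists, not_not]

theorem reindex {P : δ → Real → Prop} {f : γ → δ} (h : IsArith P) (hf : IsFixedFn f) :
    IsArith (fun c x => P (f c) x) :=
  ⟨fun W hW x hx => Pr.comp hW (h.pr W hW x hx) (hf W hW), h.pos.reindex hf, h.neg.reindex hf⟩

theorem precomp {P : γ → Real → Prop} {F : Real → Real} (h : IsArith P) (hF : Continuous F)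
    (hFW : ∀ W, ArithClosed W → ∀ x ∈ W, F x ∈ W) : IsArith (fun c x => P c (F x)) :=
  ⟨fun W hW x hx => h.pr W hW _ (hFW W hW x hx), h.pos.precomp hF hFW, h.neg.precomp hF hFW⟩

theorem const {P : γ → Prop} (h : ∀ W, ArithClosed W → Pr W P) : IsArith (fun c _ => P c) :=
  ⟨fun W hW _ _ => h W hW, .of_isClosed fun _ => isClosed_const,
    .of_isClosed fun _ => isClosed_const⟩

theorem eval {f g : γ → ℕ} (hf : IsFixedFn f) (hg : IsFixedFn g) :
    IsArith (fun c x => x (f c) = g c) := by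
  have hc : ∀ c, IsClopen {x : Real | x (f c) = g c} := fun c =>
    (isClopen_discrete {g c}).preimage (continuous_apply (f c))
  exact ⟨fun W hW x hx => Pr.eq hW (Fn.real hW hx (hf W hW)) (hg W hW),
    .of_isClosed fun c => (hc c).isClosed, .of_isClosed fun c => (hc c).compl.isClosed⟩

end IsArith

end

/-! ### Codes of projective relations -/

/-- One code of a predicate with witnesses as a `Σ¹₁` relation is correct in all arithmetically
closed sets of reals: witnesses need not be sought outside. -/
theorem exists_sigma11_code {P : Real → Prop} (h : HasWitness (fun (_ : ℕ) x => P x)) :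
    ∃ c : Real, ∀ W, ArithClosed W → ∀ x ∈ W, (Sigma11 c W x ↔ P x) := by
  obtain ⟨K, hK, h1, h2⟩ := h
  obtain ⟨c, hc⟩ := exists_code₂ (hK 0)
  refine ⟨c, fun W hW x hx => ⟨fun ⟨y, _, hy⟩ => h1 0 x y ((hc x y).2 hy), fun h => ?_⟩⟩
  obtain ⟨Y, hY, hY'⟩ := h2 W hW x hx
  exact ⟨fun n => Y (0, n), Fn.comp hW hY (Fn.pair hW (Fn.const hW 0) (Fn.id hW)),
    (hc _ _).1 (hY' 0 h)⟩

/-- A code for the relation `∃ y (A(x, y) ∧ ∀ z (x, y, z) ∉ C)` with `A` arithmetical and `C`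
closed. The first value of the third real decides whether it refutes the witness for `A` or the
second conjunct. -/
theorem exists_sigma12_code {A : Real → Prop} (hA : HasWitness (fun (_ : ℕ) x => A x))
    {C : Set (Real × Real × Real)} (hC : IsClosed C) :
    ∃ c : Real, ∀ W, ArithClosed W → ∀ x ∈ W,
      (Sigma12 c W x ↔ ∃ y ∈ W, A (joinPair x y) ∧ ∀ z ∈ W, (x, y, z) ∉ C) := by
  obtain ⟨K, hK, h1, h2⟩ := hA
  obtain ⟨c₂, hc₂⟩ := exists_code₂ (hK 0)
  have hjoin : Continuous fun p : Real × Real => joinPair p.1 p.2 := by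
    refine continuous_pi fun k => ?_
    unfold joinPair
    split_ifs
    · exact (continuous_apply _).comp continuous_fst
    · exact (continuous_apply _).comp continuous_snd
  -- The second real joins `y` and a witness for `A(x, y)`. A third real that starts with `0` is a
  -- candidate for `(x, y, z) ∈ C`; one that starts with `k ≠ 0` claims that the witness for `A`
  -- fails at length `k - 1`.
  let D : ℕ → Set (Real × Real × Real) := fun k => {p |
      (k = 0 ∧ (p.1, (fun n => (p.2.1 n).unpair.1 : Real),
        (fun n => (p.2.2 n).unpair.2 : Real)) ∈ C)
      ∨ (k ≠ 0 ∧ c₂ (Encodable.encode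
          (initSeg (joinPair p.1 (fun n => (p.2.1 n).unpair.1)) (k - 1),
          initSeg (fun n => (p.2.1 n).unpair.2) (k - 1))) ≠ 0)}
  have hK3 : IsClosed {p : Real × Real × Real | p ∈ D (p.2.2 0).unpair.1} := by
    have hfst : Continuous fun p : Real × Real × Real => (fun n => (p.2.1 n).unpair.1 : Real) :=
      (continuous_postcomp fun k => k.unpair.1).comp (continuous_fst.comp continuous_snd)
    have hsnd : Continuous fun p : Real × Real × Real => (fun n => (p.2.1 n).unpair.2 : Real) :=
      (continuous_postcomp fun k => k.unpair.2).comp (continuous_fst.comp continuous_snd)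
    refine isClosed_switch (A := D) (continuous_flag
      (F := fun p => p.2.2) (continuous_snd.comp continuous_snd) 0) fun k => ?_
    refine (isClosed_const.inter (hC.preimage ?_)).union (isClosed_const.inter ?_)
    · exact continuous_fst.prodMk (hfst.prodMk
        ((continuous_postcomp fun k => k.unpair.2).comp (continuous_snd.comp continuous_snd)))
    · have e1 := continuous_initSeg (hjoin.comp (continuous_fst.prodMk hfst)) (k - 1)
        Encodable.encode
      have e2 := continuous_initSeg hsnd (k - 1) Encodable.encode
      have e3 := (continuous_of_discreteTopology (f := fun q : ℕ × ℕ => c₂ (Nat.pair q.1 q.2))).comp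
        (e1.prodMk e2)
      exact ((isClopen_discrete ({0}ᶜ : Set ℕ)).preimage e3).isClosed
  obtain ⟨c, hc⟩ := exists_code₃ hK3
  refine ⟨c, fun W hW x hx => ⟨?_, ?_⟩⟩
  · rintro ⟨y, hy, h⟩
    have h' : ∀ z ∈ W, (x, y, z) ∉ _ := fun z hz hm => by
      obtain ⟨n, hn⟩ := h z hz
      exact hn ((hc x y z).1 hm n)
    refine ⟨fun n => (y n).unpair.1, hW.comp _ (hW.basic 0) _ hy, ?_, fun z hz hm => ?_⟩
    · refine h1 0 _ (fun n => (y n).unpair.2) ((hc₂ _ _).2 fun n => ?_)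
      by_contra hn
      refine h' (fun _ => Nat.pair (n + 1) 0) (Fn.const hW (γ := ℕ) (Nat.pair (n + 1) 0)) ?_
      simpa [D] using hn
    · refine h' (fun n => Nat.pair 0 (z n)) (hW.pair _ (Fn.const hW (γ := ℕ) 0) _ hz) ?_
      simpa [D] using hm
  · rintro ⟨y, hy, hA, hz⟩
    obtain ⟨Y, hY, hY'⟩ := h2 W hW _ (joinPair_mem hW hx hy)
    have hYW : (fun n => Y (0, n)) ∈ W :=
      Fn.comp hW hY (Fn.pair hW (Fn.const hW 0) (Fn.id hW))
    refine ⟨fun n => Nat.pair (y n) (Y (0, n)), hW.pair _ hy _ hYW, fun z hzW => ?_⟩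
    by_contra hcon
    push Not at hcon
    have hm := (hc x _ z).2 hcon
    rcases hm with ⟨_, hm⟩ | ⟨_, hm⟩
    · refine hz (fun n => (z n).unpair.2) (hW.comp _ (hW.basic 1) _ hzW) ?_
      simpa [D] using hm
    · have := (hc₂ _ _).1 (hY' 0 hA) ((z 0).unpair.1 - 1)
      simp only [Nat.unpair_pair] at hm
      exact hm this

/-- The reals with property `B` are those over which a tree has no branch: the real `c` codes the
tree, and `v` lies over `w` if `w` is its first component. In this form `B` can be evaluated in a
model that contains `c`. -/
theorem exists_branch_code {B : Real → Prop} (h : HasWitness (fun (_ : ℕ) x => ¬ B x)) :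
    ∃ c : Real, ∀ W, ArithClosed W → ∀ w ∈ W, (B w ↔ ∀ v ∈ W, (∀ n, (v n).unpair.1 = w n) →
      ∃ n, c (Encodable.encode (initSeg v n)) ≠ 0) := by
  obtain ⟨K, hK, h1, h2⟩ := h
  have hK' : IsClosed {v : Real | ((fun n => (v n).unpair.1 : Real),
      (fun n => (v n).unpair.2 : Real)) ∈ K 0} :=
    (hK 0).preimage ((continuous_postcomp fun k => k.unpair.1).prodMk
      (continuous_postcomp fun k => k.unpair.2))
  obtain ⟨c, hc⟩ := exists_code₁ hK'
  refine ⟨c, fun W hW w hw => ⟨fun hB v hv hvw => ?_, fun h => ?_⟩⟩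
  · by_contra hcon
    push Not at hcon
    have := h1 0 _ _ ((hc v).2 hcon)
    rw [funext hvw] at this
    exact this hB
  · by_contra hB
    obtain ⟨Y, hY, hY'⟩ := h2 W hW w hw
    have hYW : (fun n => Y (0, n)) ∈ W :=
      Fn.comp hW hY (Fn.pair hW (Fn.const hW 0) (Fn.id hW))
    obtain ⟨n, hn⟩ := h (fun n => Nat.pair (w n) (Y (0, n))) (hW.pair _ hw _ hYW) (by simp)
    refine hn ((hc _).1 ?_ n)
    simpa using hY' 0 hB

/-! ### Comprehension for reals in a model -/

section

variable {M : ZFSet.{u}}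

/-- The numeral `n` as an element of the model. -/
noncomputable def IsBase.num (hB : IsBase M) (n : ℕ) : El M :=
  ⟨natSet n, hB.transitive.mem_trans (natSet_mem_omegaSet n) hB.omega⟩

@[simp] theorem IsBase.num_val (hB : IsBase M) (n : ℕ) : (hB.num n).1 = natSet n := rfl

/-- The set `ω` as an element of the model. -/
noncomputable def IsBase.om (hB : IsBase M) : El M := ⟨omegaSet, hB.omega⟩

/-- Quantifiers of a model that are bounded by `ω` are number quantifiers. -/
theorem IsBase.ex_om (hB : IsBase M) {p : El M → Prop} :
    (∃ k : El M, k.1 ∈ hB.om.1 ∧ p k) ↔ ∃ n, p (hB.num n) := by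
  constructor
  · rintro ⟨k, hk, h⟩
    obtain ⟨n, hn⟩ := mem_omegaSet.1 hk
    have : hB.num n = k := Subtype.ext hn
    exact ⟨n, this ▸ h⟩
  · rintro ⟨n, h⟩
    exact ⟨hB.num n, natSet_mem_omegaSet n, h⟩

theorem IsBase.all_om (hB : IsBase M) {p : El M → Prop} :
    (∀ k : El M, k.1 ∈ hB.om.1 → p k) ↔ ∀ n, p (hB.num n) := by
  constructor
  · intro h n
    exact h _ (natSet_mem_omegaSet n)
  · intro h k hk
    obtain ⟨n, hn⟩ := mem_omegaSet.1 hk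
    have : hB.num n = k := Subtype.ext hn
    exact this ▸ h n

/-- Quantifiers of a model over functions from `ω` to `ω` are quantifiers over its reals. -/
theorem IsBase.ex_real (hB : IsBase M) {p : El M → Prop} :
    (∃ k : El M, IsFunctionOn M k hB.om ∧ p k) ↔ ∃ x, ∃ hx : x ∈ realsOf M, p ⟨realSet x, hx⟩ := by
  constructor
  · rintro ⟨k, hk, h⟩
    obtain ⟨x, hx⟩ := (isFunctionOn_iff hB.transitive hB.omega k).1 hk
    have hxW : x ∈ realsOf M := by
      rw [realsOf, Set.mem_ofPred_eq, hx]
      exact k.2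
    have : (⟨realSet x, hxW⟩ : El M) = k := Subtype.ext hx
    exact ⟨x, hxW, this ▸ h⟩
  · rintro ⟨x, hx, h⟩
    exact ⟨_, (isFunctionOn_iff hB.transitive hB.omega _).2 ⟨x, rfl⟩, h⟩

theorem IsBase.all_real (hB : IsBase M) {p : El M → Prop} :
    (∀ k : El M, IsFunctionOn M k hB.om → p k) ↔ ∀ x, ∀ hx : x ∈ realsOf M, p ⟨realSet x, hx⟩ := by
  have := hB.ex_real (p := fun k => ¬ p k)
  constructor
  · intro h x hx
    by_contra hc
    obtain ⟨k, hk, h'⟩ := this.2 ⟨x, hx, hc⟩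
    exact h' (h k hk)
  · intro h k hk
    by_contra hc
    obtain ⟨x, hx, h'⟩ := this.1 ⟨k, hk, hc⟩
    exact h' (h x hx)

end

/-- A real whose graph is defined by a uniformly definable predicate belongs to the model. The
variables `0` and `1` are the argument and the value. -/
theorem Ensured.real_comprehension {m : ℕ} {P : ∀ M : ZFSet.{u}, (Fin (m + 2) → El M) → Prop}
    (h : UDef (m + 2) P) : Ensured (fun M => ∀ hB : IsBase M, ∀ (v : Fin m → El M) (x : Real),
      (∀ a b, P M (Fin.cons (hB.num a) (Fin.cons (hB.num b) v)) ↔ x a = b) → x ∈ realsOf M) := by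
  have h1 : UDef (m + 1) (fun M w => ∃ a b : El M, (w 0).1 = ZFSet.pair a.1 b.1 ∧
      P M (Fin.cons a (Fin.cons b (fun i => w i.succ)))) := by
    refine UDef.ex (UDef.ex (UDef.and (UDef.pair 1 0 2) ?_))
    refine (h.reindex (Fin.cons 1 (Fin.cons 0 (fun i => i.succ.succ.succ)))).congr
      fun M _ v => iff_of_eq (congrArg _ ?_)
    funext i
    refine Fin.cases ?_ (Fin.cases ?_ fun i => ?_) i <;> rfl
  refine (Ensured.separation h1).mono fun M hM hsep hB v x hx => ?_
  obtain ⟨Y, hYM, hY⟩ := hB.natPairs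
  obtain ⟨b, hb⟩ := hsep v ⟨Y, hYM⟩
  have : realSet x = b.1 := by
    ext z
    rw [mem_realSet]
    constructor
    · rintro ⟨n, rfl⟩
      have hz : ZFSet.pair (natSet n) (natSet (x n)) ∈ Y := (hY _).2 ⟨_, _, rfl⟩
      exact (hb ⟨_, hM.mem_trans hz hYM⟩).2 ⟨hz, hB.num n, hB.num (x n), rfl, (hx _ _).2 rfl⟩
    · intro hz
      obtain ⟨hzY, a, c, hac, hP⟩ := (hb ⟨z, hM.mem_trans hz b.2⟩).1 hz
      obtain ⟨n, k, hnk⟩ := (hY z).1 hzY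
      have hac : z = ZFSet.pair a.1 c.1 := hac
      rw [hac, ZFSet.pair_inj] at hnk
      have ha : hB.num n = a := Subtype.ext hnk.1.symm
      have hc : hB.num k = c := Subtype.ext hnk.2.symm
      have hP : P M (Fin.cons a (Fin.cons c v)) := hP
      rw [← ha, ← hc, hx] at hP
      exact ⟨n, by rw [hac, ← ha, ← hc, hP]; rfl⟩
  rw [realsOf, Set.mem_ofPred_eq, this]
  exact b.2

/-! ### Coding a table of reals into the parameter -/

/-- Positions of the parameter that code pairs of sequences of different lengths, within the code
with index `0`. They are irrelevant for the coded relations and serve to store a table of further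
reals. -/
def freePos (n : ℕ) : ℕ := Nat.pair 0 (Encodable.encode (([] : Node), [n]))

theorem freePos_strictMono : StrictMono freePos := by
  intro m n h
  refine Nat.pair_lt_pair_right _ ?_
  rw [Encodable.encode_prod_val, Encodable.encode_prod_val]
  refine Nat.pair_lt_pair_right _ ?_
  rw [Encodable.encode_list_cons, Encodable.encode_list_cons]
  exact Nat.succ_lt_succ (Nat.pair_lt_pair_left _ h)

/-- The stored sequence: it lists the values `tab i a = b` in blocks `2, i + 3, a + 3, b + 3`. All
entries are at least `2`, which distinguishes them from the values of the codes, and the entry `2`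
marks the beginning of a block. -/
def tableEntry (tab : ℕ → Real) (n : ℕ) : ℕ :=
  if n % 4 = 0 then 2
  else if n % 4 = 1 then (n / 4).unpair.1 + 3
  else if n % 4 = 2 then (n / 4).unpair.2 + 3
  else tab (n / 4).unpair.1 (n / 4).unpair.2 + 3

theorem two_le_tableEntry (tab : ℕ → Real) (n : ℕ) : 2 ≤ tableEntry tab n := by
  unfold tableEntry
  split_ifs <;> omega

open Classical in
/-- The parameter that consists of the codes `c j` and of the table `tab`. Only the zeros of a code
matter, so its values can be replaced by `0` and `1`. -/
noncomputable def mkParam (c tab : ℕ → Real) : Real := fun k =>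
  if h : ∃ n, freePos n = k then tableEntry tab h.choose
  else if c k.unpair.1 k.unpair.2 = 0 then 0 else 1

theorem mkParam_freePos (c tab : ℕ → Real) (n : ℕ) :
    mkParam c tab (freePos n) = tableEntry tab n := by
  have h : ∃ m, freePos m = freePos n := ⟨n, rfl⟩
  unfold mkParam
  rw [dif_pos h, freePos_strictMono.injective h.choose_spec]

theorem mkParam_of_ne (c tab : ℕ → Real) {k : ℕ} (h : ∀ n, freePos n ≠ k) :
    mkParam c tab k = if c k.unpair.1 k.unpair.2 = 0 then 0 else 1 := by
  unfold mkParam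
  rw [dif_neg (by simpa using h)]

theorem two_le_mkParam {c tab : ℕ → Real} {k : ℕ} :
    2 ≤ mkParam c tab k ↔ ∃ n, freePos n = k := by
  constructor
  · intro h
    by_contra hc
    rw [mkParam_of_ne c tab (by simpa using hc)] at h
    split_ifs at h <;> omega
  · rintro ⟨n, rfl⟩
    rw [mkParam_freePos]
    exact two_le_tableEntry tab n

/-- The table does not affect the coded `Σ¹₁` relations, since a code is evaluated only at pairs of
sequences of equal length. -/
theorem sigma11_mkParam (c tab : ℕ → Real) (j : ℕ) (W : Set Real) (x : Real) :
    Sigma11 (codeAt (mkParam c tab) j) W x ↔ Sigma11 (c j) W x := by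
  refine exists_congr fun y => and_congr_right fun _ => forall_congr' fun n => ?_
  unfold codeAt
  rw [mkParam_of_ne]
  · simp
  · intro m hm
    have h1 := congrArg (fun k => (Nat.unpair k).2) hm
    simp only [freePos, Nat.unpair_pair] at h1
    obtain ⟨h2, h3⟩ := Prod.ext_iff.1 (Encodable.encode_injective h1)
    have h4 := congrArg List.length h2
    have h5 := congrArg List.length h3
    simp at h4 h5
    omega

/-- The codes of `Σ¹₂` relations have indices other than `0`, and the table is stored in the code
with index `0`. -/
theorem sigma12_mkParam (c tab : ℕ → Real) {j : ℕ} (hj : j ≠ 0) (W : Set Real) (x : Real) :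
    Sigma12 (codeAt (mkParam c tab) j) W x ↔ Sigma12 (c j) W x := by
  refine exists_congr fun y => and_congr_right fun _ => forall₂_congr fun z _ =>
    exists_congr fun n => ?_
  unfold codeAt
  rw [mkParam_of_ne]
  · simp
  · intro m hm
    have h1 := congrArg (fun k => (Nat.unpair k).1) hm
    simp only [freePos, Nat.unpair_pair] at h1
    exact hj h1.symm

/-- `q` is the next position after `p` with a value other than `0` and `1`. -/
def NextEntry (r : Real) (p q : ℕ) : Prop :=
  p < q ∧ ¬ r q = 0 ∧ ¬ r q = 1 ∧ ∀ t, t < q → p < t → r t = 0 ∨ r t = 1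

theorem nextEntry_mkParam {c tab : ℕ → Real} {n q : ℕ} :
    NextEntry (mkParam c tab) (freePos n) q ↔ q = freePos (n + 1) := by
  have key : ∀ {k}, (¬ mkParam c tab k = 0 ∧ ¬ mkParam c tab k = 1) ↔ ∃ n, freePos n = k := by
    intro k
    rw [← two_le_mkParam (c := c) (tab := tab)]
    omega
  constructor
  · rintro ⟨h1, h2, h3, h4⟩
    obtain ⟨m, rfl⟩ := key.1 ⟨h2, h3⟩
    have hnm := freePos_strictMono.lt_iff_lt.1 h1
    rcases Nat.lt_or_ge (n + 1) m with h | h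
    · have h5 := h4 (freePos (n + 1)) (freePos_strictMono h) (freePos_strictMono (by omega))
      have h6 := (key (k := freePos (n + 1))).2 ⟨_, rfl⟩
      omega
    · rw [show m = n + 1 by omega]
  · rintro rfl
    obtain ⟨h2, h3⟩ := (key (k := freePos (n + 1))).2 ⟨_, rfl⟩
    refine ⟨freePos_strictMono (by omega), h2, h3, fun t ht ht' => ?_⟩
    by_contra hc
    rw [not_or] at hc
    obtain ⟨m, rfl⟩ := key.1 hc
    have := freePos_strictMono.lt_iff_lt.1 ht
    have := freePos_strictMono.lt_iff_lt.1 ht'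
    omega

/-- The table can be read from the parameter by comparing positions, without arithmetic on them: a
value is found in four consecutive entries that start with the mark `2`. -/
theorem mkParam_table (c tab : ℕ → Real) (i a b : ℕ) : (∃ p0, mkParam c tab p0 = 2 ∧
    ∃ p1, NextEntry (mkParam c tab) p0 p1 ∧ mkParam c tab p1 = i + 3 ∧
    ∃ p2, NextEntry (mkParam c tab) p1 p2 ∧ mkParam c tab p2 = a + 3 ∧
    ∃ p3, NextEntry (mkParam c tab) p2 p3 ∧ mkParam c tab p3 = b + 3) ↔ tab i a = b := by
  constructor
  · rintro ⟨p0, h0, p1, n1, h1, p2, n2, h2, p3, n3, h3⟩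
    obtain ⟨n, rfl⟩ := (two_le_mkParam (c := c) (tab := tab)).1 (by omega : 2 ≤ mkParam c tab p0)
    obtain rfl := nextEntry_mkParam.1 n1
    obtain rfl := nextEntry_mkParam.1 n2
    obtain rfl := nextEntry_mkParam.1 n3
    rw [mkParam_freePos] at h0 h1 h2 h3
    have hn : n % 4 = 0 := by
      unfold tableEntry at h0
      split_ifs at h0 <;> omega
    have e1 : (n + 1) / 4 = n / 4 := by omega
    have e2 : (n + 1 + 1) / 4 = n / 4 := by omega
    have e3 : (n + 1 + 1 + 1) / 4 = n / 4 := by omega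
    have m1 : (n + 1) % 4 = 1 := by omega
    have m2 : (n + 1 + 1) % 4 = 2 := by omega
    have m3 : (n + 1 + 1 + 1) % 4 = 3 := by omega
    simp only [tableEntry, e1, m1, e2, m2, e3, m3] at h1 h2 h3
    simp at h1 h2 h3
    rw [← h1, ← h2, h3]
  · rintro rfl
    have e1 : (4 * Nat.pair i a + 1) / 4 = Nat.pair i a := by omega
    have e2 : (4 * Nat.pair i a + 1 + 1) / 4 = Nat.pair i a := by omega
    have e3 : (4 * Nat.pair i a + 1 + 1 + 1) / 4 = Nat.pair i a := by omega
    have m0 : (4 * Nat.pair i a) % 4 = 0 := by omega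
    have m1 : (4 * Nat.pair i a + 1) % 4 = 1 := by omega
    have m2 : (4 * Nat.pair i a + 1 + 1) % 4 = 2 := by omega
    have m3 : (4 * Nat.pair i a + 1 + 1 + 1) % 4 = 3 := by omega
    refine ⟨freePos (4 * Nat.pair i a), ?_, _, nextEntry_mkParam.2 rfl, ?_, _,
      nextEntry_mkParam.2 rfl, ?_, _, nextEntry_mkParam.2 rfl, ?_⟩ <;>
    simp [mkParam_freePos, tableEntry, e1, m0, m1, e2, m2, e3, m3]

/-- `NextEntry`, in `M`, for numerals `p` and `q`. -/
def NextEntryIn (M : ZFSet.{u}) (r p q w zero one : El M) : Prop :=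
  p.1 ∈ q.1 ∧ ¬ ZFSet.pair q.1 zero.1 ∈ r.1 ∧ ¬ ZFSet.pair q.1 one.1 ∈ r.1 ∧
    ∀ t : El M, t.1 ∈ w.1 → t.1 ∈ q.1 → p.1 ∈ t.1 →
      ZFSet.pair t.1 zero.1 ∈ r.1 ∨ ZFSet.pair t.1 one.1 ∈ r.1

theorem UDef.nextEntryIn {n : ℕ} (r p q w zero one : Fin n) : UDef.{u} n
    (fun M v => NextEntryIn M (v r) (v p) (v q) (v w) (v zero) (v one)) := by
  unfold NextEntryIn
  repeat' (first | apply UDef.app | apply UDef.mem | apply UDef.and | apply UDef.or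
                    | apply UDef.not | apply UDef.imp | apply UDef.all)

theorem nextEntryIn_iff {M : ZFSet.{u}} (hB : IsBase M) {r : Real} (hr : r ∈ realsOf M)
    (p q : ℕ) : NextEntryIn M ⟨realSet r, hr⟩ (hB.num p) (hB.num q) hB.om (hB.num 0) (hB.num 1) ↔
      NextEntry r p q := by
  unfold NextEntryIn NextEntry
  rw [hB.all_om]
  simp only [IsBase.num_val, pair_mem_realSet, natSet_mem_natSet]

/-- `c = a + 3`, in `M`. -/
def AddThreeIn (M : ZFSet.{u}) (a c : El M) : Prop :=
  ∃ b : El M, b.1 = insert a.1 a.1 ∧ ∃ b' : El M, b'.1 = insert b.1 b.1 ∧ c.1 = insert b'.1 b'.1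

theorem UDef.addThreeIn {n : ℕ} (a c : Fin n) :
    UDef.{u} n (fun M v => AddThreeIn M (v a) (v c)) := by
  unfold AddThreeIn
  repeat' (first | apply UDef.succ | apply UDef.and | apply UDef.ex)

theorem addThreeIn_iff {M : ZFSet.{u}} (hB : IsBase M) (a c : ℕ) :
    AddThreeIn M (hB.num a) (hB.num c) ↔ c = a + 3 := by
  constructor
  · rintro ⟨b, hb, b', hb', h⟩
    have : natSet.{u} c = natSet (a + 3) := by
      have h : natSet.{u} c = insert b'.1 b'.1 := h
      rw [h, hb', hb]
      rfl
    exact natSet_inj.1 this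
  · rintro rfl
    exact ⟨hB.num (a + 1), rfl, hB.num (a + 2), rfl, rfl⟩

/-- The formula that reads `tab i a = b` from the parameter `r`, as in `mkParam_table`; the set `i`
stands for the numeral of `i + 3`, and `w` for `ω`. -/
def TableIn (M : ZFSet.{u}) (a b r w zero one two i : El M) : Prop :=
  ∃ p0 : El M, p0.1 ∈ w.1 ∧ ZFSet.pair p0.1 two.1 ∈ r.1 ∧
  ∃ p1 : El M, p1.1 ∈ w.1 ∧ NextEntryIn M r p0 p1 w zero one ∧ ZFSet.pair p1.1 i.1 ∈ r.1 ∧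
  ∃ p2 : El M, p2.1 ∈ w.1 ∧ NextEntryIn M r p1 p2 w zero one ∧
    (∃ a' : El M, a'.1 ∈ w.1 ∧ AddThreeIn M a a' ∧ ZFSet.pair p2.1 a'.1 ∈ r.1) ∧
  ∃ p3 : El M, p3.1 ∈ w.1 ∧ NextEntryIn M r p2 p3 w zero one ∧
    ∃ b' : El M, b'.1 ∈ w.1 ∧ AddThreeIn M b b' ∧ ZFSet.pair p3.1 b'.1 ∈ r.1

/-- A model that contains the parameter contains the reals stored in it. -/
theorem Ensured.table : Ensured.{u} (fun M => IsBase M → ∀ c tab : ℕ → Real,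
    mkParam c tab ∈ realsOf M → ∀ i, tab i ∈ realsOf M) := by
  have h : UDef.{u} (6 + 2) (fun M w =>
      TableIn M (w 0) (w 1) (w 2) (w 3) (w 4) (w 5) (w 6) (w 7)) := by
    unfold TableIn
    repeat' (first | apply UDef.nextEntryIn | apply UDef.addThreeIn | apply UDef.app
                    | apply UDef.mem | apply UDef.and | apply UDef.ex)
  refine (Ensured.real_comprehension h).mono fun M _ hM hB c tab hr i => ?_
  refine hM hB ![⟨realSet (mkParam c tab), hr⟩, hB.om, hB.num 0, hB.num 1, hB.num 2,
    hB.num (i + 3)] (tab i) fun a b => ?_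
  rw [← mkParam_table c tab i a b]
  change TableIn M (hB.num a) (hB.num b) ⟨realSet (mkParam c tab), hr⟩ hB.om
    (hB.num 0) (hB.num 1) (hB.num 2) (hB.num (i + 3)) ↔ _
  unfold TableIn
  simp only [hB.ex_om, nextEntryIn_iff, addThreeIn_iff, IsBase.num_val, pair_mem_realSet,
    exists_eq_left]

/-! ### The reals of a model are arithmetically closed -/

theorem Ensured.comp : Ensured.{u} (fun M => IsBase M → ∀ x ∈ realsOf M, ∀ y ∈ realsOf M,
    (fun n => x (y n) : Real) ∈ realsOf M) := by
  have h : UDef.{u} (3 + 2) (fun M w => ∃ k : El M, k.1 ∈ (w 2).1 ∧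
      ZFSet.pair (w 0).1 k.1 ∈ (w 4).1 ∧ ZFSet.pair k.1 (w 1).1 ∈ (w 3).1) := by
    repeat' (first | apply UDef.app | apply UDef.mem | apply UDef.and | apply UDef.ex)
  refine (Ensured.real_comprehension h).mono fun M _ hM hB x hx y hy => ?_
  refine hM hB ![hB.om, ⟨realSet x, hx⟩, ⟨realSet y, hy⟩] _ fun a b => ?_
  change (∃ k : El M, k.1 ∈ hB.om.1 ∧ ZFSet.pair (hB.num a).1 k.1 ∈ realSet y ∧
    ZFSet.pair k.1 (hB.num b).1 ∈ realSet x) ↔ _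
  simp only [hB.ex_om, IsBase.num_val, pair_mem_realSet, exists_eq_left']

theorem Ensured.pair : Ensured.{u} (fun M => IsBase M → basic 0 ∈ realsOf M →
    basic 1 ∈ realsOf M → ∀ x ∈ realsOf M, ∀ y ∈ realsOf M,
    (fun n => Nat.pair (x n) (y n) : Real) ∈ realsOf M) := by
  have h : UDef.{u} (5 + 2) (fun M w => ∃ i : El M, i.1 ∈ (w 2).1 ∧ ∃ j : El M, j.1 ∈ (w 2).1 ∧
      ZFSet.pair (w 0).1 i.1 ∈ (w 3).1 ∧ ZFSet.pair (w 0).1 j.1 ∈ (w 4).1 ∧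
      ZFSet.pair (w 1).1 i.1 ∈ (w 5).1 ∧ ZFSet.pair (w 1).1 j.1 ∈ (w 6).1) := by
    repeat' (first | apply UDef.app | apply UDef.mem | apply UDef.and | apply UDef.ex)
  refine (Ensured.real_comprehension h).mono fun M _ hM hB h0 h1 x hx y hy => ?_
  refine hM hB ![hB.om, ⟨realSet x, hx⟩, ⟨realSet y, hy⟩, ⟨realSet (basic 0), h0⟩,
    ⟨realSet (basic 1), h1⟩] _ fun a b => ?_
  change (∃ i : El M, i.1 ∈ hB.om.1 ∧ ∃ j : El M, j.1 ∈ hB.om.1 ∧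
      ZFSet.pair (hB.num a).1 i.1 ∈ realSet x ∧ ZFSet.pair (hB.num a).1 j.1 ∈ realSet y ∧
      ZFSet.pair (hB.num b).1 i.1 ∈ realSet (basic 0) ∧
      ZFSet.pair (hB.num b).1 j.1 ∈ realSet (basic 1)) ↔ _
  simp only [hB.ex_om, IsBase.num_val, pair_mem_realSet, basic]
  constructor
  · rintro ⟨i, j, rfl, rfl, h1, h2⟩
    rw [← h1, ← h2, Nat.pair_unpair]
  · rintro rfl
    exact ⟨_, _, rfl, rfl, by simp, by simp⟩

theorem chi_eq_iff {P : ℕ → Prop} {a b : ℕ} :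
    chi P a = b ↔ (b = 1 ∧ P a) ∨ (b = 0 ∧ ¬ P a) := by
  unfold chi
  split_ifs with h <;> simp [h, eq_comm]

theorem Ensured.arith_ex : Ensured.{u} (fun M => IsBase M → basic 0 ∈ realsOf M →
    ∀ x ∈ realsOf M, chi (fun n => ∃ k, x (Nat.pair n k) = 1) ∈ realsOf M) := by
  have h : UDef.{u} (5 + 2) (fun M w =>
      ((w 1).1 = (w 5).1 ∧ ∃ l : El M, l.1 ∈ (w 2).1 ∧
        ZFSet.pair l.1 (w 0).1 ∈ (w 4).1 ∧ ZFSet.pair l.1 (w 5).1 ∈ (w 3).1) ∨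
      ((w 1).1 = (w 6).1 ∧ ¬ ∃ l : El M, l.1 ∈ (w 2).1 ∧
        ZFSet.pair l.1 (w 0).1 ∈ (w 4).1 ∧ ZFSet.pair l.1 (w 5).1 ∈ (w 3).1)) := by
    repeat' (first | apply UDef.app | apply UDef.mem | apply UDef.eq | apply UDef.and
                    | apply UDef.or | apply UDef.not | apply UDef.ex)
  refine (Ensured.real_comprehension h).mono fun M _ hM hB h0 x hx => ?_
  refine hM hB ![hB.om, ⟨realSet x, hx⟩, ⟨realSet (basic 0), h0⟩, hB.num 1, hB.num 0] _
    fun a b => ?_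
  change ((hB.num b).1 = (hB.num 1).1 ∧ ∃ l : El M, l.1 ∈ hB.om.1 ∧
        ZFSet.pair l.1 (hB.num a).1 ∈ realSet (basic 0) ∧
        ZFSet.pair l.1 (hB.num 1).1 ∈ realSet x) ∨
      ((hB.num b).1 = (hB.num 0).1 ∧ ¬ ∃ l : El M, l.1 ∈ hB.om.1 ∧
        ZFSet.pair l.1 (hB.num a).1 ∈ realSet (basic 0) ∧
        ZFSet.pair l.1 (hB.num 1).1 ∈ realSet x) ↔ _
  simp only [hB.ex_om, IsBase.num_val, pair_mem_realSet, natSet_inj, basic]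
  rw [chi_eq_iff]
  have : (∃ n, (Nat.unpair n).1 = a ∧ x n = 1) ↔ ∃ k, x (Nat.pair a k) = 1 := by
    constructor
    · rintro ⟨n, rfl, h⟩
      exact ⟨n.unpair.2, by rwa [Nat.pair_unpair]⟩
    · rintro ⟨k, h⟩
      exact ⟨_, by simp, h⟩
  rw [this]

theorem Ensured.graph : Ensured.{u} (fun M => IsBase M → basic 0 ∈ realsOf M →
    basic 1 ∈ realsOf M → ∀ x ∈ realsOf M, ∀ f : Real,
    (∀ n m, f n = m ↔ x (Nat.pair n m) = 1) → f ∈ realsOf M) := by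
  have h : UDef.{u} (5 + 2) (fun M w => ∃ l : El M, l.1 ∈ (w 2).1 ∧
      ZFSet.pair l.1 (w 0).1 ∈ (w 4).1 ∧ ZFSet.pair l.1 (w 1).1 ∈ (w 5).1 ∧
      ZFSet.pair l.1 (w 6).1 ∈ (w 3).1) := by
    repeat' (first | apply UDef.app | apply UDef.mem | apply UDef.and | apply UDef.ex)
  refine (Ensured.real_comprehension h).mono fun M _ hM hB h0 h1 x hx f hf => ?_
  refine hM hB ![hB.om, ⟨realSet x, hx⟩, ⟨realSet (basic 0), h0⟩,
    ⟨realSet (basic 1), h1⟩, hB.num 1] _ fun a b => ?_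
  change (∃ l : El M, l.1 ∈ hB.om.1 ∧ ZFSet.pair l.1 (hB.num a).1 ∈ realSet (basic 0) ∧
    ZFSet.pair l.1 (hB.num b).1 ∈ realSet (basic 1) ∧
    ZFSet.pair l.1 (hB.num 1).1 ∈ realSet x) ↔ _
  simp only [hB.ex_om, IsBase.num_val, pair_mem_realSet, basic]
  rw [hf]
  constructor
  · rintro ⟨n, rfl, rfl, h⟩
    rwa [Nat.pair_unpair]
  · intro h
    exact ⟨_, by simp, by simp, h⟩

/-- The table that starts with the functions `basic i` for `i < 20`, which are all of them, and
continues with the reals `e i`. -/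
noncomputable def tableOf (e : ℕ → Real) : ℕ → Real := fun i =>
  if i < 20 then basic i else e (i - 20)

theorem Ensured.arithClosed : Ensured.{u} (fun M => IsBase M ∧ ∀ c e : ℕ → Real,
    mkParam c (tableOf e) ∈ realsOf M → ArithClosed (realsOf M) ∧ ∀ i, e i ∈ realsOf M) := by
  refine (Ensured.isBase.and (Ensured.table.and (Ensured.comp.and (Ensured.pair.and
    (Ensured.arith_ex.and Ensured.graph))))).mono fun M _ => ?_
  rintro ⟨hB, ht, hc, hp, he, hg⟩
  refine ⟨hB, fun c e hr => ?_⟩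
  have htab := ht hB c (tableOf e) hr
  have hb : ∀ i, basic i ∈ realsOf M := by
    have : ∀ i, i < 20 → basic i ∈ realsOf M := fun i hi => by
      have := htab i
      rwa [tableOf, if_pos hi] at this
    intro i
    by_cases hi : i < 20
    · exact this i hi
    · have e : basic i = basic 15 := by
        unfold basic
        split <;> first | rfl | omega
      rw [e]
      exact this 15 (by omega)
  refine ⟨⟨hb, hc hB, hp hB (hb 0) (hb 1), he hB (hb 0), hg hB (hb 0) (hb 1)⟩, fun i => ?_⟩
  have := htab (i + 20)
  simpa [tableOf] using this

/-! ### Comprehension with a real quantifier -/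

theorem IsBase.pair_mem {M : ZFSet.{u}} (hB : IsBase M) {x y : ZFSet.{u}} (hx : x ∈ M)
    (hy : y ∈ M) : ZFSet.pair x y ∈ M := by
  have h1 := hB.pairing x hx x hx
  rw [ZFSet.pair_eq_singleton] at h1
  exact hB.pairing _ h1 _ (hB.pairing x hx y hy)

theorem snd_mem_of_pair_mem {M : ZFSet.{u}} (hM : M.IsTransitive) {x y f : ZFSet.{u}}
    (h : ZFSet.pair x y ∈ f) (hf : f ∈ M) : y ∈ M := by
  have h1 : ({x, y} : ZFSet) ∈ ZFSet.pair x y := by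
    rw [ZFSet.pair, ZFSet.mem_pair]; exact Or.inr rfl
  have h2 : y ∈ ({x, y} : ZFSet) := by rw [ZFSet.mem_pair]; exact Or.inr rfl
  exact hM.mem_trans h2 (hM.mem_trans h1 (hM.mem_trans h hf))

/-- `a` is the composition of the functions `w` and `e`. -/
def CompIn (M : ZFSet.{u}) (w e a om : El M) : Prop :=
  ∀ n : El M, n.1 ∈ om.1 → ∀ l : El M, l.1 ∈ om.1 → ∀ m : El M, m.1 ∈ om.1 →
    ZFSet.pair n.1 l.1 ∈ e.1 → ZFSet.pair l.1 m.1 ∈ w.1 → ZFSet.pair n.1 m.1 ∈ a.1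

theorem UDef.compIn {n : ℕ} (w e a om : Fin n) :
    UDef.{u} n (fun M v => CompIn M (v w) (v e) (v a) (v om)) := by
  unfold CompIn
  repeat' (first | apply UDef.app | apply UDef.mem | apply UDef.imp | apply UDef.all)

theorem compIn_iff {M : ZFSet.{u}} (hB : IsBase M) {w e a : Real} (hw : w ∈ realsOf M)
    (he : e ∈ realsOf M) (ha : a ∈ realsOf M) :
    CompIn M ⟨realSet w, hw⟩ ⟨realSet e, he⟩ ⟨realSet a, ha⟩ hB.om ↔ ∀ n, w (e n) = a n := by
  unfold CompIn
  simp only [hB.all_om, IsBase.num_val, pair_mem_realSet]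
  exact ⟨fun h n => (h n _ _ rfl rfl).symm, fun h n l m h1 h2 => by rw [← h n, h1, h2]⟩

/-- `h n` codes the restriction of `v` to `n`; the remaining sets are parameters: `ω`, the
unpairing functions `u` and `u'`, the functions `ap` appending a value and `s` taking successors,
and the numeral `0`. -/
def HistoryIn (M : ZFSet.{u}) (v h om u u' ap s zero : El M) : Prop :=
  ZFSet.pair zero.1 zero.1 ∈ h.1 ∧
  ∀ n : El M, n.1 ∈ om.1 → ∀ n' : El M, n'.1 ∈ om.1 → ∀ k : El M, k.1 ∈ om.1 →
  ∀ m : El M, m.1 ∈ om.1 → ∀ l : El M, l.1 ∈ om.1 → ∀ k' : El M, k'.1 ∈ om.1 →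
    ZFSet.pair n.1 n'.1 ∈ s.1 → ZFSet.pair n.1 k.1 ∈ h.1 → ZFSet.pair n.1 m.1 ∈ v.1 →
    ZFSet.pair l.1 k.1 ∈ u.1 → ZFSet.pair l.1 m.1 ∈ u'.1 → ZFSet.pair l.1 k'.1 ∈ ap.1 →
    ZFSet.pair n'.1 k'.1 ∈ h.1

theorem UDef.historyIn {n : ℕ} (v' h om u u' ap s zero : Fin n) : UDef.{u} n (fun M v =>
    HistoryIn M (v v') (v h) (v om) (v u) (v u') (v ap) (v s) (v zero)) := by
  unfold HistoryIn
  repeat' (first | apply UDef.app | apply UDef.mem | apply UDef.and | apply UDef.imp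
                 | apply UDef.all)

theorem historyIn_iff {M : ZFSet.{u}} (hB : IsBase M) (hW : ArithClosed (realsOf M)) {v h : Real}
    (hv : v ∈ realsOf M) (hh : h ∈ realsOf M) :
    HistoryIn M ⟨realSet v, hv⟩ ⟨realSet h, hh⟩ hB.om ⟨realSet (basic 0), hW.basic 0⟩
      ⟨realSet (basic 1), hW.basic 1⟩ ⟨realSet (basic 11), hW.basic 11⟩
      ⟨realSet (basic 2), hW.basic 2⟩ (hB.num 0) ↔ ∀ n, h n = Encodable.encode (initSeg v n) := by
  unfold HistoryIn
  simp only [hB.all_om, IsBase.num_val, pair_mem_realSet]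
  have hap : ∀ n, basic 11 (Nat.pair (Encodable.encode (initSeg v n)) (v n)) =
      Encodable.encode (initSeg v (n + 1)) := by
    intro n
    simp [basic, initSeg_succ]
  constructor
  · rintro ⟨h0, h1⟩ n
    induction n with
    | zero => simpa [initSeg] using h0
    | succ n ih =>
      rw [h1 n (n + 1) _ _ (Nat.pair (h n) (v n)) _ rfl rfl rfl (by simp [basic])
        (by simp [basic]) rfl, ih, hap]
  · intro h1
    refine ⟨by simp [h1, initSeg], ?_⟩
    rintro n _ _ _ l _ rfl rfl rfl h2 h3 rfl
    simp only [basic] at h2 h3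
    have : l = Nat.pair (h n) (v n) := by rw [← h2, ← h3, Nat.pair_unpair]
    rw [this, h1 n, hap]
    exact h1 _

/-- The formula defining the sets of `Ensured.section_comprehension`: `p` is a pair `(k, d)` with
`d ∈ Z` such that the tree coded by `c` has no branch over any real `w` that starts with `k` and
codes `a` and `d`. The remaining sets are `ω`, the unpairing functions `u` and `u'`, the functions
`e₁` and `e₂` that locate `a` and `d` in `w`, and the further parameters of `HistoryIn`. -/
def SectionIn (M : ZFSet.{u}) (p om Z c a u u' e₁ e₂ ap s zero : El M) : Prop :=
  ∃ k : El M, k.1 ∈ om.1 ∧ ∃ d : El M, d.1 ∈ Z.1 ∧ p.1 = ZFSet.pair k.1 d.1 ∧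
  ∀ w : El M, IsFunctionOn M w om → ZFSet.pair zero.1 k.1 ∈ w.1 → CompIn M w e₁ a om →
    CompIn M w e₂ d om → ∀ v : El M, IsFunctionOn M v om → CompIn M u v w om →
    ∃ h : El M, IsFunctionOn M h om ∧ HistoryIn M v h om u u' ap s zero ∧
      ∃ n : El M, n.1 ∈ om.1 ∧ ∃ l : El M, l.1 ∈ om.1 ∧ ZFSet.pair n.1 l.1 ∈ h.1 ∧
        ¬ ZFSet.pair l.1 zero.1 ∈ c.1

theorem UDef.sectionIn : UDef.{u} 12 (fun M v => SectionIn M (v 0) (v 1) (v 2) (v 3) (v 4) (v 5)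
    (v 6) (v 7) (v 8) (v 9) (v 10) (v 11)) := by
  unfold SectionIn
  repeat' (first | apply UDef.historyIn | apply UDef.compIn | apply UDef.isFunctionOn
                 | apply UDef.app | apply UDef.pair | apply UDef.mem | apply UDef.and
                 | apply UDef.not | apply UDef.imp | apply UDef.all | apply UDef.ex)

theorem ex_historyIn_iff {M : ZFSet.{u}} (hB : IsBase M) (hW : ArithClosed (realsOf M))
    {c v : Real} (hc : c ∈ realsOf M) (hv : v ∈ realsOf M) :
    (∃ h : El M, IsFunctionOn M h hB.om ∧ HistoryIn M ⟨realSet v, hv⟩ h hB.om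
        ⟨realSet (basic 0), hW.basic 0⟩ ⟨realSet (basic 1), hW.basic 1⟩
        ⟨realSet (basic 11), hW.basic 11⟩ ⟨realSet (basic 2), hW.basic 2⟩ (hB.num 0) ∧
        ∃ n : El M, n.1 ∈ hB.om.1 ∧ ∃ l : El M, l.1 ∈ hB.om.1 ∧ ZFSet.pair n.1 l.1 ∈ h.1 ∧
        ¬ ZFSet.pair l.1 (hB.num 0).1 ∈ (⟨realSet c, hc⟩ : El M).1) ↔
      ∃ n, c (Encodable.encode (initSeg v n)) ≠ 0 := by
  have step : ∀ h : Real, (∃ n : El M, n.1 ∈ hB.om.1 ∧ ∃ l : El M, l.1 ∈ hB.om.1 ∧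
      ZFSet.pair n.1 l.1 ∈ realSet h ∧ ¬ ZFSet.pair l.1 (hB.num 0).1 ∈ realSet c) ↔
      ∃ n, c (h n) ≠ 0 := by
    intro h
    rw [hB.ex_om]
    refine exists_congr fun n => ?_
    rw [hB.ex_om]
    constructor
    · rintro ⟨l, h1, h2⟩ h3
      rw [IsBase.num_val, IsBase.num_val, pair_mem_realSet] at h1
      exact h2 (pair_mem_realSet.2 (by rw [← h1, h3]))
    · intro hn
      refine ⟨h n, ?_, fun h3 => hn ?_⟩
      · rw [IsBase.num_val, IsBase.num_val, pair_mem_realSet]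
      · rw [IsBase.num_val, IsBase.num_val, pair_mem_realSet] at h3
        exact h3
  rw [hB.ex_real]
  have hh : (fun n => Encodable.encode (initSeg v n) : Real) ∈ realsOf M := by
    simpa [Fn] using Fn.initSeg hW hv
  constructor
  · rintro ⟨h, hh', hhist, hn⟩
    obtain ⟨n, hn⟩ := (step h).1 hn
    exact ⟨n, by rwa [(historyIn_iff hB hW hv hh').1 hhist] at hn⟩
  · intro hn
    exact ⟨_, hh, (historyIn_iff hB hW hv hh).2 fun _ => rfl, (step _).2 hn⟩

/-- Comprehension for pairs `(k, d)` of a number and a real in a given set `Z` that satisfy a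
universal statement about all reals `w` of the model; the matrix is given by a tree code `c` as in
`exists_branch_code`. -/
theorem Ensured.section_comprehension : Ensured.{u} (fun M => IsBase M → ArithClosed (realsOf M) →
    ∀ c ∈ realsOf M, ∀ a ∈ realsOf M, ∀ Z ∈ M, (∀ z ∈ Z, ∃ x ∈ realsOf M, realSet x = z) →
    ∃ E ∈ M, ∀ e, e ∈ E ↔ ∃ k, ∃ d ∈ realsOf M, e = ZFSet.pair (natSet k) (realSet d) ∧
      realSet d ∈ Z ∧ ∀ w ∈ realsOf M, w 0 = k → codeAt w 1 = a → codeAt w 2 = d →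
        ∀ v ∈ realsOf M, (∀ n, (v n).unpair.1 = w n) →
          ∃ n, c (Encodable.encode (initSeg v n)) ≠ 0) := by
  refine (Ensured.separation UDef.sectionIn).mono fun M hM hsep hB hW c hc a ha Z hZ hZW => ?_
  have he : ∀ j, (fun n => Nat.pair j n : Real) ∈ realsOf M := fun j =>
    hW.pair _ (Fn.const hW (γ := ℕ) j) _ (Fn.id (γ := ℕ) hW)
  obtain ⟨Y, hYM, hY⟩ := hB.natRealPairs
  obtain ⟨E, hE⟩ := hsep ![hB.om, ⟨Z, hZ⟩, ⟨realSet c, hc⟩, ⟨realSet a, ha⟩,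
    ⟨realSet (basic 0), hW.basic 0⟩, ⟨realSet (basic 1), hW.basic 1⟩,
    ⟨realSet (fun n => Nat.pair 1 n), he 1⟩, ⟨realSet (fun n => Nat.pair 2 n), he 2⟩,
    ⟨realSet (basic 11), hW.basic 11⟩, ⟨realSet (basic 2), hW.basic 2⟩, hB.num 0] ⟨Y, hYM⟩
  have key : ∀ (p : El M) (k : ℕ) (d : Real) (hd : d ∈ realsOf M), (∀ w : El M,
      IsFunctionOn M w hB.om → ZFSet.pair (hB.num 0).1 (hB.num k).1 ∈ w.1 →
      CompIn M w ⟨realSet (fun n => Nat.pair 1 n), he 1⟩ ⟨realSet a, ha⟩ hB.om →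
      CompIn M w ⟨realSet (fun n => Nat.pair 2 n), he 2⟩ ⟨realSet d, hd⟩ hB.om →
      ∀ v : El M, IsFunctionOn M v hB.om →
      CompIn M ⟨realSet (basic 0), hW.basic 0⟩ v w hB.om →
      ∃ h : El M, IsFunctionOn M h hB.om ∧ HistoryIn M v h hB.om ⟨realSet (basic 0), hW.basic 0⟩
        ⟨realSet (basic 1), hW.basic 1⟩ ⟨realSet (basic 11), hW.basic 11⟩
        ⟨realSet (basic 2), hW.basic 2⟩ (hB.num 0) ∧ ∃ n : El M, n.1 ∈ hB.om.1 ∧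
        ∃ l : El M, l.1 ∈ hB.om.1 ∧ ZFSet.pair n.1 l.1 ∈ h.1 ∧
        ¬ ZFSet.pair l.1 (hB.num 0).1 ∈ realSet c) ↔
      ∀ w ∈ realsOf M, w 0 = k → codeAt w 1 = a → codeAt w 2 = d →
        ∀ v ∈ realsOf M, (∀ n, (v n).unpair.1 = w n) →
          ∃ n, c (Encodable.encode (initSeg v n)) ≠ 0 := by
    intro p k d hd
    rw [hB.all_real]
    refine forall₂_congr fun w hw => ?_
    rw [compIn_iff, compIn_iff, IsBase.num_val, IsBase.num_val, pair_mem_realSet]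
    refine imp_congr Iff.rfl (imp_congr ?_ (imp_congr ?_ ?_))
    · exact ⟨fun h => funext h, fun h n => congrFun h n⟩
    · exact ⟨fun h => funext h, fun h n => congrFun h n⟩
    rw [hB.all_real]
    refine forall₂_congr fun v hv => ?_
    rw [compIn_iff]
    refine imp_congr Iff.rfl ?_
    exact ex_historyIn_iff hB hW hc hv
  refine ⟨E.1, E.2, fun e => ⟨fun h => ?_, ?_⟩⟩
  · have heM := hM.mem_trans h E.2
    obtain ⟨-, k, hk, d, hd, hp, hall⟩ := (hE ⟨e, heM⟩).1 h
    obtain ⟨n, hn⟩ := mem_omegaSet.1 hk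
    obtain rfl : hB.num n = k := Subtype.ext hn
    obtain ⟨x, hx, hxd⟩ := hZW _ hd
    obtain rfl : (⟨realSet x, hx⟩ : El M) = d := Subtype.ext hxd
    exact ⟨n, x, hx, hp, hd, (key ⟨e, heM⟩ n x hx).1 hall⟩
  · rintro ⟨k, d, hd, rfl, hdZ, hall⟩
    have hY' := hY k d hd
    refine (hE ⟨_, hM.mem_trans hY' hYM⟩).2 ⟨hY', hB.num k, natSet_mem_omegaSet k,
      ⟨realSet d, hd⟩, hdZ, rfl, ?_⟩
    exact (key ⟨_, hM.mem_trans hY' hYM⟩ k d hd).2 hall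

/-- The domain of a relation between numbers and sets is a real of the model. -/
theorem Ensured.dom_mem : Ensured.{u} (fun M => IsBase M → ∀ E ∈ M,
    chi (fun k => ∃ d, ZFSet.pair (natSet k) d ∈ E) ∈ realsOf M) := by
  have h : UDef.{u} (3 + 2) (fun M w =>
      ((w 1).1 = (w 3).1 ∧ ∃ d : El M, ZFSet.pair (w 0).1 d.1 ∈ (w 2).1) ∨
      ((w 1).1 = (w 4).1 ∧ ¬ ∃ d : El M, ZFSet.pair (w 0).1 d.1 ∈ (w 2).1)) := by
    repeat' (first | apply UDef.app | apply UDef.eq | apply UDef.and | apply UDef.or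
                   | apply UDef.not | apply UDef.ex)
  refine (Ensured.real_comprehension h).mono fun M hMt hM hB E hE => ?_
  refine hM hB ![⟨E, hE⟩, hB.num 1, hB.num 0] _ fun a b => ?_
  change ((hB.num b).1 = (hB.num 1).1 ∧ ∃ d : El M, ZFSet.pair (hB.num a).1 d.1 ∈ E) ∨
      ((hB.num b).1 = (hB.num 0).1 ∧ ¬ ∃ d : El M, ZFSet.pair (hB.num a).1 d.1 ∈ E) ↔ _
  rw [chi_eq_iff]
  simp only [IsBase.num_val, natSet_inj]
  have : (∃ d : El M, ZFSet.pair (natSet a) d.1 ∈ E) ↔ ∃ d, ZFSet.pair (natSet a) d ∈ E :=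
    ⟨fun ⟨d, hd⟩ => ⟨d.1, hd⟩, fun ⟨d, hd⟩ => ⟨⟨d, snd_mem_of_pair_mem hMt hd hE⟩, hd⟩⟩
  rw [this]

theorem Ensured.fiber_mem : Ensured.{u} (fun M => IsBase M → ∀ E ∈ M, ∀ Z ∈ M, ∀ k,
    ∃ F ∈ M, ∀ z, z ∈ F ↔ z ∈ Z ∧ ZFSet.pair (natSet k) z ∈ E) := by
  refine (Ensured.separation (m := 2) (UDef.app 1 2 0)).mono fun M hM hsep hB E hE Z hZ k => ?_
  obtain ⟨F, hF⟩ := hsep ![⟨E, hE⟩, hB.num k] ⟨Z, hZ⟩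
  refine ⟨F.1, F.2, fun z => ⟨fun h => (hF ⟨z, hM.mem_trans h F.2⟩).1 h, fun h => ?_⟩⟩
  exact (hF ⟨z, hM.mem_trans h.1 hZ⟩).2 h

/-! ### Countable choice in a model -/

/-- `y` is the set of the pairs in `E` with first component `k`. -/
def IsFiberIn (M : ZFSet.{u}) (k y E : El M) : Prop :=
  ∀ p : El M, p.1 ∈ y.1 ↔ (p.1 ∈ E.1 ∧ ∃ d : El M, p.1 = ZFSet.pair k.1 d.1)

/-- The formula for the join of the sequence of reals that is selected from `E` by `C`, with the
zero real where the fiber of `E` is empty. -/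
def SelectIn (M : ZFSet.{u}) (n m om u u' E C zero : El M) : Prop :=
  ∃ k : El M, k.1 ∈ om.1 ∧ ∃ i : El M, i.1 ∈ om.1 ∧ ZFSet.pair n.1 k.1 ∈ u.1 ∧
    ZFSet.pair n.1 i.1 ∈ u'.1 ∧
    ((∃ d : El M, ZFSet.pair k.1 d.1 ∈ E.1 ∧ ZFSet.pair k.1 d.1 ∈ C.1 ∧
        ZFSet.pair i.1 m.1 ∈ d.1) ∨
      (m.1 = zero.1 ∧ ¬ ∃ d : El M, ZFSet.pair k.1 d.1 ∈ E.1 ∧ ZFSet.pair k.1 d.1 ∈ C.1))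

/-- A relation `E` between numbers and reals in the model is uniformized by a sequence of reals in
the model: the axiom of choice is applied to the fibers of `E`. -/
theorem Ensured.countable_choice : Ensured.{u} (fun M => IsBase M → basic 0 ∈ realsOf M →
    basic 1 ∈ realsOf M → ∀ E ∈ M,
    (∀ e ∈ E, ∃ k, ∃ x ∈ realsOf M, e = ZFSet.pair (natSet k) (realSet x)) →
    ∃ b : ℕ → Real, joinSeq b ∈ realsOf M ∧ ∀ k, (∃ d, ZFSet.pair (natSet k) d ∈ E) →
      ZFSet.pair (natSet k) (realSet (b k)) ∈ E) := by
  have hfib : UDef.{u} (1 + 2) (fun M w => IsFiberIn M (w 0) (w 1) (w 2)) := by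
    unfold IsFiberIn
    repeat' (first | apply UDef.pair | apply UDef.mem | apply UDef.iff | apply UDef.and
                   | apply UDef.all | apply UDef.ex)
  have hsel : UDef.{u} (6 + 2) (fun M w =>
      SelectIn M (w 0) (w 1) (w 2) (w 3) (w 4) (w 5) (w 6) (w 7)) := by
    unfold SelectIn
    repeat' (first | apply UDef.app | apply UDef.mem | apply UDef.eq | apply UDef.and
                   | apply UDef.or | apply UDef.not | apply UDef.ex)
  have hdom : UDef.{u} (1 + 1) (fun M w => ∃ d : El M, ZFSet.pair (w 0).1 d.1 ∈ (w 1).1) := by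
    repeat' (first | apply UDef.app | apply UDef.ex)
  have hpair : UDef.{u} (1 + 1) (fun M w => ∃ d : El M, (w 0).1 = ZFSet.pair (w 1).1 d.1) :=
    UDef.ex (UDef.pair 2 0 1)
  refine (((Ensured.replacement hfib).and (Ensured.real_comprehension hsel)).and
    (((Ensured.separation hdom).and (Ensured.separation hpair)).and Ensured.choice)).mono
    fun M hM => ?_
  rintro ⟨⟨hrep, hcomp⟩, ⟨hdom, hpair⟩, hchoice⟩ hB h0 h1 E hE hEr
  obtain ⟨a, ha⟩ := hdom ![⟨E, hE⟩] hB.om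
  have hfibex : ∀ k : El M, ∃ y : El M, ∀ z : El M, IsFiberIn M k z ⟨E, hE⟩ ↔ z = y := by
    intro k
    obtain ⟨y, hy⟩ := hpair ![k] ⟨E, hE⟩
    refine ⟨y, fun z => ⟨fun hz => ?_, fun hz => ?_⟩⟩
    · apply Subtype.ext
      ext p
      constructor
      · intro hp
        exact (hy ⟨p, hM.mem_trans hp z.2⟩).2 ((hz ⟨p, hM.mem_trans hp z.2⟩).1 hp)
      · intro hp
        exact (hz ⟨p, hM.mem_trans hp y.2⟩).2 ((hy ⟨p, hM.mem_trans hp y.2⟩).1 hp)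
    · subst hz
      exact hy
  obtain ⟨A, hA⟩ := hrep ![⟨E, hE⟩] a (fun k _ => hfibex k)
  have hA : ∀ y : El M, y.1 ∈ A.1 ↔ ∃ k : El M, k.1 ∈ a.1 ∧ IsFiberIn M k y ⟨E, hE⟩ := hA
  have ha : ∀ k : El M, k.1 ∈ a.1 ↔ k.1 ∈ hB.om.1 ∧ ∃ d : El M, ZFSet.pair k.1 d.1 ∈ E := ha
  have hpM : ∀ {p : ZFSet.{u}}, p ∈ E → p ∈ M := fun h => hM.mem_trans h hE
  have hdM : ∀ {k d : ZFSet.{u}}, ZFSet.pair k d ∈ E → d ∈ M := fun h =>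
    snd_mem_of_pair_mem hM h hE
  obtain ⟨C, hCM, hC⟩ := hchoice A.1 A.2 (by
    intro y hy
    obtain ⟨k, hk, hfib⟩ := (hA ⟨y, hM.mem_trans hy A.2⟩).1 hy
    obtain ⟨-, d, hd⟩ := (ha k).1 hk
    exact ⟨ZFSet.pair k.1 d.1, (hfib ⟨_, hpM hd⟩).2 ⟨hd, d, rfl⟩⟩) (by
    intro y hy y' hy' p hp hp'
    obtain ⟨k, hk, hfib⟩ := (hA ⟨y, hM.mem_trans hy A.2⟩).1 hy
    obtain ⟨k', hk', hfib'⟩ := (hA ⟨y', hM.mem_trans hy' A.2⟩).1 hy'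
    have hpM' : p ∈ M := hM.mem_trans hp (hM.mem_trans hy A.2)
    obtain ⟨-, d, hd⟩ := (hfib ⟨p, hpM'⟩).1 hp
    obtain ⟨-, d', hd'⟩ := (hfib' ⟨p, hpM'⟩).1 hp'
    have hkk : k = k' := Subtype.ext (ZFSet.pair_inj.1 (hd.symm.trans hd')).1
    subst hkk
    obtain ⟨y₀, hy₀⟩ := hfibex k
    exact congrArg Subtype.val (((hy₀ _).1 hfib).trans ((hy₀ _).1 hfib').symm))
  -- For each `k` with a nonempty fiber, `C` selects exactly one pair `(k, x)` in `E`.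
  have huniq : ∀ k : ℕ, (∃ d, ZFSet.pair (natSet k) d ∈ E) → ∃ x ∈ realsOf M, ∀ d : ZFSet.{u},
      (ZFSet.pair (natSet k) d ∈ E ∧ ZFSet.pair (natSet k) d ∈ C) ↔ d = realSet x := by
    rintro k ⟨d₀, hd₀⟩
    obtain ⟨y, hy⟩ := hfibex (hB.num k)
    have hfib : IsFiberIn M (hB.num k) y ⟨E, hE⟩ := (hy y).2 rfl
    have hyA : y.1 ∈ A.1 := (hA y).2 ⟨hB.num k, (ha _).2 ⟨natSet_mem_omegaSet k,
      ⟨d₀, hdM hd₀⟩, hd₀⟩, hfib⟩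
    obtain ⟨p, hp⟩ := hC y.1 hyA
    have hpy := (hp p).2 rfl
    have hpM' : p ∈ M := hM.mem_trans hpy.1 y.2
    obtain ⟨hpE, d, hd⟩ := (hfib ⟨p, hpM'⟩).1 hpy.1
    have hd : p = ZFSet.pair (natSet k) d.1 := hd
    have hpE : p ∈ E := hpE
    obtain ⟨k', x, hx, hpx⟩ := hEr p hpE
    have hdx : d.1 = realSet x := (ZFSet.pair_inj.1 (hd.symm.trans hpx)).2
    refine ⟨x, hx, fun d' => ⟨fun h => ?_, ?_⟩⟩
    · have h2 : ZFSet.pair (natSet k) d' ∈ y.1 :=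
        (hfib ⟨_, hpM h.1⟩).2 ⟨h.1, ⟨d', hdM h.1⟩, rfl⟩
      have h3 := (hp _).1 ⟨h2, h.2⟩
      rw [hd] at h3
      rw [(ZFSet.pair_inj.1 h3).2, hdx]
    · rintro rfl
      rw [← hdx, ← hd]
      exact ⟨hpE, hpy.2⟩
  classical
  let b : ℕ → Real := fun k => if h : ∃ d, ZFSet.pair (natSet k) d ∈ E then (huniq k h).choose
    else fun _ => 0
  have hb : ∀ k, (h : ∃ d, ZFSet.pair (natSet k) d ∈ E) → b k ∈ realsOf M ∧ ∀ d : ZFSet.{u},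
      (ZFSet.pair (natSet k) d ∈ E ∧ ZFSet.pair (natSet k) d ∈ C) ↔ d = realSet (b k) := by
    intro k h
    have := (huniq k h).choose_spec
    simpa only [b, dif_pos h] using this
  refine ⟨b, ?_, fun k h => (((hb k h).2 _).2 rfl).1⟩
  refine hcomp hB ![hB.om, ⟨realSet (basic 0), h0⟩, ⟨realSet (basic 1), h1⟩, ⟨E, hE⟩, ⟨C, hCM⟩,
    hB.num 0] _ fun n m => ?_
  change SelectIn M (hB.num n) (hB.num m) hB.om ⟨realSet (basic 0), h0⟩ ⟨realSet (basic 1), h1⟩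
    ⟨E, hE⟩ ⟨C, hCM⟩ (hB.num 0) ↔ _
  unfold SelectIn
  simp only [hB.ex_om, IsBase.num_val, pair_mem_realSet, natSet_inj, exists_eq_left', basic,
    exists_and_left, joinSeq]
  by_cases h : ∃ d, ZFSet.pair (natSet n.unpair.1) d ∈ E
  · obtain ⟨h1, h2⟩ := hb _ h
    constructor
    · rintro (⟨d, hd1, hd2, hd3⟩ | ⟨-, hno⟩)
      · rw [(h2 d.1).1 ⟨hd1, hd2⟩, pair_mem_realSet] at hd3
        exact hd3
      · exact absurd ⟨⟨_, h1⟩, (h2 _).2 rfl⟩ hno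
    · rintro rfl
      exact Or.inl ⟨⟨_, h1⟩, ((h2 _).2 rfl).1, ((h2 _).2 rfl).2, pair_mem_realSet.2 rfl⟩
  · have hz : b n.unpair.1 = fun _ => 0 := dif_neg h
    rw [hz]
    constructor
    · rintro (⟨d, hd1, -⟩ | ⟨rfl, -⟩)
      · exact absurd ⟨_, hd1⟩ h
      · rfl
    · rintro rfl
      exact Or.inr ⟨rfl, fun ⟨d, hd, _⟩ => h ⟨_, hd⟩⟩

/-! ### The well-founded part of a relation in a model -/

/-- `f` is the Mostowski collapse of the transitive relation `rel`, restricted to the predecessors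
of `k`. -/
structure IsCollapse (rel : ℕ → ℕ → Prop) (k : ℕ) (f : ZFSet.{u}) : Prop where
  dom : ∀ p ∈ f, ∃ u, rel u k ∧ ∃ z, p = ZFSet.pair (natSet u) z
  tot : ∀ u, rel u k → ∃ z, ZFSet.pair (natSet u) z ∈ f
  val : ∀ u z, ZFSet.pair (natSet u) z ∈ f → ∀ y, y ∈ z ↔
    ∃ w, rel w u ∧ ZFSet.pair (natSet w) y ∈ f

namespace IsCollapse

variable {rel : ℕ → ℕ → Prop} (htr : ∀ a b c, rel a b → rel b c → rel a c) {k k' : ℕ}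
  {f f' : ZFSet.{u}}

theorem rel_of_pair_mem (h : IsCollapse rel k f) {u : ℕ} {z : ZFSet.{u}}
    (hz : ZFSet.pair (natSet u) z ∈ f) : rel u k := by
  obtain ⟨v, hv, z', h'⟩ := h.dom _ hz
  rw [ZFSet.pair_inj, natSet_inj] at h'
  rwa [h'.1]

include htr

/-- Collapses of two initial parts of the relation agree: a value that occurs in both is determined
by its argument, by induction on the value. -/
theorem eq_of_pair_mem (h : IsCollapse rel k f) (h' : IsCollapse rel k' f') (z : ZFSet.{u}) :
    ∀ u z', ZFSet.pair (natSet u) z ∈ f → ZFSet.pair (natSet u) z' ∈ f' → z = z' := by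
  induction z using ZFSet.inductionOn with
  | _ z ih =>
  intro u z' hz hz'
  ext y
  rw [h.val u z hz, h'.val u z' hz']
  constructor
  · rintro ⟨w, hw, hy⟩
    obtain ⟨y', hy'⟩ := h'.tot w (htr _ _ _ hw (h'.rel_of_pair_mem hz'))
    have : y = y' := ih y ((h.val u z hz y).2 ⟨w, hw, hy⟩) w y' hy hy'
    exact ⟨w, hw, this ▸ hy'⟩
  · rintro ⟨w, hw, hy⟩
    obtain ⟨y', hy'⟩ := h.tot w (htr _ _ _ hw (h.rel_of_pair_mem hz))
    have : y' = y := ih y' ((h.val u z hz y').2 ⟨w, hw, hy'⟩) w y hy' hy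
    exact ⟨w, hw, this ▸ hy'⟩

/-- A collapse transfers the well-foundedness of `∈` to the relation. -/
theorem acc (h : IsCollapse rel k f) : Acc rel k := by
  have key : ∀ z : ZFSet.{u}, ∀ u, ZFSet.pair (natSet u) z ∈ f → Acc rel u := by
    intro z
    induction z using ZFSet.inductionOn with
    | _ z ih =>
    intro u hz
    refine Acc.intro u fun w hw => ?_
    obtain ⟨y, hy⟩ := h.tot w (htr _ _ _ hw (h.rel_of_pair_mem hz))
    exact ih y ((h.val u z hz y).2 ⟨w, hw, hy⟩) w hy
  refine Acc.intro k fun u hu => ?_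
  obtain ⟨z, hz⟩ := h.tot u hu
  exact key z u hz

end IsCollapse

/-- The relation coded by the function `R`, in `M`; `u'` and `u''` are the unpairing functions. -/
def RelIn (M : ZFSet.{u}) (v k om u' u'' R one : El M) : Prop :=
  ∃ l : El M, l.1 ∈ om.1 ∧ ZFSet.pair l.1 v.1 ∈ u'.1 ∧ ZFSet.pair l.1 k.1 ∈ u''.1 ∧
    ZFSet.pair l.1 one.1 ∈ R.1

theorem UDef.relIn {n : ℕ} (v' k om u' u'' R one : Fin n) : UDef.{u} n (fun M v =>
    RelIn M (v v') (v k) (v om) (v u') (v u'') (v R) (v one)) := by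
  unfold RelIn
  repeat' (first | apply UDef.app | apply UDef.mem | apply UDef.and | apply UDef.ex)

/-- The formula for `IsCollapse`, for the relation coded by `R`. -/
def CollapseIn (M : ZFSet.{u}) (k f om u' u'' R one : El M) : Prop :=
  (∀ p : El M, p.1 ∈ f.1 → ∃ v : El M, v.1 ∈ om.1 ∧ RelIn M v k om u' u'' R one ∧
    ∃ z : El M, p.1 = ZFSet.pair v.1 z.1) ∧
  (∀ v : El M, v.1 ∈ om.1 → RelIn M v k om u' u'' R one →
    ∃ z : El M, ZFSet.pair v.1 z.1 ∈ f.1) ∧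
  ∀ v : El M, v.1 ∈ om.1 → ∀ z : El M, ZFSet.pair v.1 z.1 ∈ f.1 → ∀ y : El M,
    (y.1 ∈ z.1 ↔ ∃ w : El M, w.1 ∈ om.1 ∧ RelIn M w v om u' u'' R one ∧
      ZFSet.pair w.1 y.1 ∈ f.1)

theorem UDef.collapseIn {n : ℕ} (k f om u' u'' R one : Fin n) : UDef.{u} n (fun M v =>
    CollapseIn M (v k) (v f) (v om) (v u') (v u'') (v R) (v one)) := by
  unfold CollapseIn
  repeat' (first | apply UDef.relIn | apply UDef.app | apply UDef.pair | apply UDef.mem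
                 | apply UDef.iff | apply UDef.and | apply UDef.imp | apply UDef.all
                 | apply UDef.ex)

/-- `z` is the range of a collapse of the predecessors of `v`, that is, the collapse of `v`. -/
def CollapseValueIn (M : ZFSet.{u}) (v z om u' u'' R one : El M) : Prop :=
  ∃ f : El M, CollapseIn M v f om u' u'' R one ∧
    ∀ y : El M, y.1 ∈ z.1 ↔ ∃ w : El M, w.1 ∈ om.1 ∧ ZFSet.pair w.1 y.1 ∈ f.1

theorem UDef.collapseValueIn {n : ℕ} (v' z om u' u'' R one : Fin n) : UDef.{u} n (fun M v =>
    CollapseValueIn M (v v') (v z) (v om) (v u') (v u'') (v R) (v one)) := by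
  unfold CollapseValueIn
  repeat' (first | apply UDef.collapseIn | apply UDef.app | apply UDef.mem
                 | apply UDef.iff | apply UDef.and | apply UDef.all | apply UDef.ex)

section

variable {M : ZFSet.{u}} (hB : IsBase M) {R : Real} (h0 : basic 0 ∈ realsOf M)
  (h1 : basic 1 ∈ realsOf M) (hR : R ∈ realsOf M)
include hB

theorem relIn_iff (v k : ℕ) : RelIn M (hB.num v) (hB.num k) hB.om ⟨realSet (basic 0), h0⟩
    ⟨realSet (basic 1), h1⟩ ⟨realSet R, hR⟩ (hB.num 1) ↔ R (Nat.pair v k) = 1 := by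
  unfold RelIn
  simp only [hB.ex_om, IsBase.num_val, pair_mem_realSet, basic]
  constructor
  · rintro ⟨n, rfl, rfl, h⟩
    rwa [Nat.pair_unpair]
  · intro h
    exact ⟨_, by simp, by simp, h⟩

theorem collapseIn_iff (k : ℕ) (f : El M) : CollapseIn M (hB.num k) f hB.om
    ⟨realSet (basic 0), h0⟩ ⟨realSet (basic 1), h1⟩ ⟨realSet R, hR⟩ (hB.num 1) ↔
    IsCollapse (fun v k => R (Nat.pair v k) = 1) k f.1 := by
  have hM := hB.transitive
  unfold CollapseIn
  simp only [hB.ex_om, hB.all_om, relIn_iff hB h0 h1 hR, IsBase.num_val]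
  constructor
  · rintro ⟨h1, h2, h3⟩
    refine ⟨fun p hp => ?_, fun v hv => ?_, fun v z hz y => ?_⟩
    · obtain ⟨v, hv, z, hz⟩ := h1 ⟨p, hM.mem_trans hp f.2⟩ hp
      exact ⟨v, hv, z.1, hz⟩
    · obtain ⟨z, hz⟩ := h2 v hv
      exact ⟨z.1, hz⟩
    · have hzM := snd_mem_of_pair_mem hM hz f.2
      constructor
      · intro hy
        exact (h3 v ⟨z, hzM⟩ hz ⟨y, hM.mem_trans hy hzM⟩).1 hy
      · rintro ⟨w, hw, hy⟩
        exact (h3 v ⟨z, hzM⟩ hz ⟨y, snd_mem_of_pair_mem hM hy f.2⟩).2 ⟨w, hw, hy⟩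
  · rintro ⟨h1, h2, h3⟩
    refine ⟨fun p hp => ?_, fun v hv => ?_, fun v z hz y => h3 v z.1 hz y.1⟩
    · obtain ⟨v, hv, z, hz⟩ := h1 p.1 hp
      exact ⟨v, hv, ⟨z, snd_mem_of_pair_mem hM (hz ▸ hp) f.2⟩, hz⟩
    · obtain ⟨z, hz⟩ := h2 v hv
      exact ⟨⟨z, snd_mem_of_pair_mem hM hz f.2⟩, hz⟩

end

/-- The well-founded part of a transitive relation in the model belongs to the model: a number
belongs to it if and only if there is a collapse of its predecessors in the model. -/
theorem Ensured.acc_mem : Ensured.{u} (fun M => IsBase M → basic 0 ∈ realsOf M →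
    basic 1 ∈ realsOf M → ∀ R ∈ realsOf M,
    (∀ a b c, R (Nat.pair a b) = 1 → R (Nat.pair b c) = 1 → R (Nat.pair a c) = 1) →
    chi (fun k => Acc (fun v k => R (Nat.pair v k) = 1) k) ∈ realsOf M) := by
  have hrel : UDef.{u} (6 + 1) (fun M w => RelIn M (w 0) (w 1) (w 2) (w 3) (w 4) (w 5) (w 6)) :=
    UDef.relIn _ _ _ _ _ _ _
  have hran : UDef.{u} (2 + 1) (fun M w => ∃ v : El M, v.1 ∈ (w 1).1 ∧
      ZFSet.pair v.1 (w 0).1 ∈ (w 2).1) := by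
    repeat' (first | apply UDef.app | apply UDef.mem | apply UDef.and | apply UDef.ex)
  have hval : UDef.{u} (5 + 2) (fun M w => ∃ z : El M, (w 1).1 = ZFSet.pair (w 0).1 z.1 ∧
      CollapseValueIn M (w 0) z (w 2) (w 3) (w 4) (w 5) (w 6)) := by
    repeat' (first | apply UDef.collapseValueIn | apply UDef.pair | apply UDef.and
                   | apply UDef.ex)
  have hchi : UDef.{u} (6 + 2) (fun M w =>
      ((w 1).1 = (w 6).1 ∧ ∃ f : El M, CollapseIn M (w 0) f (w 2) (w 3) (w 4) (w 5) (w 6)) ∨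
      ((w 1).1 = (w 7).1 ∧ ¬ ∃ f : El M, CollapseIn M (w 0) f (w 2) (w 3) (w 4) (w 5) (w 6))) := by
    repeat' (first | apply UDef.collapseIn | apply UDef.eq | apply UDef.and | apply UDef.or
                   | apply UDef.not | apply UDef.ex)
  refine (((Ensured.separation hrel).and (Ensured.separation hran)).and
    ((Ensured.replacement hval).and (Ensured.real_comprehension hchi))).mono fun M hM => ?_
  rintro ⟨⟨hrel, hran⟩, hval, hchi⟩ hB h0 h1 R hR htr
  -- By induction along the relation, replacement collects the collapses of the predecessors.
  have hacc : ∀ k, Acc (fun v k => R (Nat.pair v k) = 1) k → ∃ f ∈ M,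
      IsCollapse (fun v k => R (Nat.pair v k) = 1) k f := by
    intro k hk
    induction hk with
    | intro k _ ih =>
    obtain ⟨a, ha⟩ := hrel ![hB.num k, hB.om, ⟨realSet (basic 0), h0⟩, ⟨realSet (basic 1), h1⟩,
      ⟨realSet R, hR⟩, hB.num 1] hB.om
    have ha : ∀ v : El M, v.1 ∈ a.1 ↔ v.1 ∈ hB.om.1 ∧ RelIn M v (hB.num k) hB.om
      ⟨realSet (basic 0), h0⟩ ⟨realSet (basic 1), h1⟩ ⟨realSet R, hR⟩ (hB.num 1) := ha
    have ha' : ∀ v : ℕ, natSet v ∈ a.1 ↔ R (Nat.pair v k) = 1 := by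
      intro v
      rw [← relIn_iff hB h0 h1 hR]
      exact (ha (hB.num v)).trans (and_iff_right (natSet_mem_omegaSet v))
    have hvalue : ∀ v : ℕ, R (Nat.pair v k) = 1 → ∃ z : El M, ∀ z' : El M,
        CollapseValueIn M (hB.num v) z' hB.om ⟨realSet (basic 0), h0⟩ ⟨realSet (basic 1), h1⟩
          ⟨realSet R, hR⟩ (hB.num 1) ↔ z' = z := by
      intro v hv
      obtain ⟨f, hfM, hf⟩ := ih v hv
      obtain ⟨z, hz⟩ := hran ![hB.om, ⟨f, hfM⟩] ⟨_, hB.union _ (hB.union f hfM)⟩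
      have hz : ∀ y : El M, y.1 ∈ z.1 ↔ y.1 ∈ ZFSet.sUnion (ZFSet.sUnion f) ∧
        ∃ w : El M, w.1 ∈ hB.om.1 ∧ ZFSet.pair w.1 y.1 ∈ f := hz
      have hz' : ∀ y : El M, y.1 ∈ z.1 ↔
          ∃ w : El M, w.1 ∈ hB.om.1 ∧ ZFSet.pair w.1 y.1 ∈ f := by
        intro y
        rw [hz, and_iff_right_iff_imp]
        rintro ⟨w, -, hw⟩
        refine ZFSet.mem_sUnion.2 ⟨{w.1, y.1}, ZFSet.mem_sUnion.2 ⟨_, hw, ?_⟩, ?_⟩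
        · rw [ZFSet.pair, ZFSet.mem_pair]; exact Or.inr rfl
        · rw [ZFSet.mem_pair]; exact Or.inr rfl
      refine ⟨z, fun z' => ⟨?_, ?_⟩⟩
      · rintro ⟨f', hf', hz''⟩
        rw [collapseIn_iff] at hf'
        apply Subtype.ext
        ext y
        have hff : ∀ {g g' : ZFSet.{u}}, IsCollapse (fun v k => R (Nat.pair v k) = 1) v g →
            IsCollapse (fun v k => R (Nat.pair v k) = 1) v g' → ∀ w : El M, w.1 ∈ hB.om.1 →
            ZFSet.pair w.1 y ∈ g → ZFSet.pair w.1 y ∈ g' := by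
          intro g g' hg hg' w hw hy
          obtain ⟨n, hn⟩ := mem_omegaSet.1 hw
          rw [← hn] at hy ⊢
          obtain ⟨y', hy'⟩ := hg'.tot n (hg.rel_of_pair_mem hy)
          rwa [IsCollapse.eq_of_pair_mem htr hg hg' y n y' hy hy']
        constructor
        · intro hy
          obtain ⟨w, hw, hwy⟩ := (hz'' ⟨y, hM.mem_trans hy z'.2⟩).1 hy
          exact (hz' ⟨y, hM.mem_trans hy z'.2⟩).2 ⟨w, hw, hff hf' hf w hw hwy⟩
        · intro hy
          obtain ⟨w, hw, hwy⟩ := (hz' ⟨y, hM.mem_trans hy z.2⟩).1 hy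
          exact (hz'' ⟨y, hM.mem_trans hy z.2⟩).2 ⟨w, hw, hff hf hf' w hw hwy⟩
      · rintro rfl
        exact ⟨⟨f, hfM⟩, (collapseIn_iff hB h0 h1 hR v _).2 hf, hz'⟩
    obtain ⟨F, hF⟩ := hval ![hB.om, ⟨realSet (basic 0), h0⟩, ⟨realSet (basic 1), h1⟩,
      ⟨realSet R, hR⟩, hB.num 1] a (by
      intro x hx
      obtain ⟨v, hv⟩ := mem_omegaSet.1 ((ha x).1 hx).1
      obtain rfl : hB.num v = x := Subtype.ext hv
      obtain ⟨z, hz⟩ := hvalue v ((ha' v).1 hx)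
      refine ⟨⟨_, hB.pair_mem (hB.num v).2 z.2⟩, fun p => ⟨?_, ?_⟩⟩
      · rintro ⟨z', hp, hz'⟩
        apply Subtype.ext
        rw [← (hz z').1 hz']
        exact hp
      · rintro rfl
        exact ⟨z, rfl, (hz z).2 rfl⟩)
    have hF' : ∀ (v : ℕ) (z : El M), ZFSet.pair (natSet v) z.1 ∈ F.1 ↔ R (Nat.pair v k) = 1 ∧
        CollapseValueIn M (hB.num v) z hB.om ⟨realSet (basic 0), h0⟩ ⟨realSet (basic 1), h1⟩
          ⟨realSet R, hR⟩ (hB.num 1) := by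
      intro v z
      refine (hF ⟨_, hB.pair_mem (hB.num v).2 z.2⟩).trans ⟨?_, ?_⟩
      · rintro ⟨x, hx, z', hp, hz'⟩
        obtain ⟨h3, h4⟩ := ZFSet.pair_inj.1 hp
        obtain rfl : hB.num v = x := Subtype.ext h3
        obtain rfl : z = z' := Subtype.ext h4
        exact ⟨(ha' v).1 hx, hz'⟩
      · rintro ⟨h3, h4⟩
        exact ⟨hB.num v, (ha' v).2 h3, z, rfl, h4⟩
    refine ⟨F.1, F.2, fun p hp => ?_, fun v hv => ?_, fun v z hz y => ?_⟩
    · obtain ⟨x, hx, z, hp', -⟩ := (hF ⟨p, hM.mem_trans hp F.2⟩).1 hp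
      obtain ⟨v, hv⟩ := mem_omegaSet.1 ((ha x).1 hx).1
      obtain rfl : hB.num v = x := Subtype.ext hv
      exact ⟨v, (ha' v).1 hx, z.1, hp'⟩
    · obtain ⟨z, hz⟩ := hvalue v hv
      exact ⟨z.1, (hF' v z).2 ⟨hv, (hz z).2 rfl⟩⟩
    · have hzM := snd_mem_of_pair_mem hM hz F.2
      obtain ⟨hvk, f, hf, hzf⟩ := (hF' v ⟨z, hzM⟩).1 hz
      rw [collapseIn_iff] at hf
      -- A value of the collapse below `v` is the value assigned to it by its own collapse.
      have hsame : ∀ w : ℕ, R (Nat.pair w v) = 1 → ∀ y : El M,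
          ZFSet.pair (natSet w) y.1 ∈ f.1 → CollapseValueIn M (hB.num w) y hB.om
          ⟨realSet (basic 0), h0⟩ ⟨realSet (basic 1), h1⟩ ⟨realSet R, hR⟩ (hB.num 1) := by
        intro w hw y hy
        obtain ⟨g, hgM, hg⟩ := ih w (htr _ _ _ hw hvk)
        refine ⟨⟨g, hgM⟩, (collapseIn_iff hB h0 h1 hR w _).2 hg, fun t => ?_⟩
        rw [hf.val w y.1 hy, hB.ex_om]
        refine exists_congr fun n => ⟨?_, ?_⟩
        · rintro ⟨hn, ht⟩
          obtain ⟨t', ht'⟩ := hg.tot n hn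
          rw [IsBase.num_val, IsCollapse.eq_of_pair_mem htr hf hg t.1 n t' ht ht']
          exact ht'
        · intro ht
          have hn := hg.rel_of_pair_mem ht
          obtain ⟨t', ht'⟩ := hf.tot n (htr _ _ _ hn hw)
          refine ⟨hn, ?_⟩
          rw [IsCollapse.eq_of_pair_mem htr hg hf t.1 n t' ht ht']
          exact ht'
      constructor
      · intro hy
        have hyM := hM.mem_trans hy hzM
        obtain ⟨w, hw, hwy⟩ := (hzf ⟨y, hyM⟩).1 hy
        obtain ⟨n, hn⟩ := mem_omegaSet.1 hw
        obtain rfl : hB.num n = w := Subtype.ext hn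
        have hnv := hf.rel_of_pair_mem hwy
        exact ⟨n, hnv, (hF' n ⟨y, hyM⟩).2 ⟨htr _ _ _ hnv hvk, hsame n hnv ⟨y, hyM⟩ hwy⟩⟩
      · rintro ⟨w, hw, hwy⟩
        have hyM := snd_mem_of_pair_mem hM hwy F.2
        obtain ⟨hwk, hyval⟩ := (hF' w ⟨y, hyM⟩).1 hwy
        obtain ⟨y', hy'⟩ := hf.tot w hw
        have hy'M := snd_mem_of_pair_mem hM hy' f.2
        obtain ⟨z₀, hz₀⟩ := hvalue w hwk
        have e : (⟨y, hyM⟩ : El M) = ⟨y', hy'M⟩ :=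
          ((hz₀ _).1 hyval).trans ((hz₀ _).1 (hsame w hw ⟨y', hy'M⟩ hy')).symm
        have e : y = y' := congrArg Subtype.val e
        exact (hzf ⟨y, hyM⟩).2 ⟨hB.num w, natSet_mem_omegaSet w, by
          change ZFSet.pair (natSet w) y ∈ f.1
          rw [e]
          exact hy'⟩
  refine hchi hB ![hB.om, ⟨realSet (basic 0), h0⟩, ⟨realSet (basic 1), h1⟩, ⟨realSet R, hR⟩,
    hB.num 1, hB.num 0] _ fun k b => ?_
  have key : (∃ f : El M, CollapseIn M (hB.num k) f hB.om ⟨realSet (basic 0), h0⟩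
      ⟨realSet (basic 1), h1⟩ ⟨realSet R, hR⟩ (hB.num 1)) ↔
      Acc (fun v k => R (Nat.pair v k) = 1) k := by
    constructor
    · rintro ⟨f, hf⟩
      exact ((collapseIn_iff hB h0 h1 hR k f).1 hf).acc htr
    · intro h
      obtain ⟨f, hfM, hf⟩ := hacc k h
      exact ⟨⟨f, hfM⟩, (collapseIn_iff hB h0 h1 hR k _).2 hf⟩
  rw [chi_eq_iff, ← key, ← natSet_inj.{u} (m := b), ← natSet_inj.{u} (m := b)]
  exact Iff.rfl

/-! ### Splitting levels of trees -/

theorem IsTree.mem_of_prefix {p : Set Node} (hp : IsTree p) {s t : Node} (ht : t ∈ p)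
    (h : s <+: t) : s ∈ p := by
  obtain ⟨r, rfl⟩ := h
  induction r using List.reverseRecOn with
  | nil => simpa using ht
  | append_singleton r m ih =>
    rw [← List.append_assoc] at ht
    exact ih (hp.1 ht)

theorem isTree_of_prefix {p : Set Node} (h : ∀ s t, t ∈ p → s <+: t → s ∈ p) (hne : p.Nonempty) :
    IsTree p :=
  ⟨fun _ _ h' => h _ _ h' (List.prefix_append _ _), hne⟩

theorem prefix_snoc_iff {s t : Node} {m : ℕ} : s <+: t ++ [m] ↔ s = t ++ [m] ∨ s <+: t := by
  exact List.prefix_concat_iff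

theorem eq_or_snoc_prefix {s t : Node} (h : s <+: t) : s = t ∨ ∃ m, s ++ [m] <+: t := by
  obtain ⟨r, rfl⟩ := h
  cases r with
  | nil => simp
  | cons m r => exact Or.inr ⟨m, r, by simp⟩

theorem prefix_antisymm {s t : Node} (h : s <+: t) (h' : t <+: s) : s = t :=
  h.eq_of_length_le h'.length_le

theorem prefix_total {s t u : Node} (h : s <+: u) (h' : t <+: u) : s <+: t ∨ t <+: s :=
  List.prefix_or_prefix_of_prefix h h'

/-- Incomparable nodes branch at some node. -/
theorem exists_branching {s t : Node} (h : ¬ s <+: t) (h' : ¬ t <+: s) :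
    ∃ w a b, a ≠ b ∧ w ++ [a] <+: s ∧ w ++ [b] <+: t := by
  induction s generalizing t with
  | nil => exact absurd List.nil_prefix h
  | cons a s ih =>
    cases t with
    | nil => exact absurd List.nil_prefix h'
    | cons b t =>
      by_cases hab : a = b
      · subst hab
        simp only [List.cons_prefix_cons, true_and] at h h'
        obtain ⟨w, c, d, hcd, h1, h2⟩ := ih h h'
        exact ⟨a :: w, c, d, hcd, by simpa using h1, by simpa using h2⟩
      · exact ⟨[], a, b, hab, by simp, by simp⟩

theorem prefix_of_branching {r s t w : Node} {a b : ℕ} (hab : a ≠ b) (hs : w ++ [a] <+: s)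
    (ht : w ++ [b] <+: t) (h : r <+: s) (h' : r <+: t) : r <+: w := by
  rcases prefix_total h ((List.prefix_append _ _).trans hs) with h1 | h1
  · exact h1
  rcases eq_or_snoc_prefix h1 with rfl | ⟨c, hc⟩
  · exact List.prefix_rfl
  have key : ∀ {d : ℕ} {v : Node}, w ++ [d] <+: v → r <+: v → c = d := by
    intro d v h1 h2
    simpa using (List.prefix_of_prefix_length_le (hc.trans h2) h1 (by simp)).eq_of_length (by simp)
  exact absurd ((key hs h).symm.trans (key ht h')) hab

theorem spl_mono {p q : Set Node} (h : q ⊆ p) : spl q ⊆ spl p := fun _ hs =>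
  ⟨h hs.1, hs.2.mono fun _ hm => h hm⟩

/-- The number of splitting nodes of `p` strictly below `s`. -/
noncomputable def cnt (p : Set Node) (s : Node) : ℕ := {t | t ∈ spl p ∧ t <+: s ∧ t ≠ s}.ncard

theorem mem_splN {p : Set Node} {n : ℕ} {s : Node} : s ∈ splN p n ↔ s ∈ spl p ∧ cnt p s = n :=
  Iff.rfl

theorem finite_splitting_below (p : Set Node) (s : Node) :
    {t | t ∈ spl p ∧ t <+: s ∧ t ≠ s}.Finite :=
  (List.finite_toSet s.inits).subset fun _ ht => (List.mem_inits _ _).2 ht.2.1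

theorem cnt_mono {p q : Set Node} (h : q ⊆ p) (s : Node) : cnt q s ≤ cnt p s :=
  Set.ncard_le_ncard (fun _ ht => ⟨spl_mono h ht.1, ht.2⟩) (finite_splitting_below p s)

theorem cnt_nil (p : Set Node) : cnt p [] = 0 := by
  unfold cnt
  rw [Set.ncard_eq_zero (finite_splitting_below p [])]
  ext t
  simp +contextual

theorem cnt_snoc_of_mem {p : Set Node} {s : Node} (hs : s ∈ spl p) (m : ℕ) :
    cnt p (s ++ [m]) = cnt p s + 1 := by
  unfold cnt
  rw [← Set.ncard_insert_of_notMem (fun h => h.2.2 rfl) (finite_splitting_below p s)]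
  congr 1
  ext t
  simp only [Set.mem_ofPred_eq, Set.mem_insert_iff, prefix_snoc_iff]
  constructor
  · rintro ⟨h1, h2, h3⟩
    by_cases e : t = s
    · exact Or.inl e
    · exact Or.inr ⟨h1, h2.resolve_left h3, e⟩
  · rintro (rfl | ⟨h1, h2, h3⟩)
    · exact ⟨hs, Or.inr List.prefix_rfl, by simp⟩
    · refine ⟨h1, Or.inr h2, ?_⟩
      rintro rfl
      simpa using h2.length_le

theorem cnt_snoc_of_notMem {p : Set Node} {s : Node} (hs : s ∉ spl p) (m : ℕ) :
    cnt p (s ++ [m]) = cnt p s := by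
  unfold cnt
  congr 1
  ext t
  simp only [Set.mem_ofPred_eq, prefix_snoc_iff]
  constructor
  · rintro ⟨h1, h2, h3⟩
    exact ⟨h1, h2.resolve_left h3, fun e => hs (e ▸ h1)⟩
  · rintro ⟨h1, h2, h3⟩
    refine ⟨h1, Or.inr h2, ?_⟩
    rintro rfl
    simpa using h2.length_le

theorem cnt_snoc_le (p : Set Node) (s : Node) (m : ℕ) : cnt p (s ++ [m]) ≤ cnt p s + 1 := by
  by_cases hs : s ∈ spl p
  · rw [cnt_snoc_of_mem hs]
  · rw [cnt_snoc_of_notMem hs]; omega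

theorem cnt_le_of_prefix {p : Set Node} {s t : Node} (h : s <+: t) : cnt p s ≤ cnt p t := by
  refine Set.ncard_le_ncard (fun u hu => ⟨hu.1, hu.2.1.trans h, ?_⟩) (finite_splitting_below p t)
  rintro rfl
  exact hu.2.2 (prefix_antisymm hu.2.1 h)

theorem cnt_lt_of_prefix {p : Set Node} {s t : Node} (hs : s ∈ spl p) (h : s <+: t)
    (hne : s ≠ t) : cnt p s < cnt p t := by
  obtain ⟨m, hm⟩ := (eq_or_snoc_prefix h).resolve_left hne
  have := cnt_le_of_prefix (p := p) hm
  rw [cnt_snoc_of_mem hs] at this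
  omega

theorem cnt_le_length (p : Set Node) (s : Node) : cnt p s ≤ s.length := by
  induction s using List.reverseRecOn with
  | nil => rw [cnt_nil]; simp
  | append_singleton s m ih =>
    have := cnt_snoc_le p s m
    simp only [List.length_append, List.length_singleton]
    omega

theorem exists_cnt_eq_succ {p : Set Node} {s : Node} (h : 0 < cnt p s) :
    ∃ u ∈ spl p, u <+: s ∧ u ≠ s ∧ cnt p s = cnt p u + 1 := by
  induction s using List.reverseRecOn with
  | nil => rw [cnt_nil] at h; omega
  | append_singleton s m ih =>
    by_cases hs : s ∈ spl p
    · exact ⟨s, hs, List.prefix_append _ _, by simp, cnt_snoc_of_mem hs m⟩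
    · rw [cnt_snoc_of_notMem hs] at h ⊢
      obtain ⟨u, hu, hus, -, he⟩ := ih h
      refine ⟨u, hu, hus.trans (List.prefix_append _ _), ?_, he⟩
      rintro rfl
      simpa using hus.length_le

/-- An arithmetical recursion for the number of splitting nodes below a node. -/
theorem succ_le_cnt_iff {p : Set Node} {s : Node} {n : ℕ} :
    n + 1 ≤ cnt p s ↔ ∃ u, u ∈ spl p ∧ u <+: s ∧ u ≠ s ∧ n ≤ cnt p u := by
  constructor
  · intro h
    obtain ⟨u, h1, h2, h3, h4⟩ := exists_cnt_eq_succ (p := p) (s := s) (by omega)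
    exact ⟨u, h1, h2, h3, by omega⟩
  · rintro ⟨u, h1, h2, h3, h4⟩
    have := cnt_lt_of_prefix h1 h2 h3
    omega

theorem exists_splN_prefix {p : Set Node} {s : Node} {n : ℕ} (hs : s ∈ spl p)
    (h : n ≤ cnt p s) : ∃ w ∈ splN p n, w <+: s := by
  induction hk : cnt p s - n generalizing s with
  | zero => exact ⟨s, ⟨hs, by change cnt p s = n; omega⟩, List.prefix_rfl⟩
  | succ k ih =>
    obtain ⟨u, hu, hus, -, he⟩ := exists_cnt_eq_succ (p := p) (s := s) (by omega)
    obtain ⟨w, hw, hwu⟩ := ih hu (by omega) (by omega)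
    exact ⟨w, hw, hwu.trans hus⟩

/-- Each splitting level is an antichain. -/
theorem splN_antichain {p : Set Node} {n : ℕ} {s t : Node} (hs : s ∈ splN p n)
    (ht : t ∈ splN p n) (h : s <+: t) : s = t := by
  by_contra hne
  have := cnt_lt_of_prefix hs.1 h hne
  rw [mem_splN] at hs ht
  omega

theorem exists_spl_of_incomparable {p : Set Node} (hp : IsTree p) {s t : Node} (hs : s ∈ p)
    (ht : t ∈ p) (h : ¬ s <+: t) (h' : ¬ t <+: s) :
    ∃ w ∈ spl p, w <+: s ∧ w ≠ s ∧ ∀ r, r <+: s → r <+: t → r <+: w := by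
  obtain ⟨w, a, b, hab, h1, h2⟩ := exists_branching h h'
  refine ⟨w, ⟨hp.mem_of_prefix hs ((List.prefix_append _ _).trans h1), a, hp.mem_of_prefix hs h1,
    b, hp.mem_of_prefix ht h2, hab⟩, (List.prefix_append _ _).trans h1, ?_,
    fun r hr hr' => prefix_of_branching hab h1 h2 hr hr'⟩
  rintro rfl
  simpa using h1.length_le

theorem splN_zero_unique {p : Set Node} (hp : IsTree p) {s t : Node} (hs : s ∈ splN p 0)
    (ht : t ∈ splN p 0) : s = t := by
  by_cases h : s <+: t
  · exact splN_antichain hs ht h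
  by_cases h' : t <+: s
  · exact (splN_antichain ht hs h').symm
  obtain ⟨w, hw, hws, hne, -⟩ := exists_spl_of_incomparable hp hs.1.1 ht.1.1 h h'
  have := cnt_lt_of_prefix hw hws hne
  rw [mem_splN] at hs
  omega

/-- Above every node there is a splitting node. -/
def HasSplitting (p : Set Node) : Prop := ∀ s ∈ p, ∃ t ∈ spl p, s <+: t

theorem HasSplitting.exists_splN {p : Set Node} (h : HasSplitting p) {s : Node} {n : ℕ}
    (hs : s ∈ p) (hn : cnt p s ≤ n) : ∃ t ∈ splN p n, s <+: t := by
  have key : ∀ k, ∃ t ∈ spl p, s <+: t ∧ k ≤ cnt p t := by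
    intro k
    induction k with
    | zero =>
      obtain ⟨t, ht, hst⟩ := h s hs
      exact ⟨t, ht, hst, Nat.zero_le _⟩
    | succ k ih =>
      obtain ⟨t, ht, hst, hk⟩ := ih
      obtain ⟨m, hm⟩ := ht.2.nonempty
      obtain ⟨u, hu, htu⟩ := h _ hm
      refine ⟨u, hu, hst.trans ((List.prefix_append _ _).trans htu), ?_⟩
      have := cnt_le_of_prefix (p := p) htu
      rw [cnt_snoc_of_mem ht] at this
      omega
  obtain ⟨t, ht, hst, hk⟩ := key n
  obtain ⟨w, hw, hwt⟩ := exists_splN_prefix ht hk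
  rcases prefix_total hst hwt with h1 | h1
  · exact ⟨w, hw, h1⟩
  · refine ⟨w, hw, ?_⟩
    by_cases e : w = s
    · rw [e]
    · have := cnt_lt_of_prefix hw.1 h1 e
      rw [mem_splN] at hw
      omega

theorem HasSplitting.exists_snoc {p : Set Node} (h : HasSplitting p) (hp : IsTree p) {s : Node}
    (hs : s ∈ p) : ∃ m, s ++ [m] ∈ p := by
  obtain ⟨t, ht, hst⟩ := h s hs
  rcases eq_or_snoc_prefix hst with rfl | ⟨m, hm⟩
  · exact ht.2.nonempty
  · exact ⟨m, hp.mem_of_prefix ht.1 hm⟩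

theorem HasSplitting.exists_spl_initSeg {p : Set Node} (h : HasSplitting p) (hp : IsTree p)
    {x : Real} (hx : ∀ k, initSeg x k ∈ p) (k : ℕ) : ∃ j ≥ k, initSeg x j ∈ spl p := by
  by_contra hcon
  push Not at hcon
  -- without splitting nodes on the branch, all nodes of `p` above `x ↾ k` lie on the branch
  have key : ∀ r : Node, initSeg x k ++ r ∈ p → initSeg x k ++ r = initSeg x (k + r.length) := by
    intro r
    induction r using List.reverseRecOn with
    | nil => intro _; simp
    | append_singleton r m ih =>
      intro hr
      rw [← List.append_assoc] at hr ⊢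
      have e := ih (hp.mem_of_prefix hr (List.prefix_append _ _))
      rw [e] at hr ⊢
      have hns := hcon (k + r.length) (by omega)
      have hxs := hx (k + r.length + 1)
      rw [initSeg_succ] at hxs
      have : m = x (k + r.length) := by
        by_contra hne
        exact hns ⟨hx _, m, hr, _, hxs, hne⟩
      rw [this, ← initSeg_succ]
      simp [add_assoc]
  obtain ⟨t, ht, r, rfl⟩ := h _ (hx k)
  have e := key r ht.1
  rw [e] at ht
  exact hcon _ (by omega) ht

theorem HasSplitting.exists_splN_initSeg {p : Set Node} (h : HasSplitting p) (hp : IsTree p)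
    {x : Real} (hx : ∀ k, initSeg x k ∈ p) (n : ℕ) : ∃ k, initSeg x k ∈ splN p n := by
  have key : ∀ n, ∃ k, initSeg x k ∈ spl p ∧ n ≤ cnt p (initSeg x k) := by
    intro n
    induction n with
    | zero =>
      obtain ⟨j, -, hj⟩ := h.exists_spl_initSeg hp hx 0
      exact ⟨j, hj, Nat.zero_le _⟩
    | succ n ih =>
      obtain ⟨k, hk, hn⟩ := ih
      obtain ⟨j, hj, hjs⟩ := h.exists_spl_initSeg hp hx (k + 1)
      refine ⟨j, hjs, ?_⟩
      have := cnt_le_of_prefix (p := p) (initSeg_prefix x hj)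
      rw [initSeg_succ, cnt_snoc_of_mem hk] at this
      omega
  obtain ⟨k, hk, hn⟩ := key n
  obtain ⟨w, hw, hwk⟩ := exists_splN_prefix hk hn
  exact ⟨w.length, prefix_initSeg hwk ▸ hw⟩

/-! ### The four forcings in terms of immediate successors -/

/-- The sets of immediate successors that nodes of conditions of the forcing may have. -/
def IsSuccSet : TreeForcing → Set ℕ → Prop
  | .sacks => fun S => S.Nonempty
  | .miller => fun S => (∃! n, n ∈ S) ∨ S.Infinite
  | .roslanowski => fun S => (∃! n, n ∈ S) ∨ S = Set.univ
  | .laver => fun S => (∃! n, n ∈ S) ∨ S.Infinite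

theorem isSuccSet_singleton (Q : TreeForcing) (m : ℕ) : IsSuccSet Q {m} := by
  cases Q
  · exact ⟨m, rfl⟩
  all_goals exact Or.inl ⟨m, rfl, fun _ h => h⟩

theorem not_nontrivial_of_existsUnique {S : Set ℕ} (h : ∃! n, n ∈ S) : ¬ S.Nontrivial := by
  rintro ⟨a, ha, b, hb, hab⟩
  exact hab (h.unique ha hb)

theorem infinite_of_nontrivial {S : Set ℕ} (h : (∃! n, n ∈ S) ∨ S.Infinite)
    (hS : S.Nontrivial) : S.Infinite :=
  h.resolve_left fun h' => not_nontrivial_of_existsUnique h' hS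

theorem IsStem.mem_splN_zero {p : Set Node} {s : Node} (hs : IsStem p s) : s ∈ splN p 0 := by
  refine ⟨⟨hs.1, hs.2.1⟩, ?_⟩
  change cnt p s = 0
  by_contra h
  obtain ⟨u, hu, hus, hne, -⟩ := exists_cnt_eq_succ (p := p) (s := s) (by omega)
  obtain ⟨m, hm⟩ := (eq_or_snoc_prefix hus).resolve_left hne
  obtain ⟨k, hk, hkm⟩ := hu.2.exists_ne m
  rcases hs.2.2 _ hk with h2 | h2
  · rcases prefix_total h2 hm with h3 | h3
    · exact hkm (by simpa using h3.eq_of_length (by simp))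
    · exact hkm (by simpa using (h3.eq_of_length (by simp)).symm)
  · have h3 := hm.trans h2
    exact hkm (by simpa using (h3.eq_of_length (by simp)).symm)

theorem IsStem.unique {p : Set Node} (hp : IsTree p) {s t : Node} (hs : IsStem p s)
    (ht : IsStem p t) : s = t :=
  splN_zero_unique hp hs.mem_splN_zero ht.mem_splN_zero

/-- A uniform description of the conditions of the four forcings. Laver conditions are the Miller
conditions in which all nodes above a splitting node are splitting nodes. -/
theorem isCond_iff (Q : TreeForcing) (p : Set Node) : IsCond Q p ↔ IsTree p ∧
    (∀ s ∈ p, IsSuccSet Q (succs p s)) ∧ HasSplitting p ∧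
    (Q = .laver → ∀ s ∈ spl p, ∀ t ∈ p, s <+: t → t ∈ spl p) := by
  cases Q
  · simp only [IsCond, IsSacks, IsSuccSet, reduceCtorEq, false_imp_iff, and_true]
    constructor
    · rintro ⟨hT, h⟩
      have hs : HasSplitting p := fun s hs => by
        obtain ⟨t, ht, hst, hn⟩ := h s hs
        exact ⟨t, ⟨ht, hn⟩, hst⟩
      exact ⟨hT, fun s h' => hs.exists_snoc hT h', hs⟩
    · rintro ⟨hT, -, h⟩
      refine ⟨hT, fun s hs => ?_⟩
      obtain ⟨t, ht, hst⟩ := h s hs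
      exact ⟨t, ht.1, hst, ht.2⟩
  · simp only [IsCond, IsMiller, IsSuccSet, reduceCtorEq, false_imp_iff, and_true]
    refine and_congr_right fun hT => and_congr_right fun hloc => forall₂_congr fun s hs => ?_
    constructor
    · rintro ⟨t, ht, hst, hn⟩
      exact ⟨t, ⟨ht, hn.nontrivial⟩, hst⟩
    · rintro ⟨t, ht, hst⟩
      exact ⟨t, ht.1, hst, infinite_of_nontrivial (hloc t ht.1) ht.2⟩
  · simp only [IsCond, IsRoslanowski, IsSuccSet, reduceCtorEq, false_imp_iff, and_true]
    refine and_congr_right fun hT => and_congr_right fun hloc => forall₂_congr fun s hs => ?_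
    constructor
    · rintro ⟨t, ht, hst, hn⟩
      exact ⟨t, ⟨ht, hn ▸ Set.nontrivial_univ⟩, hst⟩
    · rintro ⟨t, ht, hst⟩
      exact ⟨t, ht.1, hst,
        (hloc t ht.1).resolve_left fun h' => not_nontrivial_of_existsUnique h' ht.2⟩
  · simp only [IsCond, IsSuccSet, forall_const]
    constructor
    · rintro ⟨hT, σ, hσ, hinf⟩
      have hbelow : ∀ s ∈ p, ¬ σ <+: s → ∃! m, m ∈ succs p s := by
        intro s hs hns
        have hsσ := (hσ.2.2 s hs).resolve_right hns
        obtain ⟨m, hm⟩ := (eq_or_snoc_prefix hsσ).resolve_left (fun e => hns (e ▸ List.prefix_rfl))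
        refine ⟨m, hT.mem_of_prefix hσ.1 hm, fun k hk => ?_⟩
        rcases hσ.2.2 _ hk with h2 | h2
        · rcases prefix_total h2 hm with h3 | h3
          · simpa using h3.eq_of_length (by simp)
          · simpa using (h3.eq_of_length (by simp)).symm
        · rcases prefix_snoc_iff.1 h2 with h3 | h3
          · rw [h3] at hm
            simpa using (hm.eq_of_length (by simp)).symm
          · exact absurd h3 hns
      refine ⟨hT, fun s hs => ?_, fun s hs => ?_, fun s hs t ht hst => ?_⟩
      · by_cases h : σ <+: s
        · exact Or.inr (hinf s hs h)
        · exact Or.inl (hbelow s hs h)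
      · by_cases h : σ <+: s
        · exact ⟨s, ⟨hs, (hinf s hs h).nontrivial⟩, List.prefix_rfl⟩
        · exact ⟨σ, ⟨hσ.1, hσ.2.1⟩, (hσ.2.2 s hs).resolve_right h⟩
      · by_cases h : σ <+: s
        · exact ⟨ht, (hinf t ht (h.trans hst)).nontrivial⟩
        · exact absurd hs.2 (not_nontrivial_of_existsUnique (hbelow s hs.1 h))
    · rintro ⟨hT, hloc, hspl, habove⟩
      obtain ⟨s, hs⟩ := hT.2
      have hnil : [] ∈ p := hT.mem_of_prefix hs (List.nil_prefix)
      obtain ⟨σ, hσ, -⟩ := hspl.exists_splN hnil (n := 0) (by rw [cnt_nil])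
      refine ⟨hT, σ, ⟨hσ.1.1, hσ.1.2, fun t ht => ?_⟩, fun t ht hst => ?_⟩
      · by_cases h0 : cnt p t = 0
        · obtain ⟨u, hu, htu⟩ := hspl.exists_splN ht (n := 0) (by omega)
          exact Or.inl (splN_zero_unique hT hu hσ ▸ htu)
        · obtain ⟨u, hu, hut, -⟩ := exists_cnt_eq_succ (p := p) (s := t) (by omega)
          obtain ⟨w, hw, hwu⟩ := exists_splN_prefix hu (Nat.zero_le _)
          exact Or.inr (splN_zero_unique hT hw hσ ▸ hwu.trans hut)
      · exact infinite_of_nontrivial (hloc t ht) (habove σ hσ.1 t ht hst).2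

/-! ### Restrictions of conditions -/

theorem mem_restr {p : Set Node} {s t : Node} : s ∈ restr p t ↔ s ∈ p ∧ (s <+: t ∨ t <+: s) :=
  Iff.rfl

theorem restr_subset (p : Set Node) (t : Node) : restr p t ⊆ p := fun _ h => h.1

theorem restr_mono {p q : Set Node} (h : q ⊆ p) (t : Node) : restr q t ⊆ restr p t :=
  fun _ hs => ⟨h hs.1, hs.2⟩

theorem succs_restr_of_prefix {p : Set Node} {t u : Node} (h : t <+: u) :
    succs (restr p t) u = succs p u := by
  ext m
  exact ⟨fun hm => hm.1, fun hm => ⟨hm, Or.inr (h.trans (List.prefix_append _ _))⟩⟩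

theorem succs_restr_of_snoc_prefix {p : Set Node} (hp : IsTree p) {t u : Node} (ht : t ∈ p)
    {m : ℕ} (h : u ++ [m] <+: t) : succs (restr p t) u = {m} := by
  ext k
  simp only [Set.mem_singleton_iff]
  constructor
  · rintro ⟨-, h1 | h1⟩
    · rcases prefix_total h1 h with h2 | h2
      · simpa using h2.eq_of_length (by simp)
      · simpa using (h2.eq_of_length (by simp)).symm
    · simpa using ((h.trans h1).eq_of_length (by simp)).symm
  · rintro rfl
    exact ⟨hp.mem_of_prefix ht h, Or.inl h⟩

theorem isTree_restr {p : Set Node} (hp : IsTree p) {t : Node} (ht : t ∈ p) :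
    IsTree (restr p t) := by
  refine isTree_of_prefix (fun u v hv huv => ⟨hp.mem_of_prefix hv.1 huv, ?_⟩)
    ⟨t, ht, Or.inl List.prefix_rfl⟩
  rcases hv.2 with h | h
  · exact Or.inl (huv.trans h)
  · exact prefix_total huv h

theorem isCond_restr {Q : TreeForcing} {p : Set Node} (hp : IsCond Q p) {t : Node} (ht : t ∈ p) :
    IsCond Q (restr p t) := by
  obtain ⟨hT, hloc, hspl, habove⟩ := (isCond_iff Q p).1 hp
  have hcase : ∀ u ∈ restr p t, t <+: u ∨ ∃ m, u ++ [m] <+: t := by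
    rintro u ⟨-, h | h⟩
    · rcases eq_or_snoc_prefix h with rfl | hm
      · exact Or.inl List.prefix_rfl
      · exact Or.inr hm
    · exact Or.inl h
  refine (isCond_iff Q _).2 ⟨isTree_restr hT ht, fun u hu => ?_, fun u hu => ?_,
    fun hQ u hu v hv huv => ?_⟩
  · rcases hcase u hu with h | ⟨m, hm⟩
    · rw [succs_restr_of_prefix h]
      exact hloc u hu.1
    · rw [succs_restr_of_snoc_prefix hT ht hm]
      exact isSuccSet_singleton Q m
  · have key : ∀ w ∈ p, t <+: w → ∃ v ∈ spl (restr p t), w <+: v := by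
      intro w hw htw
      obtain ⟨v, hv, hwv⟩ := hspl w hw
      refine ⟨v, ⟨⟨hv.1, Or.inr (htw.trans hwv)⟩, ?_⟩, hwv⟩
      rw [succs_restr_of_prefix (htw.trans hwv)]
      exact hv.2
    rcases hu.2 with h | h
    · obtain ⟨v, hv, htv⟩ := key t ht List.prefix_rfl
      exact ⟨v, hv, h.trans htv⟩
    · exact key u hu.1 h
  · rcases hcase u hu.1 with h | ⟨m, hm⟩
    · refine ⟨hv, ?_⟩
      rw [succs_restr_of_prefix (h.trans huv)]
      exact (habove hQ u (spl_mono (restr_subset p t) hu) v hv.1 huv).2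
    · have := hu.2
      rw [succs_restr_of_snoc_prefix hT ht hm] at this
      exact absurd this Set.not_nontrivial_singleton

theorem IsCond.isTree {Q : TreeForcing} {p : Set Node} (hp : IsCond Q p) : IsTree p :=
  ((isCond_iff Q p).1 hp).1

theorem IsCond.hasSplitting {Q : TreeForcing} {p : Set Node} (hp : IsCond Q p) :
    HasSplitting p :=
  ((isCond_iff Q p).1 hp).2.2.1

theorem IsCond.nil_mem {Q : TreeForcing} {p : Set Node} (hp : IsCond Q p) : [] ∈ p := by
  obtain ⟨s, hs⟩ := hp.isTree.2
  exact hp.isTree.mem_of_prefix hs List.nil_prefix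

theorem HasSplitting.exists_length {p : Set Node} (h : HasSplitting p) (hp : IsTree p) (n : ℕ) :
    ∃ s ∈ p, s.length = n := by
  induction n with
  | zero =>
    obtain ⟨s, hs⟩ := hp.2
    exact ⟨[], hp.mem_of_prefix hs List.nil_prefix, rfl⟩
  | succ n ih =>
    obtain ⟨s, hs, rfl⟩ := ih
    obtain ⟨m, hm⟩ := h.exists_snoc hp hs
    exact ⟨_, hm, by simp⟩

/-- A condition below `p^[t]` contains the node `t`. -/
theorem IsCond.mem_of_subset_restr {Q : TreeForcing} {p d : Set Node} (hd : IsCond Q d) {t : Node}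
    (h : d ⊆ restr p t) : t ∈ d := by
  obtain ⟨s, hs, hl⟩ := hd.hasSplitting.exists_length hd.isTree t.length
  rcases (h hs).2 with h1 | h1
  · rwa [← h1.eq_of_length hl]
  · rwa [h1.eq_of_length hl.symm]

/-- Every condition `q ⊆ p` meets all splitting levels of `p`. -/
theorem IsCond.exists_mem_splN {Q : TreeForcing} {p q : Set Node} (hq : IsCond Q q) (h : q ⊆ p)
    (n : ℕ) : ∃ s ∈ splN p n, s ∈ q := by
  obtain ⟨u, hu, -⟩ := hq.hasSplitting.exists_splN hq.nil_mem (n := n) (by rw [cnt_nil]; omega)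
  obtain ⟨w, hw, hwu⟩ := exists_splN_prefix (spl_mono h hu.1) (n := n)
    (le_trans hu.2.ge (cnt_mono h u))
  exact ⟨w, hw, hq.isTree.mem_of_prefix hu.1.1 hwu⟩

/-! ### Fusion -/

/-- Passing from `p` to `q ≤_n p` keeps the nodes with at most `n` splitting nodes below them. -/
theorem LeN.mem {n : ℕ} {p q : Set Node} (hp : HasSplitting p) (hq : IsTree q) (h : LeN n q p)
    {u : Node} (hu : u ∈ p) (hn : cnt p u ≤ n) : u ∈ q := by
  obtain ⟨s, hs, hus⟩ := hp.exists_splN hu hn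
  rw [← h.2] at hs
  exact hq.mem_of_prefix hs.1.1 hus

/-- The intersection of a fusion sequence is a condition: around a node of length `k`, the tree
does not change any more after the stage `k + 1`. -/
theorem isCond_iInter {Q : TreeForcing} {a : ℕ → Set Node} (ha : ∀ n, IsCond Q (a n))
    (h : ∀ n, LeN n (a (n + 1)) (a n)) : IsCond Q (⋂ n, a n) := by
  have hanti : ∀ m n, m ≤ n → a n ⊆ a m := fun m n hmn => by
    induction n, hmn using Nat.le_induction with
    | base => exact subset_rfl
    | succ n _ ih => exact (h n).1.trans ih
  -- A node with at most `n` splitting nodes below it at the stage `n` is never removed later.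
  have hmem : ∀ n u, u ∈ a n → cnt (a n) u ≤ n → u ∈ ⋂ n, a n := by
    intro n u hu hn
    have key : ∀ m ≥ n, u ∈ a m ∧ cnt (a m) u ≤ n := by
      intro m hm
      induction m, hm using Nat.le_induction with
      | base => exact ⟨hu, hn⟩
      | succ m hm ih =>
        exact ⟨(h m).mem (ha m).hasSplitting (ha _).isTree ih.1 (ih.2.trans hm),
          (cnt_mono (h m).1 u).trans ih.2⟩
    refine Set.mem_iInter.2 fun m => ?_
    exact hanti m _ (le_max_left m n) (key _ (le_max_right m n)).1
  have hsub : ∀ n, (⋂ n, a n) ⊆ a n := fun n => Set.iInter_subset _ n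
  have hsuccs : ∀ n u, u ∈ a n → cnt (a n) u < n → succs (⋂ n, a n) u = succs (a n) u := by
    intro n u hu hn
    ext m
    refine ⟨fun hm => hsub n hm, fun hm => hmem n _ hm ?_⟩
    have := cnt_snoc_le (a n) u m
    omega
  have hstab : ∀ u ∈ ⋂ n, a n, succs (⋂ n, a n) u = succs (a (u.length + 1)) u := fun u hu =>
    hsuccs _ u (hsub _ hu) (Nat.lt_succ_of_le (cnt_le_length _ u))
  refine (isCond_iff Q _).2 ⟨?_, fun s hs => ?_, fun s hs => ?_, fun hQ s hs t ht hst => ?_⟩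
  · refine isTree_of_prefix (fun s t ht hst => Set.mem_iInter.2 fun n =>
      (ha n).isTree.mem_of_prefix (hsub n ht) hst) ⟨[], hmem 0 [] (ha 0).nil_mem ?_⟩
    rw [cnt_nil]
  · rw [hstab s hs]
    exact ((isCond_iff Q _).1 (ha _)).2.1 s (hsub _ hs)
  · obtain ⟨t, ht, hst⟩ := (ha (s.length + 1)).hasSplitting.exists_splN (hsub _ hs)
      (cnt_le_length _ s)
    have hlt : cnt (a (s.length + 1)) t < s.length + 1 := by
      rw [mem_splN] at ht
      omega
    refine ⟨t, ⟨hmem _ t ht.1.1 hlt.le, ?_⟩, hst⟩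
    rw [hsuccs _ t ht.1.1 hlt]
    exact ht.1.2
  · refine ⟨ht, ?_⟩
    rw [hstab t ht]
    exact (((isCond_iff Q _).1 (ha _)).2.2.2 hQ s (spl_mono (hsub _) hs) t (hsub _ ht) hst).2

/-! ### Amalgamation along an antichain -/

/-- The union of the trees `d t` for `t ∈ F`. -/
def amalg (F : Set Node) (d : Node → Set Node) : Set Node := {v | ∃ t ∈ F, v ∈ d t}

/-- `F` is an antichain, and for `t ∈ F` the tree `d t` contains `t` and consists of nodes that are
comparable with `t`. -/
structure IsAmalgam (F : Set Node) (d : Node → Set Node) : Prop where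
  nonempty : F.Nonempty
  antichain : ∀ s ∈ F, ∀ t ∈ F, s <+: t → s = t
  isTree : ∀ t ∈ F, IsTree (d t)
  self_mem : ∀ t ∈ F, t ∈ d t
  comparable : ∀ t ∈ F, ∀ v ∈ d t, v <+: t ∨ t <+: v

section

variable {F : Set Node} {d : Node → Set Node} (h : IsAmalgam F d)
include h

theorem IsAmalgam.subset : F ⊆ amalg F d := fun t ht => ⟨t, ht, h.self_mem t ht⟩

theorem IsAmalgam.isTree_amalg : IsTree (amalg F d) := by
  obtain ⟨t, ht⟩ := h.nonempty
  exact isTree_of_prefix (fun u v ⟨t, ht, hv⟩ huv => ⟨t, ht, (h.isTree t ht).mem_of_prefix hv huv⟩)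
    ⟨t, h.subset ht⟩

theorem IsAmalgam.restr_eq {t : Node} (ht : t ∈ F) : restr (amalg F d) t = d t := by
  ext v
  constructor
  · rintro ⟨⟨t', ht', hv⟩, hc⟩
    have hcomp : t = t' ∨ v <+: t := by
      rcases hc with hc | hc
      · exact Or.inr hc
      · left
        rcases h.comparable t' ht' v hv with h1 | h1
        · exact h.antichain t ht t' ht' (hc.trans h1)
        · rcases prefix_total hc h1 with h2 | h2
          · exact h.antichain t ht t' ht' h2
          · exact (h.antichain t' ht' t ht h2).symm
    rcases hcomp with rfl | hvt
    · exact hv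
    · exact (h.isTree t ht).mem_of_prefix (h.self_mem t ht) hvt
  · exact fun hv => ⟨⟨t, ht, hv⟩, h.comparable t ht v hv⟩

theorem IsAmalgam.succs_eq {t v : Node} (ht : t ∈ F) (hv : t <+: v) :
    succs (amalg F d) v = succs (d t) v := by
  rw [← h.restr_eq ht, succs_restr_of_prefix hv]

end

/-! ### Strengthening a condition above a splitting level -/

/-- The immediate successors of the nodes of the `n`-th splitting level. Amalgamating above them,
rather than above the splitting nodes, preserves the splitting of the `n`-th level. -/
def nextLevel (p : Set Node) (n : ℕ) : Set Node := {t | t ∈ p ∧ ∃ s ∈ splN p n, ∃ m, t = s ++ [m]}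

theorem nextLevel_antichain {p : Set Node} {n : ℕ} : ∀ s ∈ nextLevel p n, ∀ t ∈ nextLevel p n,
    s <+: t → s = t := by
  rintro _ ⟨-, s, hs, k, rfl⟩ _ ⟨-, t, ht, m, rfl⟩ h
  have : s = t := by
    rcases prefix_total ((List.prefix_append s [k]).trans h) (List.prefix_append t [m]) with h' | h'
    · exact splN_antichain hs ht h'
    · exact (splN_antichain ht hs h').symm
  subst this
  exact h.eq_of_length (by simp)

theorem cnt_snoc_le_of_prefix {p : Set Node} {n k : ℕ} {s v : Node} (hs : s ∈ splN p n)
    (hv : v <+: s) (hne : v ≠ s) : cnt p (v ++ [k]) ≤ n := by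
  rw [mem_splN] at hs
  by_cases h : v ∈ spl p
  · rw [cnt_snoc_of_mem h]
    have := cnt_lt_of_prefix h hv hne
    omega
  · rw [cnt_snoc_of_notMem h]
    have := cnt_le_of_prefix (p := p) hv
    omega

theorem amalg_nextLevel_subset {Q : TreeForcing} {p : Set Node} {n : ℕ} {d : Node → Set Node}
    (hd : ∀ t ∈ nextLevel p n, IsCond Q (d t) ∧ d t ⊆ restr p t) :
    amalg (nextLevel p n) d ⊆ p :=
  fun _ ⟨t, ht, hv⟩ => ((hd t ht).2 hv).1

section

variable {Q : TreeForcing} {p : Set Node} (hp : IsCond Q p) {n : ℕ} {d : Node → Set Node}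
  (hd : ∀ t ∈ nextLevel p n, IsCond Q (d t) ∧ d t ⊆ restr p t)
include hp hd

theorem isAmalgam_nextLevel : IsAmalgam (nextLevel p n) d where
  nonempty := by
    obtain ⟨s, hs, -⟩ := hp.hasSplitting.exists_splN hp.nil_mem (n := n) (by rw [cnt_nil]; omega)
    obtain ⟨m, hm⟩ := hs.1.2.nonempty
    exact ⟨_, hm, s, hs, m, rfl⟩
  antichain := nextLevel_antichain
  isTree t ht := (hd t ht).1.isTree
  self_mem t ht := (hd t ht).1.mem_of_subset_restr (hd t ht).2
  comparable t ht v hv := ((hd t ht).2 hv).2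

theorem mem_amalg_nextLevel {u : Node} (hu : u ∈ p) (hn : cnt p u ≤ n) :
    u ∈ amalg (nextLevel p n) d := by
  have hA := isAmalgam_nextLevel hp hd
  obtain ⟨s, hs, hus⟩ := hp.hasSplitting.exists_splN hu hn
  obtain ⟨m, hm⟩ := hs.1.2.nonempty
  exact hA.isTree_amalg.mem_of_prefix (hA.subset ⟨hm, s, hs, m, rfl⟩)
    (hus.trans (List.prefix_append _ _))

theorem succs_amalg_nextLevel {s v : Node} (hs : s ∈ splN p n) (hv : v <+: s) :
    succs (amalg (nextLevel p n) d) v = succs p v := by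
  ext k
  refine ⟨fun hk => amalg_nextLevel_subset hd hk, fun hk => ?_⟩
  by_cases e : v = s
  · subst e
    exact (isAmalgam_nextLevel hp hd).subset ⟨hk, v, hs, k, rfl⟩
  · exact mem_amalg_nextLevel hp hd hk (cnt_snoc_le_of_prefix hs hv e)

/-- The amalgam is a condition, except for Laver forcing, where nodes below the stems of the trees
`d t` need not split. -/
theorem isCond_amalg_nextLevel (hQ : Q ≠ .laver) : IsCond Q (amalg (nextLevel p n) d) := by
  have hA := isAmalgam_nextLevel hp hd
  refine (isCond_iff Q _).2 ⟨hA.isTree_amalg, ?_, ?_, fun h => absurd h hQ⟩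
  · rintro v ⟨t, ht, hv⟩
    by_cases htv : t <+: v
    · rw [hA.succs_eq ht htv]
      exact ((isCond_iff Q _).1 (hd t ht).1).2.1 v hv
    · obtain ⟨-, s, hs, m, rfl⟩ := id ht
      have hvs := (prefix_snoc_iff.1 ((((hd _ ht).2 hv).2).resolve_right htv)).resolve_left
        fun e => htv (e ▸ List.prefix_rfl)
      rw [succs_amalg_nextLevel hp hd hs hvs]
      exact ((isCond_iff Q _).1 hp).2.1 v (hp.isTree.mem_of_prefix hs.1.1 hvs)
  · have key : ∀ t ∈ nextLevel p n, ∀ v ∈ d t, t <+: v →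
        ∃ u ∈ spl (amalg (nextLevel p n) d), v <+: u := by
      intro t ht v hv htv
      obtain ⟨u, hu, hvu⟩ := (hd t ht).1.hasSplitting v hv
      refine ⟨u, ⟨⟨t, ht, hu.1⟩, ?_⟩, hvu⟩
      rw [hA.succs_eq ht (htv.trans hvu)]
      exact hu.2
    rintro v ⟨t, ht, hv⟩
    rcases hA.comparable t ht v hv with h | h
    · obtain ⟨u, hu, htu⟩ := key t ht t (hA.self_mem t ht) List.prefix_rfl
      exact ⟨u, hu, h.trans htu⟩
    · exact key t ht v hv h

theorem leN_amalg_nextLevel : LeN n (amalg (nextLevel p n) d) p := by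
  have hA := isAmalgam_nextLevel hp hd
  refine ⟨amalg_nextLevel_subset hd, ?_⟩
  have h1 : splN p n ⊆ splN (amalg (nextLevel p n) d) n := by
    intro s hs
    have hspl : ∀ v, v <+: s → v ∈ spl p → v ∈ spl (amalg (nextLevel p n) d) := by
      intro v hv hvp
      refine ⟨mem_amalg_nextLevel hp hd hvp.1 ?_, ?_⟩
      · have := cnt_le_of_prefix (p := p) hv
        rw [mem_splN] at hs
        omega
      · rw [succs_amalg_nextLevel hp hd hs hv]
        exact hvp.2
    refine ⟨hspl s List.prefix_rfl hs.1, ?_⟩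
    refine Eq.trans (congrArg Set.ncard (Set.ext fun v => ?_)) hs.2
    exact ⟨fun hv => ⟨spl_mono (amalg_nextLevel_subset hd) hv.1, hv.2⟩,
      fun hv => ⟨hspl v hv.2.1 hv.1, hv.2⟩⟩
  refine Set.Subset.antisymm (fun s hs => ?_) h1
  obtain ⟨t, ht, hst⟩ := hs.1.1
  obtain ⟨-, s', hs', m, rfl⟩ := id ht
  rcases hA.comparable _ ht s hst with h | h
  · rcases prefix_snoc_iff.1 h with rfl | h
    · exact absurd (splN_antichain (h1 hs') hs (List.prefix_append _ _)) (by simp)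
    · rwa [splN_antichain hs (h1 hs') h]
  · have h' := (List.prefix_append s' [m]).trans h
    rwa [← splN_antichain (h1 hs') hs h']

/-- Every branch of the amalgam splits for the `n`-th time and passes through the next level. -/
theorem front_nextLevel (hQ : Q ≠ .laver) (W : Set Real) :
    FrontIn W (nextLevel p n) (amalg (nextLevel p n) d) := by
  have hA := isAmalgam_nextLevel hp hd
  refine ⟨hA.subset, hA.antichain, fun x _ hx => ?_⟩
  have hq := isCond_amalg_nextLevel hp hd hQ
  obtain ⟨k, hk⟩ := hq.hasSplitting.exists_splN_initSeg hq.isTree hx n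
  rw [(leN_amalg_nextLevel hp hd).2] at hk
  exact ⟨k + 1, amalg_nextLevel_subset hd (hx _), _, hk, x k, initSeg_succ x k⟩

/-- The trees `d t` are the restrictions of the amalgam to the nodes of its splitting level
`n + 1`. -/
theorem restr_splN_amalg_nextLevel {s : Node}
    (hs : s ∈ splN (amalg (nextLevel p n) d) (n + 1)) :
    ∃ t ∈ nextLevel p n, restr (amalg (nextLevel p n) d) s = d t := by
  have hA := isAmalgam_nextLevel hp hd
  obtain ⟨u, hu, hus, hne, he⟩ := exists_cnt_eq_succ
    (p := amalg (nextLevel p n) d) (s := s) (by rw [mem_splN] at hs; omega)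
  rw [mem_splN] at hs
  have hun : u ∈ splN (amalg (nextLevel p n) d) n := mem_splN.2 ⟨hu, by omega⟩
  rw [(leN_amalg_nextLevel hp hd).2] at hun
  obtain ⟨m, hm⟩ := (eq_or_snoc_prefix hus).resolve_left hne
  have ht : u ++ [m] ∈ nextLevel p n := ⟨amalg_nextLevel_subset hd
    (hA.isTree_amalg.mem_of_prefix hs.1.1 hm), u, hun, m, rfl⟩
  refine ⟨_, ht, ?_⟩
  rw [← hA.restr_eq ht]
  ext v
  refine and_congr_right fun hv => ⟨?_, ?_⟩
  · rintro (h | h)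
    · exact prefix_total h hm
    · exact Or.inr (hm.trans h)
  · rintro (h | h)
    · exact Or.inl (h.trans hm)
    · by_contra hcon
      push Not at hcon
      obtain ⟨w, hw, hws, hwne, hmeet⟩ := exists_spl_of_incomparable hA.isTree_amalg hs.1.1 hv
        hcon.2 hcon.1
      have h1 := cnt_lt_of_prefix hw hws hwne
      have h2 := cnt_le_of_prefix (p := amalg (nextLevel p n) d) (hmeet _ hm h)
      rw [cnt_snoc_of_mem hu] at h2
      omega

end

/-! ### Laver conditions and bars -/

/-- `p` is a Laver condition with stem `s`. -/
structure IsLaverAt (p : Set Node) (s : Node) : Prop where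
  isTree : IsTree p
  stem : IsStem p s
  infinite : ∀ t ∈ p, s <+: t → (succs p t).Infinite

theorem isLaverAt_iff {p : Set Node} {s : Node} : IsLaverAt p s ↔ IsLaver p ∧ IsStem p s := by
  constructor
  · rintro ⟨h1, h2, h3⟩
    exact ⟨⟨h1, s, h2, h3⟩, h2⟩
  · rintro ⟨⟨h1, s', h2, h3⟩, h⟩
    obtain rfl := h.unique h1 h2
    exact ⟨h1, h, h3⟩

theorem isLaverAt_of_infinite {p : Set Node} {s : Node} (hT : IsTree p) (hs : s ∈ p)
    (hc : ∀ t ∈ p, t <+: s ∨ s <+: t) (h : ∀ t ∈ p, s <+: t → (succs p t).Infinite) :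
    IsLaverAt p s :=
  ⟨hT, ⟨hs, (h s hs List.prefix_rfl).nontrivial, hc⟩, h⟩

section

variable {p : Set Node} {σ : Node} (hp : IsLaverAt p σ)
include hp

theorem IsLaverAt.isCond : IsCond .laver p := (isLaverAt_iff.1 hp).1

theorem IsLaverAt.mem_spl_iff {s : Node} : s ∈ spl p ↔ s ∈ p ∧ σ <+: s := by
  constructor
  · intro hs
    refine ⟨hs.1, ?_⟩
    rcases hp.stem.2.2 s hs.1 with h | h
    · by_contra hcon
      have h1 := cnt_lt_of_prefix hs h (fun e => hcon (e ▸ List.prefix_rfl))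
      have h2 := hp.stem.mem_splN_zero
      rw [mem_splN] at h2
      omega
    · exact h
  · exact fun hs => ⟨hs.1, (hp.infinite s hs.1 hs.2).nontrivial⟩

end

/-- The set `A` is a bar for `p` above `s`: every branch of `p` in `W` meets `A` at or above the
level of `s`. -/
def IsBarIn (W : Set Real) (A p : Set Node) (s : Node) : Prop :=
  ∀ x ∈ W, (∀ n, initSeg x n ∈ p) → ∃ n ≥ s.length, initSeg x n ∈ A

/-- In `W` there is a Laver condition `q ⊆ p` with stem `s` for which `A` is a bar. -/
def IsGood (W : Set Real) (A p : Set Node) (s : Node) : Prop :=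
  ∃ q, nodeReal q ∈ W ∧ IsLaverAt q s ∧ q ⊆ p ∧ IsBarIn W A q s

/-- The part of `p^[t]` in which no node at or above `t` is good. -/
def badPart (W : Set Real) (A p : Set Node) (t : Node) : Set Node :=
  {v | v ∈ restr p t ∧ ∀ w, t <+: w → w <+: v → ¬ IsGood W A p w}

/-- If nodes with infinitely many good immediate successors are good, then a bad node is the stem of
a Laver condition all of whose nodes above the stem are bad. -/
theorem isLaverAt_badPart {W : Set Real} {A p : Set Node} {σ t : Node} (hp : IsLaverAt p σ)
    (hstep : ∀ v ∈ p, σ <+: v → {m | IsGood W A p (v ++ [m])}.Infinite → IsGood W A p v)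
    (ht : t ∈ p) (hσ : σ <+: t) (hbad : ¬ IsGood W A p t) :
    IsLaverAt (badPart W A p t) t := by
  have hmem : t ∈ badPart W A p t := ⟨⟨ht, Or.inl List.prefix_rfl⟩, fun w h1 h2 =>
    prefix_antisymm h1 h2 ▸ hbad⟩
  refine isLaverAt_of_infinite (isTree_of_prefix (fun u v hv huv =>
    ⟨(isTree_restr hp.isTree ht).mem_of_prefix hv.1 huv, fun w h1 h2 =>
      hv.2 w h1 (h2.trans huv)⟩) ⟨t, hmem⟩) hmem (fun v hv => hv.1.2) fun v hv htv => ?_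
  have hfin : {m | IsGood W A p (v ++ [m])}.Finite := by
    by_contra hcon
    exact hv.2 v htv List.prefix_rfl (hstep v hv.1.1 (hσ.trans htv) hcon)
  refine ((hp.infinite v hv.1.1 (hσ.trans htv)).sdiff hfin).mono fun m hm => ?_
  refine ⟨⟨hm.1, Or.inr (htv.trans (List.prefix_append _ _))⟩, fun w h1 h2 => ?_⟩
  rcases prefix_snoc_iff.1 h2 with rfl | h2
  · exact hm.2
  · exact hv.2 w h1 h2

section

variable {t : Node} {S : Set ℕ} {b : Node → Set Node}
  (hb : ∀ m ∈ S, IsLaverAt (b (t ++ [m])) (t ++ [m]))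
include hb

theorem isAmalgam_snoc (hS : S.Infinite) : IsAmalgam {u | ∃ m ∈ S, u = t ++ [m]} b where
  nonempty := let ⟨m, hm⟩ := hS.nonempty; ⟨_, m, hm, rfl⟩
  antichain := by
    rintro _ ⟨m, -, rfl⟩ _ ⟨k, -, rfl⟩ h
    exact h.eq_of_length (by simp)
  isTree := by
    rintro _ ⟨m, hm, rfl⟩
    exact (hb m hm).isTree
  self_mem := by
    rintro _ ⟨m, hm, rfl⟩
    exact (hb m hm).stem.1
  comparable := by
    rintro _ ⟨m, hm, rfl⟩
    exact (hb m hm).stem.2.2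

theorem isLaverAt_amalg_snoc (hS : S.Infinite) :
    IsLaverAt (amalg {u | ∃ m ∈ S, u = t ++ [m]} b) t := by
  have hA := isAmalgam_snoc hb hS
  have hsnoc : ∀ m ∈ S, t ++ [m] ∈ amalg {u | ∃ m ∈ S, u = t ++ [m]} b := fun m hm =>
    hA.subset ⟨m, hm, rfl⟩
  obtain ⟨m₀, hm₀⟩ := hS.nonempty
  refine isLaverAt_of_infinite hA.isTree_amalg
    (hA.isTree_amalg.mem_of_prefix (hsnoc m₀ hm₀) (List.prefix_append _ _)) ?_ ?_
  · rintro v ⟨_, ⟨m, hm, rfl⟩, hv⟩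
    rcases (hb m hm).stem.2.2 v hv with h | h
    · exact prefix_total h (List.prefix_append _ _)
    · exact Or.inr ((List.prefix_append _ _).trans h)
  · rintro v ⟨_, ⟨m, hm, rfl⟩, hv⟩ htv
    by_cases e : v = t
    · subst e
      exact hS.mono hsnoc
    · have h : t ++ [m] <+: v := by
        rcases (hb m hm).stem.2.2 v hv with h | h
        · rcases prefix_snoc_iff.1 h with rfl | h
          · exact List.prefix_rfl
          · exact absurd (prefix_antisymm h htv) e
        · exact h
      rw [hA.succs_eq ⟨m, hm, rfl⟩ h]
      exact (hb m hm).infinite v hv h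

theorem isBarIn_amalg_snoc {W : Set Real} {A : Set Node} (hS : S.Infinite)
    (hbar : ∀ m ∈ S, IsBarIn W A (b (t ++ [m])) (t ++ [m])) :
    IsBarIn W A (amalg {u | ∃ m ∈ S, u = t ++ [m]} b) t := by
  have hA := isAmalgam_snoc hb hS
  intro x hxW hx
  obtain ⟨_, ⟨m, hm, rfl⟩, hv⟩ := hx (t.length + 1)
  have he : initSeg x (t.length + 1) = t ++ [m] := by
    rcases (hb m hm).stem.2.2 _ hv with h | h
    · exact h.eq_of_length (by simp)
    · exact (h.eq_of_length (by simp)).symm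
  have hbr : ∀ n, initSeg x n ∈ b (t ++ [m]) := by
    have key : ∀ n ≥ t.length + 1, initSeg x n ∈ b (t ++ [m]) := by
      intro n hn
      rw [← hA.restr_eq ⟨m, hm, rfl⟩]
      exact ⟨hx n, Or.inr (he ▸ initSeg_prefix x hn)⟩
    intro n
    exact (hb m hm).isTree.mem_of_prefix (key _ (le_max_right n _))
      (initSeg_prefix x (le_max_left n _))
  obtain ⟨n, hn, hA'⟩ := hbar m hm x hxW hbr
  simp only [List.length_append, List.length_singleton] at hn
  exact ⟨n, by omega, hA'⟩

end

/-! ### Strengthening a Laver condition along a bar -/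

/-- The minimal nodes of `A` in the trees `b s`, where `s` runs through the `n`-th splitting
level of `p`. -/
def barFront (A p : Set Node) (n : ℕ) (b : Node → Set Node) : Set Node :=
  {u | u ∈ A ∧ ∃ s, s ∈ splN p n ∧ s <+: u ∧ u ∈ b s ∧
    ∀ v, s <+: v → v <+: u → v ≠ u → v ∉ A}

/-- The data for strengthening the Laver condition `p`: above each node `s` of the `n`-th splitting
level a condition `b s` for which `A` is a bar, and for `u ∈ A` a condition `d u` with stem `u`.
As bars refer to the branches in `W`, the trees `b s` need enough branches in `W`. -/
structure IsBarSystem (W : Set Real) (A p : Set Node) (σ : Node) (n : ℕ)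
    (b d : Node → Set Node) : Prop where
  laver : IsLaverAt p σ
  b_laver : ∀ s ∈ splN p n, IsLaverAt (b s) s
  b_bar : ∀ s ∈ splN p n, IsBarIn W A (b s) s
  b_branch : ∀ s ∈ splN p n, ∀ v ∈ b s, ∃ x ∈ W, (∀ k, initSeg x k ∈ b s) ∧
    initSeg x v.length = v
  d_laver : ∀ u ∈ A, IsLaverAt (d u) u
  d_subset : ∀ u ∈ A, d u ⊆ p

section

variable {W : Set Real} {A p : Set Node} {σ : Node} {n : ℕ} {b d : Node → Set Node}
  (h : IsBarSystem W A p σ n b d)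
include h

/-- A branch of `b s` passes through the front, at its first node in `A` above `s`. -/
theorem IsBarSystem.exists_barFront_of_branch {x : Real} (hxW : x ∈ W) {s : Node}
    (hs : s ∈ splN p n) (hx : ∀ k, initSeg x k ∈ b s) : ∃ k, initSeg x k ∈ barFront A p n b ∧
      s <+: initSeg x k ∧ ∀ v, s <+: v → v <+: initSeg x k → v ≠ initSeg x k → v ∉ A := by
  classical
  have hex := h.b_bar s hs x hxW hx
  have hsx : initSeg x s.length = s := by
    rcases (h.b_laver s hs).stem.2.2 _ (hx s.length) with h1 | h1
    · exact h1.eq_of_length (by simp)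
    · exact (h1.eq_of_length (by simp)).symm
  obtain ⟨h1, h2⟩ := Nat.find_spec hex
  have h3 : s <+: initSeg x (Nat.find hex) := by
    have := initSeg_prefix x h1
    rwa [hsx] at this
  have h4 : ∀ v, s <+: v → v <+: initSeg x (Nat.find hex) → v ≠ initSeg x (Nat.find hex) →
      v ∉ A := by
    intro v hsv hv hne hvA
    have hl : v.length < Nat.find hex := by
      refine lt_of_le_of_ne (by simpa using hv.length_le) fun e => hne ?_
      exact hv.eq_of_length (by simpa using e)
    exact Nat.find_min hex hl ⟨hsv.length_le, prefix_initSeg hv ▸ hvA⟩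
  exact ⟨_, ⟨h2, s, hs, h3, hx _, h4⟩, h3, h4⟩

/-- A node of `b s` with no earlier node in `A` is extended by a node of the front, as it lies on a
branch. -/
theorem IsBarSystem.exists_barFront {s v : Node} (hs : s ∈ splN p n) (hv : v ∈ b s)
    (hvA : ∀ w, s <+: w → w <+: v → w ≠ v → w ∉ A) :
    ∃ u ∈ barFront A p n b, v <+: u := by
  obtain ⟨x, hxW, hx, hxv⟩ := h.b_branch s hs v hv
  obtain ⟨k, hk, hsk, hmin⟩ := h.exists_barFront_of_branch hxW hs hx
  refine ⟨_, hk, ?_⟩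
  rw [← hxv]
  by_cases hle : v.length ≤ k
  · exact initSeg_prefix x hle
  · have hkv : initSeg x k <+: v := by
      have := initSeg_prefix x (le_of_not_ge hle)
      rwa [hxv] at this
    refine absurd hk.1 (hvA _ hsk hkv fun e => hle ?_)
    simp [← e]

theorem IsBarSystem.isAmalgam : IsAmalgam (barFront A p n b) d where
  nonempty := by
    obtain ⟨s, hs, -⟩ := h.laver.isCond.exists_mem_splN subset_rfl n
    obtain ⟨u, hu, -⟩ := h.exists_barFront hs (h.b_laver s hs).stem.1
      fun w h1 h2 h3 => absurd (prefix_antisymm h2 h1) h3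
    exact ⟨u, hu⟩
  antichain := by
    rintro u ⟨huA, s, hs, hsu, -, -⟩ u' ⟨-, s', hs', hsu', -, hmin⟩ huu'
    have hss : s = s' := by
      rcases prefix_total (hsu.trans huu') hsu' with h' | h'
      · exact splN_antichain hs hs' h'
      · exact (splN_antichain hs' hs h').symm
    by_contra hne
    exact hmin u (hss ▸ hsu) huu' hne huA
  isTree u hu := (h.d_laver u hu.1).isTree
  self_mem u hu := (h.d_laver u hu.1).stem.1
  comparable u hu := (h.d_laver u hu.1).stem.2.2

theorem IsBarSystem.amalg_subset : amalg (barFront A p n b) d ⊆ p :=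
  fun _ ⟨u, hu, hv⟩ => h.d_subset u hu.1 hv

theorem IsBarSystem.mem_amalg {v : Node} (hv : v ∈ p) (hn : cnt p v ≤ n) :
    v ∈ amalg (barFront A p n b) d := by
  obtain ⟨s, hs, hvs⟩ := h.laver.isCond.hasSplitting.exists_splN hv hn
  obtain ⟨u, hu, hsu⟩ := h.exists_barFront hs (h.b_laver s hs).stem.1
    fun w h1 h2 h3 => absurd (prefix_antisymm h2 h1) h3
  exact h.isAmalgam.isTree_amalg.mem_of_prefix (h.isAmalgam.subset hu) (hvs.trans hsu)

/-- Above the stem, a node of the amalgam is at or beyond a node `u` of the front, or between the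
`n`-th splitting level and the front, or below the splitting level; it then inherits its immediate
successors from `d u`, `b s` and `p`, respectively. -/
theorem IsBarSystem.isLaverAt_amalg : IsLaverAt (amalg (barFront A p n b) d) σ := by
  have hA := h.isAmalgam
  refine isLaverAt_of_infinite hA.isTree_amalg (h.mem_amalg h.laver.stem.1 ?_)
    (fun v hv => h.laver.stem.2.2 v (h.amalg_subset hv)) ?_
  · have := h.laver.stem.mem_splN_zero.2
    change cnt p σ = 0 at this
    omega
  rintro v ⟨u, hu, hvu⟩ hσv
  by_cases huv : u <+: v
  · rw [hA.succs_eq hu huv]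
    exact (h.d_laver u hu.1).infinite v hvu huv
  · have hvu' := ((h.d_laver u hu.1).stem.2.2 v hvu).resolve_right huv
    have hne : v ≠ u := fun e => huv (e ▸ List.prefix_rfl)
    obtain ⟨-, s, hs, hsu, hub, hmin⟩ := id hu
    by_cases hsv : s <+: v
    · have hvb := (h.b_laver s hs).isTree.mem_of_prefix hub hvu'
      refine ((h.b_laver s hs).infinite v hvb hsv).mono fun m hm => ?_
      have hminm : ∀ w, s <+: w → w <+: v ++ [m] → w ≠ v ++ [m] → w ∉ A := by
        intro w h1 h2 h3
        have h2' := (prefix_snoc_iff.1 h2).resolve_left h3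
        exact hmin w h1 (h2'.trans hvu') fun e => hne (prefix_antisymm hvu' (e ▸ h2'))
      obtain ⟨u', hu', hmu⟩ := h.exists_barFront hs hm hminm
      exact hA.isTree_amalg.mem_of_prefix (hA.subset hu') hmu
    · have hvs := (prefix_total hvu' hsu).resolve_right hsv
      have hvp := h.laver.isTree.mem_of_prefix hs.1.1 hvs
      refine (h.laver.infinite v hvp hσv).mono fun m hm => h.mem_amalg hm ?_
      exact cnt_snoc_le_of_prefix hs hvs fun e => hsv (e ▸ List.prefix_rfl)

/-- Above the stem all nodes of `p` and of the amalgam split, so splitting levels are the same where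
the nodes are. -/
theorem IsBarSystem.leN : LeN n (amalg (barFront A p n b) d) p := by
  refine ⟨h.amalg_subset, ?_⟩
  have hspl : ∀ v, v ∈ amalg (barFront A p n b) d →
      (v ∈ spl (amalg (barFront A p n b) d) ↔ v ∈ spl p) := by
    intro v hv
    rw [h.isLaverAt_amalg.mem_spl_iff, h.laver.mem_spl_iff]
    simp [hv, h.amalg_subset hv]
  have hcnt : ∀ v ∈ amalg (barFront A p n b) d, cnt (amalg (barFront A p n b) d) v = cnt p v := by
    intro v hv
    refine congrArg Set.ncard (Set.ext fun w => ?_)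
    constructor
    · exact fun hw => ⟨spl_mono h.amalg_subset hw.1, hw.2⟩
    · exact fun hw => ⟨(hspl w (h.isAmalgam.isTree_amalg.mem_of_prefix hv hw.2.1)).2 hw.1, hw.2⟩
  ext v
  rw [mem_splN, mem_splN]
  constructor
  · rintro ⟨h1, h2⟩
    exact ⟨(hspl v h1.1).1 h1, by rw [← hcnt v h1.1, h2]⟩
  · rintro ⟨h1, h2⟩
    have hv := h.mem_amalg h1.1 h2.le
    exact ⟨(hspl v hv).2 h1, by rw [hcnt v hv, h2]⟩

theorem IsBarSystem.front : FrontIn W (barFront A p n b) (amalg (barFront A p n b) d) := by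
  have hA := h.isAmalgam
  refine ⟨hA.subset, hA.antichain, fun x hxW hx => ?_⟩
  have hp := h.laver.isCond
  obtain ⟨k, hk⟩ := hp.hasSplitting.exists_splN_initSeg hp.isTree
    (fun j => h.amalg_subset (hx j)) n
  by_contra hcon
  push Not at hcon
  -- a branch that avoids the front stays in the tree `b (x ↾ k)`
  have key : ∀ j ≥ k, initSeg x j ∈ b (initSeg x k) := by
    intro j hj
    obtain ⟨u, hu, hv⟩ := hx j
    rcases (h.d_laver u hu.1).stem.2.2 _ hv with h1 | h1
    · obtain ⟨-, s, hs, hsu, hub, -⟩ := id hu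
      have hss : initSeg x k = s := by
        rcases prefix_total ((initSeg_prefix x hj).trans h1) hsu with h' | h'
        · exact splN_antichain hk hs h'
        · exact (splN_antichain hs hk h').symm
      rw [hss]
      exact (h.b_laver s hs).isTree.mem_of_prefix hub h1
    · exact absurd (prefix_initSeg h1 ▸ hu) (hcon _)
  have hbr : ∀ j, initSeg x j ∈ b (initSeg x k) := fun j =>
    (h.b_laver _ hk).isTree.mem_of_prefix (key _ (le_max_right j k))
      (initSeg_prefix x (le_max_left j k))
  obtain ⟨i, hi, -⟩ := h.exists_barFront_of_branch hxW hk hbr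
  exact hcon i hi

end

/-! ### Tree predicates are arithmetical -/

section

variable {W : Set Real} {γ δ ε : Type} [Denumerable γ] [Denumerable δ] [Denumerable ε]

theorem Fn.proj₁ (hW : ArithClosed W) {f : γ → δ × ε} (hf : Fn W f) : Fn W (fun c => (f c).1) :=
  Fn.comp hW (Fn.fst hW) hf

theorem Fn.proj₂ (hW : ArithClosed W) {f : γ → δ × ε} (hf : Fn W f) : Fn W (fun c => (f c).2) :=
  Fn.comp hW (Fn.snd hW) hf

theorem Fn.encode_comp (hW : ArithClosed W) {f : γ → δ} (hf : Fn W f) :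
    Fn W (fun c => Encodable.encode (f c)) :=
  Fn.comp hW (Fn.encode hW) hf

theorem Pr.mem (hW : ArithClosed W) {A : Set Node} (hA : nodeReal A ∈ W) {f : γ → Node}
    (hf : Fn W f) : Pr W (fun c => f c ∈ A) :=
  Pr.comp hW (nodeReal_mem_iff.1 hA) hf

end

/-- A family of sets of nodes whose membership relation is arithmetical. -/
def IsArithTree (A : Real → Set Node) : Prop := IsArith (fun (s : Node) x => s ∈ A x)

theorem IsArithTree.mem {γ : Type} [Denumerable γ] {A : Real → Set Node} (hA : IsArithTree A)
    {f : γ → Node} (hf : IsFixedFn f) : IsArith (fun c x => f c ∈ A x) :=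
  IsArith.reindex hA hf

theorem isArithTree_treeOf : IsArithTree treeOf :=
  IsArith.eval (fun _ hW => Fn.encode hW) (fun _ hW => Fn.const hW 1)

theorem IsArithTree.precomp {A : Real → Set Node} (hA : IsArithTree A) {F : Real → Real}
    (hF : Continuous F) (hFW : ∀ W, ArithClosed W → ∀ x ∈ W, F x ∈ W) :
    IsArithTree (fun x => A (F x)) :=
  IsArith.precomp hA hF hFW

theorem nontrivial_succs_iff {p : Set Node} {s : Node} : (succs p s).Nontrivial ↔
    ∃ m n : ℕ, ¬ m = n ∧ s ++ [m] ∈ p ∧ s ++ [n] ∈ p :=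
  ⟨fun ⟨m, hm, n, hn, h⟩ => ⟨m, n, h, hm, hn⟩, fun ⟨m, n, h, hm, hn⟩ => ⟨m, hm, n, hn, h⟩⟩

theorem infinite_succs_iff {p : Set Node} {s : Node} : (succs p s).Infinite ↔
    ∀ m : ℕ, ∃ n : ℕ, m < n ∧ s ++ [n] ∈ p := by
  refine ⟨fun h m => ?_, fun h => ?_⟩
  · obtain ⟨n, hn, hm⟩ := h.exists_gt m
    exact ⟨n, hm, hn⟩
  · exact Set.infinite_of_not_bddAbove fun ⟨m, hm⟩ => by
      obtain ⟨n, hn, hs⟩ := h m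
      exact absurd (hm hs) (not_le.2 hn)

section

variable {A B : Real → Set Node} (hA : IsArithTree A)
include hA

theorem IsArithTree.isTree : IsArith (fun (_ : ℕ) x => IsTree (A x)) := by
  have h : IsArith (fun (_ : ℕ) x =>
      (∀ s t : Node, t ∈ A x → s <+: t → s ∈ A x) ∧ ∃ s, s ∈ A x) := by
    with_reducible repeat' (first | apply IsArith.and | apply IsArith.all | apply IsArith.ex
                                  | apply IsArith.imp | apply hA.mem | apply IsArith.const)
    all_goals
      intro W hW
      with_reducible repeat' (first | exact Fn.id hW | apply Pr.prefix hW | apply Fn.proj₁ hW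
                                    | apply Fn.proj₂ hW)
  exact h.congr fun _ x => ⟨fun h => isTree_of_prefix h.1 h.2,
    fun h => ⟨fun s t ht hst => h.mem_of_prefix ht hst, h.2⟩⟩

theorem IsArithTree.nontrivial_succs : IsArith (fun s x => (succs (A x) s).Nontrivial) := by
  refine IsArith.congr ?_ fun s x => nontrivial_succs_iff.symm
  with_reducible repeat' (first | apply IsArith.and | apply IsArith.ex | apply IsArith.not
                                | apply hA.mem | apply IsArith.const)
  all_goals
    intro W hW
    with_reducible repeat' (first | exact Fn.id hW | apply Pr.eq hW | apply Fn.snoc hW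
                                  | apply Fn.proj₁ hW | apply Fn.proj₂ hW)

theorem IsArithTree.infinite_succs : IsArith (fun s x => (succs (A x) s).Infinite) := by
  refine IsArith.congr ?_ fun s x => infinite_succs_iff.symm
  with_reducible repeat' (first | apply IsArith.and | apply IsArith.ex | apply IsArith.all
                                | apply hA.mem | apply IsArith.const)
  all_goals
    intro W hW
    with_reducible repeat' (first | exact Fn.id hW | apply Pr.lt hW | apply Fn.snoc hW
                                  | apply Fn.proj₁ hW | apply Fn.proj₂ hW)

theorem IsArithTree.isSuccSet (Q : TreeForcing) :
    IsArith (fun s x => IsSuccSet Q (succs (A x) s)) := by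
  have h1 : IsArith (fun s x => ∃! n, n ∈ succs (A x) s) := by
    have h : IsArith (fun s x => ∃ n : ℕ, s ++ [n] ∈ A x ∧ ∀ m : ℕ, s ++ [m] ∈ A x → m = n) := by
      with_reducible repeat' (first | apply IsArith.and | apply IsArith.ex | apply IsArith.all
                                    | apply IsArith.imp | apply hA.mem | apply IsArith.const)
      all_goals
        intro W hW
        with_reducible repeat' (first | exact Fn.id hW | apply Pr.eq hW | apply Fn.snoc hW
                                      | apply Fn.proj₁ hW | apply Fn.proj₂ hW)
    exact h
  have hsnoc : IsFixedFn fun c : Node × ℕ => c.1 ++ [c.2] := fun W hW => by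
    with_reducible repeat' (first | exact Fn.id hW | apply Fn.snoc hW | apply Fn.proj₁ hW
                                  | apply Fn.proj₂ hW)
  cases Q
  · exact IsArith.ex (P := fun s (n : ℕ) x => s ++ [n] ∈ A x) (hA.mem hsnoc)
  · exact h1.or hA.infinite_succs
  · refine h1.or ((IsArith.all (P := fun s (n : ℕ) x => s ++ [n] ∈ A x) (hA.mem hsnoc)).congr
      fun s x => Set.eq_univ_iff_forall.symm)
  · exact h1.or hA.infinite_succs

theorem IsArithTree.spl : IsArithTree (fun x => spl (A x)) :=
  IsArith.and hA hA.nontrivial_succs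

theorem IsArithTree.hasSplitting : IsArith (fun (_ : ℕ) x => HasSplitting (A x)) := by
  have h : IsArith (fun (_ : ℕ) x => ∀ s, s ∈ A x → ∃ t, t ∈ EffAxiomA.spl (A x) ∧ s <+: t) := by
    with_reducible repeat' (first | apply IsArith.and | apply IsArith.ex | apply IsArith.all
                                  | apply IsArith.imp | apply hA.mem | apply hA.spl.mem
                                  | apply IsArith.const)
    all_goals
      intro W hW
      with_reducible repeat' (first | exact Fn.id hW | apply Pr.prefix hW | apply Fn.proj₁ hW
                                    | apply Fn.proj₂ hW)
  exact h

theorem IsArithTree.isCond (Q : TreeForcing) : IsArith (fun (_ : ℕ) x => IsCond Q (A x)) := by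
  refine IsArith.congr ?_ fun _ x => (isCond_iff Q (A x)).symm
  have h1 : IsArith (fun (_ : ℕ) x => ∀ s, s ∈ A x → IsSuccSet Q (succs (A x) s)) :=
    IsArith.all (IsArith.imp (hA.mem fun W hW => Fn.snd hW)
      ((hA.isSuccSet Q).reindex fun W hW => Fn.snd hW))
  have h2 : IsArith (fun (_ : ℕ) x =>
      Q = .laver → ∀ s, s ∈ EffAxiomA.spl (A x) → ∀ t, t ∈ A x → s <+: t →
      t ∈ EffAxiomA.spl (A x)) := by
    with_reducible repeat' (first | apply IsArith.and | apply IsArith.ex | apply IsArith.all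
                                  | apply IsArith.imp | apply hA.mem | apply hA.spl.mem
                                  | apply IsArith.const)
    all_goals
      intro W hW
      with_reducible repeat' (first | exact Fn.id hW | apply Pr.const hW | apply Pr.prefix hW
                                    | apply Fn.proj₁ hW | apply Fn.proj₂ hW)
  exact hA.isTree.and (h1.and (hA.hasSplitting.and h2))

theorem IsArithTree.le_cnt (n : ℕ) : IsArith (fun s x => n ≤ cnt (A x) s) := by
  induction n with
  | zero =>
    exact (IsArith.const (P := fun _ => True) fun W hW => Pr.const hW _).congr fun s x => by simp
  | succ n ih =>
    refine IsArith.congr ?_ fun s x => succ_le_cnt_iff.symm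
    have hi : IsArith (fun (c : Node × Node) x => n ≤ cnt (A x) c.2) :=
      ih.reindex fun W hW => Fn.snd hW
    with_reducible repeat' (first | apply IsArith.and | apply IsArith.ex | apply IsArith.not
                                  | apply hA.spl.mem | apply hi | apply IsArith.const)
    all_goals
      intro W hW
      with_reducible repeat' (first | exact Fn.id hW | apply Pr.not hW | apply Pr.eq hW
                                    | apply Pr.prefix hW | apply Fn.proj₁ hW | apply Fn.proj₂ hW)

theorem IsArithTree.splN (n : ℕ) : IsArithTree (fun x => splN (A x) n) :=
  (IsArith.and hA.spl ((hA.le_cnt n).and (hA.le_cnt (n + 1)).not)).congr fun s x => by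
    rw [mem_splN]
    exact and_congr_right fun _ => by omega

theorem IsArithTree.subset (hB : IsArithTree B) : IsArith (fun (_ : ℕ) x => A x ⊆ B x) :=
  IsArith.all (P := fun _ s x => s ∈ A x → s ∈ B x)
    (IsArith.imp (hA.mem fun _ hW => Fn.snd hW) (hB.mem fun _ hW => Fn.snd hW))

theorem IsArithTree.leN (hB : IsArithTree B) (n : ℕ) :
    IsArith (fun (_ : ℕ) x => LeN n (A x) (B x)) :=
  (hA.subset hB).and ((((hA.splN n).subset (hB.splN n)).and
    ((hB.splN n).subset (hA.splN n))).congr fun _ _ => Set.Subset.antisymm_iff.symm)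

end

/-! ### Codes of the relations of the four forcings -/

/-- The first component of a pair of reals. -/
def evenPart (x : Real) : Real := fun k => x (2 * k)

/-- The second component of a pair of reals. -/
def oddPart (x : Real) : Real := fun k => x (2 * k + 1)

@[simp] theorem evenPart_joinPair (x y : Real) : evenPart (joinPair x y) = x :=
  funext fun k => joinPair_even x y k

@[simp] theorem oddPart_joinPair (x y : Real) : oddPart (joinPair x y) = y :=
  funext fun k => joinPair_odd x y k

theorem evenPart_mem {W : Set Real} (hW : ArithClosed W) {x : Real} (hx : x ∈ W) :
    evenPart x ∈ W :=
  Fn.real (γ := ℕ) hW hx (Fn.two_mul hW (Fn.id hW))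

theorem oddPart_mem {W : Set Real} (hW : ArithClosed W) {x : Real} (hx : x ∈ W) :
    oddPart x ∈ W :=
  Fn.real (γ := ℕ) hW hx (Fn.succ hW (Fn.two_mul hW (Fn.id hW)))

theorem codeAt_mem {W : Set Real} (hW : ArithClosed W) {x : Real} (hx : x ∈ W) (j : ℕ) :
    codeAt x j ∈ W :=
  Fn.real (γ := ℕ) hW hx (Fn.natPair hW (Fn.const hW j) (Fn.id hW))

theorem continuous_evenPart : Continuous evenPart := continuous_precomp _

theorem continuous_oddPart : Continuous oddPart := continuous_precomp _

theorem continuous_codeAt (j : ℕ) : Continuous fun x => codeAt x j := continuous_precomp _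

@[simp] theorem codeAt_joinSeq (a : ℕ → Real) (j : ℕ) : codeAt (joinSeq a) j = a j := by
  funext k
  simp [codeAt, joinSeq]

/-- Predicates with witnesses are `Σ¹₂`, with a vacuous second quantifier. -/
theorem exists_sigma12_code_of_hasWitness {P : Real → Prop}
    (h : HasWitness (fun (_ : ℕ) x => P x)) :
    ∃ c : Real, ∀ W, ArithClosed W → ∀ x ∈ W, (Sigma12 c W x ↔ P x) := by
  obtain ⟨c, hc⟩ := exists_sigma12_code (h.precomp continuous_evenPart
    fun W hW x hx => evenPart_mem hW hx) isClosed_empty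
  refine ⟨c, fun W hW x hx => (hc W hW x hx).trans ?_⟩
  simp only [evenPart_joinPair, Set.mem_empty_iff_false, not_false_eq_true, implies_true, and_true]
  exact ⟨fun ⟨_, _, h⟩ => h, fun h => ⟨x, hx, h⟩⟩

/-- The first `ω` coordinates of the `(ω+1)`-tuple coded by `x`, as trees. -/
def seqPart (x : Real) (i : ℕ) : Set Node := treeOf (codeAt x (i + 1))

/-- The tree in the last coordinate of the `(ω+1)`-tuple coded by `x`. -/
def topPart (x : Real) : Set Node := treeOf (codeAt x 0)

/-- `E` is a `Σ¹₂` relation, with one code for all arithmetically closed sets of reals. -/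
def HasSigma12Code (E : EpdRel) : Prop :=
  ∃ c : Real, ∀ W, ArithClosed W → ∀ x ∈ W, (Sigma12 c W x ↔ E W (seqPart x) (topPart x))

/-- Effectively predense, through fronts: there is a front `F` in `p` such that every `p^[t]`,
`t ∈ F`, is contained in one of the `b i`. Unlike `epdFront`, this passes to stronger conditions. -/
def epdSub : EpdRel := fun W b p =>
  ∃ F : Set Node, nodeReal F ∈ W ∧ FrontIn W F p ∧ ∀ t ∈ F, ∃ i, restr p t ⊆ b i

theorem isArithTree_topPart : IsArithTree topPart :=
  isArithTree_treeOf.precomp (continuous_codeAt 0) fun _ hW _ hx => codeAt_mem hW hx 0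

theorem isArith_mem_seqPart {γ : Type} [Denumerable γ] {f : γ → Node} {g : γ → ℕ}
    (hf : IsFixedFn f) (hg : IsFixedFn g) : IsArith (fun c x => f c ∈ seqPart x (g c)) :=
  IsArith.eval (f := fun c => Nat.pair (g c + 1) (Encodable.encode (f c)))
    (fun W hW => Fn.natPair hW (Fn.succ hW (hg W hW)) (Fn.encode_comp hW (hf W hW)))
    (fun _ hW => Fn.const hW 1)

theorem isClosed_branch {X : Type} [TopologicalSpace X] {F z : X → Real} (hF : Continuous F)
    (hz : Continuous z) (k : ℕ) :
    IsClosed {p | ∀ n, initSeg (z p) n ∈ treeOf (F p) ↔ k = 1} := by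
  rw [Set.ofPred_forall]
  refine isClosed_iInter fun n => ?_
  have h1 := continuous_initSeg hz n Encodable.encode
  have h2 : ∀ m, IsClosed {p | F p m = 1 ↔ k = 1} := fun m => by
    have : Continuous fun p => F p m := (continuous_apply m).comp hF
    exact ((isClopen_discrete {v : ℕ | v = 1 ↔ k = 1}).preimage this).isClosed
  exact isClosed_switch h1 h2

/-- Fronts are the only source of the second real quantifier: the front is guessed, its other
properties are arithmetical, and the branches that avoid it form a closed set. -/
theorem hasSigma12Code_of_front {R : Real → Node → ℕ → Prop} {P : EpdRel}
    (hR : IsArith (fun (c : Node × ℕ) x => R x c.1 c.2))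
    (hP : ∀ W x, P W (seqPart x) (topPart x) ↔ ∃ F : Set Node, nodeReal F ∈ W ∧
      FrontIn W F (topPart x) ∧ ∀ t ∈ F, ∃ i, R x t i) : HasSigma12Code P := by
  let A : Real → Prop := fun z => treeOf (oddPart z) ⊆ topPart (evenPart z) ∧
    (∀ s, s ∈ treeOf (oddPart z) → ∀ t, t ∈ treeOf (oddPart z) → s <+: t → s = t) ∧
    ∀ t, t ∈ treeOf (oddPart z) → ∃ i, R (evenPart z) t i
  let C : Set (Real × Real × Real) := {q | (∀ n, initSeg q.2.2 n ∈ treeOf (codeAt q.1 0)) ∧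
    ∀ n, initSeg q.2.2 n ∉ treeOf q.2.1}
  have hodd : IsArithTree fun z => treeOf (oddPart z) :=
    isArithTree_treeOf.precomp continuous_oddPart fun _ hW _ hx => oddPart_mem hW hx
  have htop : IsArithTree fun z => topPart (evenPart z) :=
    isArithTree_topPart.precomp continuous_evenPart fun _ hW _ hx => evenPart_mem hW hx
  have hA : IsArith (fun (_ : ℕ) z => A z) := by
    refine (hodd.subset htop).and (IsArith.and ?_ ?_)
    · with_reducible repeat' (first | apply IsArith.all | apply IsArith.imp | apply hodd.mem
                                    | apply IsArith.const)
      all_goals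
        intro W hW
        with_reducible repeat' (first | exact Fn.id hW | apply Pr.eq hW | apply Pr.prefix hW
                                      | apply Fn.proj₁ hW | apply Fn.proj₂ hW)
    · have h : IsArith (fun (c : Node × ℕ) x => R (evenPart x) c.1 c.2) :=
        hR.precomp continuous_evenPart fun _ hW _ hx => evenPart_mem hW hx
      refine IsArith.all (IsArith.imp (hodd.mem fun W hW => Fn.snd hW) (IsArith.ex ?_))
      exact h.reindex (f := fun c : (ℕ × Node) × ℕ => (c.1.2, c.2)) fun W hW =>
        Fn.pair hW (Fn.proj₂ hW (Fn.fst hW)) (Fn.snd hW)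
  have hC : IsClosed C := by
    have h1 := isClosed_branch (F := fun q : Real × Real × Real => codeAt q.1 0)
      (z := fun q => q.2.2) ((continuous_codeAt 0).comp continuous_fst)
      (continuous_snd.comp continuous_snd) 1
    have h2 := isClosed_branch (F := fun q : Real × Real × Real => q.2.1)
      (z := fun q => q.2.2) (continuous_fst.comp continuous_snd)
      (continuous_snd.comp continuous_snd) 0
    have := h1.inter h2
    simp only [iff_true, zero_ne_one, iff_false] at this
    exact this
  obtain ⟨c, hc⟩ := exists_sigma12_code hA.pos hC
  refine ⟨c, fun W hW x hx => (hc W hW x hx).trans ?_⟩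
  rw [hP]
  have key : ∀ y, (A (joinPair x y) ∧ ∀ z ∈ W, (x, y, z) ∉ C) ↔
      FrontIn W (treeOf y) (topPart x) ∧ ∀ t ∈ treeOf y, ∃ i, R x t i := by
    intro y
    simp only [A, C, evenPart_joinPair, oddPart_joinPair, Set.mem_ofPred_eq, not_and, FrontIn]
    push Not
    exact ⟨fun ⟨⟨h1, h2, h3⟩, h4⟩ => ⟨⟨h1, h2, h4⟩, h3⟩, fun ⟨⟨h1, h2, h4⟩, h3⟩ =>
      ⟨⟨h1, h2, h3⟩, h4⟩⟩
  simp only [key]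
  constructor
  · rintro ⟨y, hy, h⟩
    exact ⟨treeOf y, nodeReal_mem_iff.2 (Pr.mem_treeOf hW hy (Fn.id hW)), h⟩
  · rintro ⟨F, hF, h⟩
    exact ⟨nodeReal F, hF, by simpa using h⟩

theorem hasSigma12Code_epdFront : HasSigma12Code epdFront := by
  refine hasSigma12Code_of_front (R := fun x t i => ∀ s, s ∈ seqPart x i ↔
    (s ∈ topPart x ∧ (s <+: t ∨ t <+: s))) ?_ fun W x => ?_
  · with_reducible repeat' (first | apply IsArith.all | apply IsArith.iff | apply IsArith.and
                                  | apply isArithTree_topPart.mem | apply isArith_mem_seqPart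
                                  | apply IsArith.const)
    all_goals
      intro W hW
      with_reducible repeat' (first | exact Fn.id hW | apply Pr.or hW | apply Pr.prefix hW
                                    | apply Fn.proj₁ hW | apply Fn.proj₂ hW)
  · simp only [epdFront, Set.ext_iff, mem_restr]

theorem hasSigma12Code_epdSub : HasSigma12Code epdSub := by
  refine hasSigma12Code_of_front (R := fun x t i => ∀ s,
    (s ∈ topPart x ∧ (s <+: t ∨ t <+: s)) → s ∈ seqPart x i) ?_ fun W x => Iff.rfl
  with_reducible repeat' (first | apply IsArith.all | apply IsArith.imp | apply IsArith.and
                                | apply isArithTree_topPart.mem | apply isArith_mem_seqPart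
                                | apply IsArith.const)
  all_goals
    intro W hW
    with_reducible repeat' (first | exact Fn.id hW | apply Pr.or hW | apply Pr.prefix hW
                                  | apply Fn.proj₁ hW | apply Fn.proj₂ hW)

theorem hasSigma12Code_epdSplit : HasSigma12Code epdSplit := by
  refine exists_sigma12_code_of_hasWitness (P := fun x => epdSplit Set.univ (seqPart x) (topPart x))
    ?_
  refine HasWitness.iUnion_nat fun n => ?_
  have h : IsArith (fun (_ : ℕ) x => ∀ t, t ∈ splN (topPart x) n → ∃ i : ℕ, ∀ s,
      s ∈ seqPart x i ↔ (s ∈ topPart x ∧ (s <+: t ∨ t <+: s))) := by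
    with_reducible repeat' (first | apply IsArith.all | apply IsArith.ex | apply IsArith.imp
                                  | apply IsArith.iff | apply IsArith.and
                                  | apply isArithTree_topPart.mem
                                  | apply (isArithTree_topPart.splN n).mem
                                  | apply isArith_mem_seqPart | apply IsArith.const)
    all_goals
      intro W hW
      with_reducible repeat' (first | exact Fn.id hW | apply Pr.or hW | apply Pr.prefix hW
                                    | apply Fn.proj₁ hW | apply Fn.proj₂ hW)
  exact h.pos.congr fun _ x => by simp only [Set.ext_iff, mem_restr]

/-- The relations of the forcing `Q` as coded relations: `0` codes the conditions, `1` the order,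
`2` the relation `E`, and `n + 3` the relation `≤_n`. -/
structure IsCodeOf (Q : TreeForcing) (E : EpdRel) (c : ℕ → Real) : Prop where
  cond : ∀ W, ArithClosed W → ∀ x ∈ W, (Sigma11 (c 0) W x ↔ ∃ p, IsCond Q p ∧ nodeReal p = x)
  le : ∀ W, ArithClosed W → ∀ x ∈ W,
    (Sigma11 (c 1) W x ↔ treeOf (evenPart x) ⊆ treeOf (oddPart x))
  epd : ∀ W, ArithClosed W → ∀ x ∈ W, (Sigma12 (c 2) W x ↔ E W (seqPart x) (topPart x))
  leN : ∀ n W, ArithClosed W → ∀ x ∈ W,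
    (Sigma12 (c (n + 3)) W x ↔ LeN n (treeOf (evenPart x)) (treeOf (oddPart x)))

/-- Being the real of a condition is arithmetical. -/
theorem isArith_nodeReal (Q : TreeForcing) :
    IsArith (fun (_ : ℕ) x => ∃ p, IsCond Q p ∧ nodeReal p = x) := by
  have h1 : IsArith (fun (_ : ℕ) x => ∀ k : ℕ, x k = 0 ∨ x k = 1) :=
    IsArith.all (P := fun (_ : ℕ) (k : ℕ) x => x k = 0 ∨ x k = 1)
      (IsArith.or (IsArith.eval (fun W hW => Fn.snd hW) fun W hW => Fn.const hW 0)
        (IsArith.eval (fun W hW => Fn.snd hW) fun W hW => Fn.const hW 1))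
  refine ((isArithTree_treeOf.isCond Q).and h1).congr fun _ x => ?_
  constructor
  · rintro ⟨h, h'⟩
    exact ⟨treeOf x, h, nodeReal_treeOf h'⟩
  · rintro ⟨p, hp, rfl⟩
    refine ⟨by rwa [treeOf_nodeReal], fun k => ?_⟩
    unfold nodeReal
    split <;> simp

theorem exists_isCodeOf (Q : TreeForcing) {E : EpdRel} (hE : HasSigma12Code E) :
    ∃ c, IsCodeOf Q E c := by
  have heven : IsArithTree fun z => treeOf (evenPart z) :=
    isArithTree_treeOf.precomp continuous_evenPart fun _ hW _ hx => evenPart_mem hW hx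
  have hodd : IsArithTree fun z => treeOf (oddPart z) :=
    isArithTree_treeOf.precomp continuous_oddPart fun _ hW _ hx => oddPart_mem hW hx
  obtain ⟨c0, h0⟩ := exists_sigma11_code (isArith_nodeReal Q).pos
  obtain ⟨c1, h1⟩ := exists_sigma11_code (heven.subset hodd).pos
  obtain ⟨c2, h2⟩ := hE
  have h3 := fun n => exists_sigma12_code_of_hasWitness (heven.leN hodd n).pos
  choose c3 h3 using h3
  exact ⟨fun j => match j with
    | 0 => c0
    | 1 => c1
    | 2 => c2
    | n + 3 => c3 n, h0, h1, h2, h3⟩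

/-! ### Branches in arithmetically closed sets of reals -/

/-- The nodes comparable with `u` that follow the function `f` above `u`. -/
def followSet (f : Node → ℕ) (u : Node) : Set Node := {v | v <+: u ∨ (u <+: v ∧
  ∀ w : Node, ∀ j : ℕ, u <+: w → w ++ [j] <+: v → j = f w)}

section

variable {f : Node → ℕ} {u : Node}

theorem mem_followSet_of_prefix {v v' : Node} (hv : v ∈ followSet f u) (h : v' <+: v) :
    v' ∈ followSet f u := by
  rcases hv with hv | ⟨hv, hf⟩
  · exact Or.inl (h.trans hv)
  · rcases prefix_total h hv with h' | h'
    · exact Or.inl h'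
    · exact Or.inr ⟨h', fun w j hw hj => hf w j hw (hj.trans h)⟩

theorem followSet_unique {v v' : Node} (hv : v ∈ followSet f u) (hv' : v' ∈ followSet f u)
    (hl : v.length = v'.length) : v = v' := by
  by_contra hne
  have h1 : ¬ v <+: v' := fun h => hne (h.eq_of_length hl)
  have h2 : ¬ v' <+: v := fun h => hne (h.eq_of_length hl.symm).symm
  rcases hv with hv | ⟨hv, hf⟩ <;> rcases hv' with hv' | ⟨hv', hf'⟩
  · exact (prefix_total hv hv').elim h1 h2
  · exact h1 (hv.trans hv')
  · exact h2 (hv'.trans hv)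
  · obtain ⟨w, a, b, hab, ha, hb⟩ := exists_branching h1 h2
    have hw := prefix_of_branching hab ha hb hv hv'
    exact hab ((hf w a hw ha).trans (hf' w b hw hb).symm)

theorem exists_followSet (f : Node → ℕ) (u : Node) (n : ℕ) :
    ∃ v ∈ followSet f u, v.length = n := by
  induction n with
  | zero => exact ⟨[], Or.inl List.nil_prefix, rfl⟩
  | succ n ih =>
    obtain ⟨v, hv, rfl⟩ := ih
    by_cases h : u <+: v
    · refine ⟨v ++ [f v], Or.inr ⟨h.trans (List.prefix_append _ _), fun w j hw hj => ?_⟩, by simp⟩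
      rcases prefix_snoc_iff.1 hj with hj | hj
      · obtain ⟨rfl, hj⟩ := List.append_inj' hj rfl
        simpa using hj
      · rcases hv with hv | ⟨-, hf⟩
        · exact absurd (hj.trans (hv.trans hw)).length_le (by simp)
        · exact hf w j hw hj
    · have hvu := hv.resolve_right fun h' => h h'.1
      obtain ⟨m, hm⟩ := (eq_or_snoc_prefix hvu).resolve_left fun e => h (e ▸ List.prefix_rfl)
      exact ⟨v ++ [m], Or.inl hm, by simp⟩

end

section

variable {W : Set Real} (hW : ArithClosed W)
include hW

/-- A tree in `W` without terminal nodes above `u` has a branch through `u` in `W`: immediate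
successors are chosen by a function in `W`, and the branch is arithmetical in that function. -/
theorem exists_branch_mem {Y : Set Node} (hY : nodeReal Y ∈ W) {u : Node} (hu : u ∈ Y)
    (hstep : ∀ v ∈ Y, u <+: v → ∃ j, v ++ [j] ∈ Y) :
    ∃ x ∈ W, (∀ n ≥ u.length, initSeg x n ∈ Y) ∧ initSeg x u.length = u := by
  obtain ⟨f, hf, hfY⟩ := Fn.exists_choice hW (P := fun (v : Node) (j : ℕ) => v ++ [j] ∈ Y)
    (Pr.mem hW hY (Fn.snoc hW (Fn.fst hW) (Fn.snd hW)))
  choose v hv hvl using exists_followSet f u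
  have hvY : ∀ w : Node, w ∈ followSet f u → u <+: w → w ∈ Y := by
    intro w
    induction w using List.reverseRecOn with
    | nil =>
      intro _ h
      rwa [← List.prefix_nil.1 h]
    | append_singleton w m ih =>
      intro hw h
      rcases prefix_snoc_iff.1 h with rfl | h'
      · exact hu
      · have hwY := ih (mem_followSet_of_prefix hw (List.prefix_append _ _)) h'
        have hm : m = f w := by
          rcases hw with hw | ⟨-, hw⟩
          · exact absurd (hw.trans h').length_le (by simp)
          · exact hw w m h' List.prefix_rfl
        rw [hm]
        exact hfY w (hstep w hwY h')
  have hsucc : ∀ n, v (n + 1) = v n ++ [(v (n + 1)).getD n 0] := by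
    intro n
    have h1 : (v (n + 1)).take n = v n := followSet_unique
      (mem_followSet_of_prefix (hv _) (List.take_prefix _ _)) (hv n) (by simp [hvl])
    have hlt : n < (v (n + 1)).length := by rw [hvl]; omega
    rw [← h1, List.getD_eq_getElem _ _ hlt, List.take_append_getElem hlt]
    rw [List.take_of_length_le (by rw [hvl])]
  let x : Real := fun n => (v (n + 1)).getD n 0
  have hx : ∀ n, initSeg x n = v n := by
    intro n
    induction n with
    | zero => exact (List.eq_nil_of_length_eq_zero (hvl 0)).symm ▸ rfl
    | succ n ih => rw [initSeg_succ, ih, hsucc n]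
  have huv : v u.length = u := followSet_unique (hv _) (Or.inl List.prefix_rfl) (hvl _)
  refine ⟨x, ?_, fun n hn => ?_, by rw [hx, huv]⟩
  · have hL : Pr W (fun w : Node => w ∈ followSet f u) := by
      have h : Pr W (fun v : Node => v <+: u ∨ (u <+: v ∧
          ∀ w : Node, ∀ j : ℕ, u <+: w → w ++ [j] <+: v → j = f w)) := by
        have hf' : Fn W (fun c : (Node × Node) × ℕ => f c.1.2) :=
          Fn.comp hW hf (Fn.snd hW |> fun h => Fn.comp hW h (Fn.fst hW))
        with_reducible repeat' (first | exact Fn.id hW | exact hf' | apply Fn.proj₁ hW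
                                      | apply Fn.proj₂ hW | apply Fn.snoc hW | apply Fn.const hW
                                      | apply Pr.or hW | apply Pr.and hW | apply Pr.all hW
                                      | apply Pr.imp hW | apply Pr.prefix hW | apply Pr.eq hW)
      exact h
    have hg : Pr W (fun c : ℕ × ℕ => ∃ w : Node, w.length = c.1 ∧ w ++ [c.2] ∈ followSet f u) := by
      refine Pr.ex hW (Pr.and hW (Pr.eq hW (Fn.length hW (Fn.snd hW))
        (Fn.proj₁ hW (Fn.fst hW))) (Pr.comp hW hL (Fn.snoc hW (Fn.snd hW)
        (Fn.proj₂ hW (Fn.fst hW)))))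
    refine Fn.of_graph hW (f := x) (hg.congr fun ⟨n, m⟩ => ?_)
    constructor
    · rintro ⟨w, rfl, hw⟩
      have h := followSet_unique hw (hv (w.length + 1)) (by simp [hvl])
      rw [hsucc] at h
      exact (List.cons.inj (List.append_inj' h rfl).2).1.symm
    · intro h
      exact ⟨v n, hvl n, by rw [← h]; exact hsucc n ▸ hv _⟩
  · rw [hx]
    refine hvY _ (hv n) ?_
    rw [← huv, ← hx, ← hx]
    exact initSeg_prefix x hn

theorem exists_branch_of_hasSplitting {p : Set Node} (hp : nodeReal p ∈ W) (hT : IsTree p)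
    (h : HasSplitting p) {u : Node} (hu : u ∈ p) :
    ∃ x ∈ W, (∀ n, initSeg x n ∈ p) ∧ initSeg x u.length = u := by
  obtain ⟨x, hx, h1, h2⟩ := exists_branch_mem hW hp hu fun v hv _ => h.exists_snoc hT hv
  exact ⟨x, hx, fun n => hT.mem_of_prefix (h1 _ (le_max_right n _))
    (initSeg_prefix x (le_max_left n _)), h2⟩

theorem nodeReal_restr_mem {p : Set Node} (hp : nodeReal p ∈ W) (t : Node) :
    nodeReal (restr p t) ∈ W := by
  have h : Pr W (fun s : Node => s ∈ p ∧ (s <+: t ∨ t <+: s)) := by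
    with_reducible repeat' (first | exact Fn.id hW | apply Fn.const hW | apply Pr.or hW
                                  | apply Pr.and hW | apply Pr.mem hW hp | apply Pr.prefix hW)
  exact nodeReal_mem_iff.2 h

theorem nodeReal_splN_mem {p : Set Node} (hp : nodeReal p ∈ W) (n : ℕ) :
    nodeReal (splN p n) ∈ W := by
  have h : Pr W (fun s => s ∈ splN (treeOf (nodeReal p)) n) :=
    IsArith.pr (isArithTree_treeOf.splN n) W hW _ hp
  rw [treeOf_nodeReal] at h
  exact nodeReal_mem_iff.2 h

theorem nodeReal_amalg_mem {F : Set Node} {d : Node → Set Node} (hF : nodeReal F ∈ W)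
    (hd : Pr W (fun c : Node × Node => c.2 ∈ d c.1)) : nodeReal (amalg F d) ∈ W := by
  refine nodeReal_mem_iff.2 (Pr.ex hW (P := fun v t => t ∈ F ∧ v ∈ d t) (Pr.and hW
    (Pr.mem hW hF (Fn.snd hW)) (Pr.comp hW hd (Fn.pair hW (Fn.snd hW) (Fn.fst hW)))))

theorem joinOmega_mem {b : ℕ → Real} {p : Real} (hb : joinSeq b ∈ W) (hp : p ∈ W) :
    joinOmega b p ∈ W := by
  have h : Pr W (fun c : ℕ × ℕ => (c.1.unpair.1 = 0 ∧ p c.1.unpair.2 = c.2) ∨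
      ∃ i : ℕ, c.1.unpair.1 = i + 1 ∧ joinSeq b (Nat.pair i c.1.unpair.2) = c.2) := by
    with_reducible repeat' (first | exact Fn.id hW | apply Fn.unpairFst hW | apply Fn.unpairSnd hW
                                  | apply Fn.proj₁ hW | apply Fn.proj₂ hW | apply Fn.succ hW
                                  | apply Fn.const hW | apply Fn.real hW hb
                                  | apply Fn.real hW hp | apply Fn.natPair hW | apply Pr.or hW
                                  | apply Pr.and hW | apply Pr.ex hW | apply Pr.eq hW)
  refine Fn.of_graph hW (f := joinOmega b p) (h.congr fun ⟨k, m⟩ => ?_)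
  unfold joinOmega
  rcases hk : k.unpair.1 with _ | i
  · simp [joinSeq, hk]
  · simp [joinSeq, hk]

end

/-! ### The coded forcing in an arithmetically closed set of reals -/

theorem isCodeOf_mkParam {Q : TreeForcing} {E : EpdRel} {c : ℕ → Real} (h : IsCodeOf Q E c)
    (tab : ℕ → Real) : IsCodeOf Q E (codeAt (mkParam c tab)) where
  cond W hW x hx := (sigma11_mkParam c tab 0 W x).trans (h.cond W hW x hx)
  le W hW x hx := (sigma11_mkParam c tab 1 W x).trans (h.le W hW x hx)
  epd W hW x hx := (sigma12_mkParam c tab (by simp) W x).trans (h.epd W hW x hx)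
  leN n W hW x hx := (sigma12_mkParam c tab (by simp) W x).trans (h.leN n W hW x hx)

/-- The relation `E(b_i, p)` implies that the `b_i` are predense below `p`, in all arithmetically
closed sets of reals. -/
def IsSoundFor (Q : TreeForcing) (E : EpdRel) : Prop :=
  ∀ W, ArithClosed W → ∀ (b : ℕ → Set Node) (p : Set Node), E W b p →
    ∀ q, IsCond Q q → nodeReal q ∈ W → q ⊆ p →
      ∃ i s, IsCond Q s ∧ nodeReal s ∈ W ∧ s ⊆ q ∧ s ⊆ b i

/-- A branch of `q` meets the front at a node `t`, and then `q^[t]` is contained in some `b i`. -/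
theorem isSoundFor_epdSub (Q : TreeForcing) : IsSoundFor Q epdSub := by
  rintro W hW b p ⟨F, hF, hfront, hb⟩ q hq hqW hqp
  obtain ⟨x, hxW, hx, -⟩ := exists_branch_of_hasSplitting hW hqW hq.isTree hq.hasSplitting
    hq.nil_mem
  obtain ⟨n, hn⟩ := hfront.2.2 x hxW fun n => hqp (hx n)
  obtain ⟨i, hi⟩ := hb _ hn
  exact ⟨i, restr q (initSeg x n), isCond_restr hq (hx n), nodeReal_restr_mem hW hqW _,
    restr_subset _ _, (restr_mono hqp _).trans hi⟩

theorem epdSub_of_epdFront {W : Set Real} {b : ℕ → Set Node} {p : Set Node}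
    (h : epdFront W b p) : epdSub W b p := by
  obtain ⟨F, hF, hfront, hb⟩ := h
  exact ⟨F, hF, hfront, fun t ht => let ⟨i, hi⟩ := hb t ht; ⟨i, hi.ge⟩⟩

theorem isSoundFor_epdFront (Q : TreeForcing) : IsSoundFor Q epdFront :=
  fun W hW b p h => isSoundFor_epdSub Q W hW b p (epdSub_of_epdFront h)

/-- A condition below `p` contains a node of each splitting level of `p`. -/
theorem isSoundFor_epdSplit (Q : TreeForcing) : IsSoundFor Q epdSplit := by
  rintro W hW b p ⟨n, hb⟩ q hq hqW hqp
  obtain ⟨s, hs, hsq⟩ := hq.exists_mem_splN hqp n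
  obtain ⟨i, hi⟩ := hb s hs
  exact ⟨i, restr q s, isCond_restr hq hsq, nodeReal_restr_mem hW hqW _,
    restr_subset _ _, hi ▸ restr_mono hqp _⟩

section

variable {Q : TreeForcing} {E : EpdRel} {r : Real} (h : IsCodeOf Q E (codeAt r))
  {W : Set Real} (hW : ArithClosed W)
include h hW

theorem mem_cCond_iff {x : Real} : x ∈ cCond r W ↔ x ∈ W ∧ ∃ p, IsCond Q p ∧ nodeReal p = x :=
  and_congr_right fun hx => h.cond W hW x hx

theorem nodeReal_mem_cCond {p : Set Node} (hp : IsCond Q p) (hpW : nodeReal p ∈ W) :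
    nodeReal p ∈ cCond r W :=
  (mem_cCond_iff h hW).2 ⟨hpW, p, hp, rfl⟩

theorem cLe_nodeReal_iff {p q : Set Node} (hp : nodeReal p ∈ W) (hq : nodeReal q ∈ W) :
    cLe r W (nodeReal q) (nodeReal p) ↔ q ⊆ p := by
  refine (h.le W hW _ (joinPair_mem hW hq hp)).trans ?_
  simp

theorem cLeN_nodeReal_iff {n : ℕ} {p q : Set Node} (hp : nodeReal p ∈ W)
    (hq : nodeReal q ∈ W) : cLeN r W n (nodeReal q) (nodeReal p) ↔ LeN n q p := by
  refine (h.leN n W hW _ (joinPair_mem hW hq hp)).trans ?_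
  simp

theorem cEpd_nodeReal_iff {b : ℕ → Set Node} {p : Set Node}
    (hb : joinSeq (fun i => nodeReal (b i)) ∈ W) (hp : nodeReal p ∈ W) :
    cEpd r W (fun i => nodeReal (b i)) (nodeReal p) ↔ E W b p := by
  refine (h.epd W hW _ (joinOmega_mem hW hb hp)).trans ?_
  have h1 : seqPart (joinOmega (fun i => nodeReal (b i)) (nodeReal p)) = b := by
    funext i
    rw [seqPart, joinOmega, codeAt_joinSeq, treeOf_nodeReal]
  have h2 : topPart (joinOmega (fun i => nodeReal (b i)) (nodeReal p)) = p := by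
    rw [topPart, joinOmega, codeAt_joinSeq, treeOf_nodeReal]
  rw [h1, h2]

theorem definesOrderIn : DefinesOrderIn Q r W :=
  ⟨fun _ => mem_cCond_iff h hW, fun _ _ _ _ hp hq => cLe_nodeReal_iff h hW hp hq⟩

theorem definesAxiomAIn : DefinesAxiomAIn Q E r W :=
  ⟨fun _ _ _ _ _ hp hq => cLeN_nodeReal_iff h hW hp hq,
    fun _ _ _ _ hb hp => cEpd_nodeReal_iff h hW hb hp⟩

theorem orderIn : OrderIn r W := by
  refine ⟨fun x hx => ?_, fun x hx y hy hxy hyx => ?_, fun x hx y hy z hz hxy hyz => ?_⟩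
  · obtain ⟨hxW, p, hp, rfl⟩ := (mem_cCond_iff h hW).1 hx
    exact (cLe_nodeReal_iff h hW hxW hxW).2 subset_rfl
  · obtain ⟨hxW, p, hp, rfl⟩ := (mem_cCond_iff h hW).1 hx
    obtain ⟨hyW, q, hq, rfl⟩ := (mem_cCond_iff h hW).1 hy
    rw [((cLe_nodeReal_iff h hW hyW hxW).1 hxy).antisymm ((cLe_nodeReal_iff h hW hxW hyW).1 hyx)]
  · obtain ⟨hxW, p, hp, rfl⟩ := (mem_cCond_iff h hW).1 hx
    obtain ⟨hyW, q, hq, rfl⟩ := (mem_cCond_iff h hW).1 hy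
    obtain ⟨hzW, s, hs, rfl⟩ := (mem_cCond_iff h hW).1 hz
    exact (cLe_nodeReal_iff h hW hzW hxW).2 (((cLe_nodeReal_iff h hW hyW hxW).1 hxy).trans
      ((cLe_nodeReal_iff h hW hzW hyW).1 hyz))

theorem epdSoundIn (hE : IsSoundFor Q E) : EpdSoundIn r W := by
  intro b x hbW hb hx hepd y hy hyx
  obtain ⟨hxW, p, hp, rfl⟩ := (mem_cCond_iff h hW).1 hx
  obtain ⟨hyW, q, hq, rfl⟩ := (mem_cCond_iff h hW).1 hy
  have hb' := fun i => (mem_cCond_iff h hW).1 (hb i)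
  choose hbiW a ha hab using hb'
  obtain rfl : (fun i => nodeReal (a i)) = b := funext hab
  obtain ⟨i, s, hs, hsW, hsq, hsb⟩ := hE W hW a p ((cEpd_nodeReal_iff h hW hbW hxW).1 hepd) q hq hyW
    ((cLe_nodeReal_iff h hW hxW hyW).1 hyx)
  exact ⟨i, nodeReal s, nodeReal_mem_cCond h hW hs hsW, (cLe_nodeReal_iff h hW hyW hsW).2 hsq,
    (cLe_nodeReal_iff h hW (hbiW i) hsW).2 hsb⟩

end

/-! ### What a candidate knows about its reals -/

/-- The relation `B(k, a, d, x)` as a property of one real, whose value at `0` is `k` and which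
codes `a`, `d` and `x`. -/
def asReal (B : ℕ → Real → Real → Real → Prop) (w : Real) : Prop :=
  B (w 0) (codeAt w 1) (codeAt w 2) (codeAt w 3)

/-- The real `c` codes the complement of the property `P` as the projection of a closed set. -/
def IsBranchCode (c : Real) (P : Real → Prop) : Prop :=
  ∀ W, ArithClosed W → ∀ w ∈ W, (P w ↔ ∀ v ∈ W, (∀ n, (v n).unpair.1 = w n) →
    ∃ n, c (Encodable.encode (initSeg v n)) ≠ 0)

/-- A quantifier over the coded reals amounts to a quantifier over their last component. -/
theorem forall_asReal_iff {W : Set Real} (hW : ArithClosed W)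
    (B : ℕ → Real → Real → Real → Prop) {k : ℕ} {a d : Real} (ha : a ∈ W) (hd : d ∈ W) :
    (∀ w ∈ W, w 0 = k → codeAt w 1 = a → codeAt w 2 = d → asReal B w) ↔
      ∀ x ∈ W, B k a d x := by
  constructor
  · intro h x hx
    let s : ℕ → Real := fun j => match j with
      | 0 => fun _ => k
      | 1 => a
      | 2 => d
      | _ => x
    have hs : joinSeq s ∈ W := by
      have hp : Pr W (fun c : ℕ × ℕ => (c.1.unpair.1 = 0 ∧ k = c.2) ∨
          (c.1.unpair.1 = 1 ∧ a c.1.unpair.2 = c.2) ∨ (c.1.unpair.1 = 2 ∧ d c.1.unpair.2 = c.2) ∨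
          (2 < c.1.unpair.1 ∧ x c.1.unpair.2 = c.2)) := by
        with_reducible repeat' (first | exact Fn.id hW | apply Fn.unpairFst hW
                                      | apply Fn.unpairSnd hW | apply Fn.proj₁ hW
                                      | apply Fn.proj₂ hW | apply Fn.const hW | apply Fn.real hW ha
                                      | apply Fn.real hW hd | apply Fn.real hW hx | apply Pr.or hW
                                      | apply Pr.and hW | apply Pr.eq hW | apply Pr.lt hW)
      refine Fn.of_graph hW (f := joinSeq s) (hp.congr fun ⟨j, m⟩ => ?_)
      unfold joinSeq
      rcases j.unpair.1 with _ | _ | _ | i <;> simp [s]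
    have := h _ hs (by simp [joinSeq, s]) (codeAt_joinSeq s 1) (codeAt_joinSeq s 2)
    unfold asReal at this
    simpa [s, joinSeq] using this
  · rintro h w hw rfl rfl rfl
    exact h _ (codeAt_mem hW hw 3)

/-- The reals `d` with `realSet d ∈ Z` such that `B(k, a, d, x)` holds for all reals `x` of `M`. -/
def sectionOf (M Z : ZFSet.{u}) (B : ℕ → Real → Real → Real → Prop) (k : ℕ) (a : Real) :
    Set Real :=
  {d | d ∈ realsOf M ∧ realSet d ∈ Z ∧ ∀ x ∈ realsOf M, B k a d x}

/-- The closure properties of a candidate that are used for the relation `B`: its reals are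
arithmetically closed, and the sections of `B` are sets, have their domains, and can be
uniformized. -/
structure IsRich (M : ZFSet.{u}) (B : ℕ → Real → Real → Real → Prop) : Prop where
  closed : ArithClosed (realsOf M)
  reals : ∃ R ∈ M, ∀ z, z ∈ R ↔ ∃ x ∈ realsOf M, realSet x = z
  fiber : ∀ a ∈ realsOf M, ∀ Z ∈ M, (∀ z ∈ Z, ∃ x ∈ realsOf M, realSet x = z) → ∀ k,
    ∃ F ∈ M, ∀ z, z ∈ F ↔ ∃ d ∈ sectionOf M Z B k a, realSet d = z
  dom : ∀ a ∈ realsOf M, ∀ Z ∈ M, (∀ z ∈ Z, ∃ x ∈ realsOf M, realSet x = z) →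
    chi (fun k => (sectionOf M Z B k a).Nonempty) ∈ realsOf M
  choice : ∀ a ∈ realsOf M, ∀ Z ∈ M, (∀ z ∈ Z, ∃ x ∈ realsOf M, realSet x = z) →
    ∃ b : ℕ → Real, joinSeq b ∈ realsOf M ∧
      ∀ k, (sectionOf M Z B k a).Nonempty → b k ∈ sectionOf M Z B k a
  acc : ∀ R ∈ realsOf M,
    (∀ a b c, R (Nat.pair a b) = 1 → R (Nat.pair b c) = 1 → R (Nat.pair a c) = 1) →
    chi (fun k => Acc (fun v k => R (Nat.pair v k) = 1) k) ∈ realsOf M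

/-- Finitely many axioms suffice for all the relations that are coded in the parameter. -/
theorem Ensured.isRich : Ensured.{u} (fun M => ∀ (c e : ℕ → Real)
    (B : ℕ → ℕ → Real → Real → Real → Prop), (∀ i, IsBranchCode (e i) (asReal (B i))) →
    mkParam c (tableOf e) ∈ realsOf M → ∀ i, IsRich M (B i)) := by
  refine (Ensured.arithClosed.and (Ensured.section_comprehension.and (Ensured.dom_mem.and
    (Ensured.fiber_mem.and (Ensured.countable_choice.and Ensured.acc_mem))))).mono fun M _ => ?_
  rintro ⟨⟨hB, hac⟩, hsec, hdom, hfib, hch, hacc⟩ c e B he hr i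
  obtain ⟨hW, heW⟩ := hac c e hr
  have key : ∀ a ∈ realsOf M, ∀ Z ∈ M, (∀ z ∈ Z, ∃ x ∈ realsOf M, realSet x = z) →
      ∃ E ∈ M, ∀ e, e ∈ E ↔ ∃ k, ∃ d ∈ sectionOf M Z (B i) k a,
        e = ZFSet.pair (natSet k) (realSet d) := by
    intro a ha Z hZ hZW
    obtain ⟨E, hEM, hE⟩ := hsec hB hW (e i) (heW i) a ha Z hZ hZW
    refine ⟨E, hEM, fun p => (hE p).trans (exists_congr fun k => exists_congr fun d => ?_)⟩
    constructor
    · rintro ⟨hd, h1, h2, h3⟩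
      refine ⟨⟨hd, h2, (forall_asReal_iff hW (B i) ha hd).1 fun w hw e1 e2 e3 => ?_⟩, h1⟩
      exact (he i _ hW w hw).2 (h3 w hw e1 e2 e3)
    · rintro ⟨⟨hd, h2, h3⟩, h1⟩
      refine ⟨hd, h1, h2, fun w hw e1 e2 e3 => ?_⟩
      exact (he i _ hW w hw).1 ((forall_asReal_iff hW (B i) ha hd).2 h3 w hw e1 e2 e3)
  have hmem : ∀ {E Z : ZFSet.{u}} {a : Real}, (∀ e, e ∈ E ↔ ∃ k, ∃ d ∈ sectionOf M Z (B i) k a,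
      e = ZFSet.pair (natSet k) (realSet d)) → ∀ k z, ZFSet.pair (natSet k) z ∈ E ↔
      ∃ d ∈ sectionOf M Z (B i) k a, realSet d = z := by
    intro E Z a hE k z
    rw [hE]
    constructor
    · rintro ⟨k', d, hd, h⟩
      obtain ⟨h1, rfl⟩ := ZFSet.pair_inj.1 h
      obtain rfl := natSet_inj.1 h1
      exact ⟨d, hd, rfl⟩
    · rintro ⟨d, hd, rfl⟩
      exact ⟨k, d, hd, rfl⟩
  refine ⟨hW, hB.reals, fun a ha Z hZ hZW k => ?_, fun a ha Z hZ hZW => ?_,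
    fun a ha Z hZ hZW => ?_, hacc hB (hW.basic 0) (hW.basic 1)⟩
  · obtain ⟨E, hEM, hE⟩ := key a ha Z hZ hZW
    obtain ⟨F, hF, hFz⟩ := hfib hB E hEM Z hZ k
    refine ⟨F, hF, fun z => ?_⟩
    rw [hFz, hmem hE]
    refine and_iff_right_of_imp ?_
    rintro ⟨d, hd, rfl⟩
    exact hd.2.1
  · obtain ⟨E, hEM, hE⟩ := key a ha Z hZ hZW
    have := hdom hB E hEM
    simp only [hmem hE] at this
    convert this using 3 with k
    exact ⟨fun ⟨d, hd⟩ => ⟨_, d, hd, rfl⟩, fun ⟨_, d, hd, _⟩ => ⟨d, hd⟩⟩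
  · obtain ⟨E, hEM, hE⟩ := key a ha Z hZ hZW
    obtain ⟨b, hb, hbE⟩ := hch hB (hW.basic 0) (hW.basic 1) E hEM fun p hp => by
      obtain ⟨k, d, hd, rfl⟩ := (hE p).1 hp
      exact ⟨k, d, hd.1, rfl⟩
    refine ⟨b, hb, fun k ⟨d, hd⟩ => ?_⟩
    obtain ⟨d', hd', h⟩ := (hmem hE k _).1 (hbE k ⟨_, (hmem hE k _).2 ⟨d, hd, rfl⟩⟩)
    rwa [← realSet_inj.1 h]

/-- A tree in a candidate that has a branch has a branch in the candidate: otherwise the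
well-founded part of the reverse order of the tree, which belongs to the candidate, would contain
the root. -/
theorem IsRich.exists_branch {M : ZFSet.{u}} {B : ℕ → Real → Real → Real → Prop}
    (hM : IsRich M B) {S : Set Node} (hS : nodeReal S ∈ realsOf M)
    (hpre : ∀ s t, t ∈ S → s <+: t → s ∈ S) {x : Real} (hx : ∀ n, initSeg x n ∈ S) :
    ∃ y ∈ realsOf M, ∀ n, initSeg y n ∈ S := by
  have hW := hM.closed
  let rel : Node → Node → Prop := fun v k => v ∈ S ∧ k ∈ S ∧ k <+: v ∧ ¬ k = v
  let R : Real := chi (fun k => rel (ofNat (Node × Node) k).1 (ofNat (Node × Node) k).2)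
  have hRW : R ∈ realsOf M := by
    have h : Pr (realsOf M) (fun c : Node × Node => c.1 ∈ S ∧ c.2 ∈ S ∧ c.2 <+: c.1 ∧
        ¬ c.2 = c.1) := by
      with_reducible repeat' (first | exact Fn.id hW | apply Fn.proj₁ hW | apply Fn.proj₂ hW
                                    | apply Pr.and hW | apply Pr.mem hW hS | apply Pr.prefix hW
                                    | apply Pr.not hW | apply Pr.eq hW)
    exact h
  have hR : ∀ v k, R (Nat.pair v k) = 1 ↔ rel (ofNat Node v) (ofNat Node k) := by
    intro v k
    simp only [R, chi_eq_one, Denumerable.prod_ofNat_val, Nat.unpair_pair]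
  have hacc := hM.acc R hRW fun a b c h1 h2 => by
    rw [hR] at *
    refine ⟨h1.1, h2.2.1, h2.2.2.1.trans h1.2.2.1, fun e => h1.2.2.2 ?_⟩
    exact prefix_antisymm h1.2.2.1 (e ▸ h2.2.2.1)
  -- the nodes outside the well-founded part, a tree without terminal nodes
  let Y : Set Node := {s | s ∈ S ∧ ¬ Acc (fun v k => R (Nat.pair v k) = 1) (Encodable.encode s)}
  have hY : nodeReal Y ∈ realsOf M := by
    refine nodeReal_mem_iff.2 (Pr.and hW (nodeReal_mem_iff.1 hS) (Pr.not hW ?_))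
    have h : Pr (γ := ℕ) (realsOf M) (fun k => Acc (fun v k => R (Nat.pair v k) = 1) k) := hacc
    exact Pr.comp hW h (Fn.encode hW)
  have hnil : ([] : Node) ∈ Y := by
    refine ⟨hx 0, fun hA => ?_⟩
    have key : ∀ k, Acc (fun v k => R (Nat.pair v k) = 1) k → ∀ n,
        k ≠ Encodable.encode (initSeg x n) := by
      intro k hk
      induction hk with
      | intro k _ ih =>
        rintro n rfl
        refine ih (Encodable.encode (initSeg x (n + 1))) ?_ (n + 1) rfl
        rw [hR]
        simp only [Denumerable.ofNat_encode]
        refine ⟨hx _, hx _, initSeg_prefix x (Nat.le_succ n), fun e => ?_⟩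
        simpa using congrArg List.length e
    exact key _ hA 0 rfl
  obtain ⟨y, hy, hyY, -⟩ := exists_branch_mem hW hY hnil fun v hv _ => by
    by_contra hcon
    push Not at hcon
    refine hv.2 (Acc.intro _ fun w hw => ?_)
    have hw' := (hR _ _).1 hw
    rw [Denumerable.ofNat_encode] at hw'
    obtain ⟨hwS, -, hvw, hne⟩ := hw'
    obtain ⟨j, hj⟩ := (eq_or_snoc_prefix hvw).resolve_left hne
    have hjS := hpre _ _ hwS hj
    have hjA : Acc (fun v k => R (Nat.pair v k) = 1) (Encodable.encode (v ++ [j])) := by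
      by_contra h
      exact hcon j ⟨hjS, h⟩
    by_cases e : v ++ [j] = ofNat Node w
    · rwa [e, Denumerable.encode_ofNat] at hjA
    · refine hjA.inv ((hR _ _).2 ?_)
      rw [Denumerable.ofNat_encode]
      exact ⟨hwS, hjS, hj, e⟩
  exact ⟨y, hy, fun n => (hyY n (Nat.zero_le n)).1⟩

/-! ### The relations for which comprehension is used -/

/-- The relations `B(k, a, d, x)` to which comprehension and choice are applied in candidates:
`d` is a condition; `d` is contained in `a^[k]`; `d` is contained in `a` and has the stem `k`;
and `d` is a Laver condition with stem `k` contained in the first component of `a` such that the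
second component of `a` is met by `x` if `x` is a branch of `d`. Nodes are given by their codes. -/
def selectRel (Q : TreeForcing) : ℕ → ℕ → Real → Real → Real → Prop
  | 0 => fun _ _ d _ => ∃ p, IsCond Q p ∧ nodeReal p = d
  | 1 => fun k a d _ => treeOf d ⊆ restr (treeOf a) (ofNat Node k)
  | 2 => fun k a d _ => treeOf d ⊆ treeOf a ∧ IsStem (treeOf d) (ofNat Node k)
  | 3 => fun k a d x => IsLaverAt (treeOf d) (ofNat Node k) ∧ treeOf d ⊆ treeOf (evenPart a) ∧
      ((∀ n, initSeg x n ∈ treeOf d) →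
        ∃ n ≥ (ofNat Node k).length, initSeg x n ∈ treeOf (oddPart a))
  | _ => fun _ _ _ _ => True

theorem IsArith.atNode {P : Node → Real → Prop} (h : IsArith P) :
    IsArith (fun (_ : ℕ) w => P (ofNat Node (w 0)) w) := by
  have h1 : IsArith (fun (_ : ℕ) w => ∃ t : Node, w 0 = Encodable.encode t ∧ P t w) :=
    IsArith.ex (P := fun _ (t : Node) w => w 0 = Encodable.encode t ∧ P t w)
      (IsArith.and (IsArith.eval (fun W hW => Fn.const hW 0)
        fun W hW => Fn.encode_comp hW (Fn.snd hW)) (h.reindex fun W hW => Fn.snd hW))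
  refine h1.congr fun _ w => ⟨?_, fun h => ⟨_, by simp, h⟩⟩
  rintro ⟨t, ht, h⟩
  rwa [ht, Denumerable.ofNat_encode]

theorem isArith_initSeg_eq : IsArith (fun (c : ℕ × Node) x => initSeg x c.1 = c.2) := by
  refine IsArith.congr (P := fun (c : ℕ × Node) x => c.2.length = c.1 ∧
    ∀ i : ℕ, i < c.1 → x i = c.2.getD i 0) ?_ fun c x => ?_
  · refine IsArith.and (IsArith.const fun W hW => Pr.eq hW (Fn.length hW (Fn.snd hW)) (Fn.fst hW))
      (IsArith.all (IsArith.imp (IsArith.const fun W hW => Pr.lt hW (Fn.snd hW)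
        (Fn.proj₁ hW (Fn.fst hW))) (IsArith.eval (fun W hW => Fn.snd hW) fun W hW => ?_)))
    exact Fn.getD hW (Fn.proj₂ hW (Fn.fst hW)) (Fn.snd hW)
  · rw [eq_initSeg_iff]
    simp only [eq_comm]

theorem isArith_selectRel (Q : TreeForcing) (i : ℕ) :
    IsArith (fun (_ : ℕ) w => asReal (selectRel Q i) w) := by
  have hc : ∀ j, IsArithTree fun w => treeOf (codeAt w j) := fun j =>
    isArithTree_treeOf.precomp (continuous_codeAt j) fun _ hW _ hx => codeAt_mem hW hx j
  have hstem : IsArith (fun t w => IsStem (treeOf (codeAt w 2)) t) := by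
    refine IsArith.and (hc 2) (IsArith.and (hc 2).nontrivial_succs ?_)
    have h : IsArith (fun (t : Node) w => ∀ s, s ∈ treeOf (codeAt w 2) → (s <+: t ∨ t <+: s)) := by
      with_reducible repeat' (first | apply IsArith.all | apply IsArith.imp | apply (hc 2).mem
                                    | apply IsArith.const)
      all_goals
        intro W hW
        with_reducible repeat' (first | exact Fn.id hW | apply Fn.proj₁ hW | apply Fn.proj₂ hW
                                      | apply Pr.or hW | apply Pr.prefix hW)
    exact h
  match i with
  | 0 =>
    exact (isArith_nodeReal Q).precomp (continuous_codeAt 2) fun _ hW _ hx => codeAt_mem hW hx 2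
  | 1 =>
    refine IsArith.atNode (P := fun t w => treeOf (codeAt w 2) ⊆ restr (treeOf (codeAt w 1)) t) ?_
    have h : IsArith (fun (t : Node) w => ∀ s, s ∈ treeOf (codeAt w 2) →
        (s ∈ treeOf (codeAt w 1) ∧ (s <+: t ∨ t <+: s))) := by
      with_reducible repeat' (first | apply IsArith.all | apply IsArith.imp | apply IsArith.and
                                    | apply (hc 2).mem | apply (hc 1).mem | apply IsArith.const)
      all_goals
        intro W hW
        with_reducible repeat' (first | exact Fn.id hW | apply Fn.proj₁ hW | apply Fn.proj₂ hW
                                      | apply Pr.or hW | apply Pr.prefix hW)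
    exact h
  | 2 => exact ((hc 2).subset (hc 1)).and (IsArith.atNode hstem)
  | 3 =>
    have heven : IsArithTree fun w => treeOf (evenPart (codeAt w 1)) :=
      (isArithTree_treeOf.precomp continuous_evenPart fun _ hW _ hx => evenPart_mem hW hx).precomp
        (continuous_codeAt 1) fun _ hW _ hx => codeAt_mem hW hx 1
    have hodd : IsArithTree fun w => treeOf (oddPart (codeAt w 1)) :=
      (isArithTree_treeOf.precomp continuous_oddPart fun _ hW _ hx => oddPart_mem hW hx).precomp
        (continuous_codeAt 1) fun _ hW _ hx => codeAt_mem hW hx 1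
    have hseg : IsArith (fun (c : ℕ × Node) w => initSeg (codeAt w 3) c.1 = c.2) :=
      isArith_initSeg_eq.precomp (continuous_codeAt 3) fun _ hW _ hx => codeAt_mem hW hx 3
    have hmem : ∀ A : Real → Set Node, IsArithTree A →
        IsArith (fun (n : ℕ) w => initSeg (codeAt w 3) n ∈ A w) := by
      intro A hA
      refine (IsArith.ex (P := fun (n : ℕ) (s : Node) w => initSeg (codeAt w 3) n = s ∧ s ∈ A w)
        (hseg.and (hA.mem fun W hW => Fn.snd hW))).congr fun n w => by simp
    have h1 : IsArith (fun (t : Node) w => ∀ s, s ∈ treeOf (codeAt w 2) → t <+: s →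
        (succs (treeOf (codeAt w 2)) s).Infinite) :=
      IsArith.all (IsArith.imp ((hc 2).mem fun W hW => Fn.snd hW) (IsArith.imp
        (IsArith.const fun W hW => Pr.prefix hW (Fn.fst hW) (Fn.snd hW))
        ((hc 2).infinite_succs.reindex fun W hW => Fn.snd hW)))
    have h2 : IsArith (fun (t : Node) w => ∃ n : ℕ, t.length ≤ n ∧
        initSeg (codeAt w 3) n ∈ treeOf (oddPart (codeAt w 1))) :=
      IsArith.ex (IsArith.and (IsArith.const fun W hW => Pr.le hW (Fn.length hW (Fn.fst hW))
        (Fn.snd hW)) ((hmem _ hodd).reindex fun W hW => Fn.snd hW))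
    have h3 : IsArith (fun (_ : ℕ) w => ∀ n, initSeg (codeAt w 3) n ∈ treeOf (codeAt w 2)) :=
      IsArith.all (P := fun _ n w => initSeg (codeAt w 3) n ∈ treeOf (codeAt w 2))
        ((hmem _ (hc 2)).reindex fun W hW => Fn.snd hW)
    have h4 : IsArith (fun (_ : ℕ) w => IsLaverAt (treeOf (codeAt w 2)) (ofNat Node (w 0))) :=
      ((hc 2).isTree.and (IsArith.atNode (hstem.and h1))).congr fun _ w =>
        ⟨fun h => ⟨h.1, h.2.1, h.2.2⟩, fun h => ⟨h.1, h.2, h.3⟩⟩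
    exact h4.and (((hc 2).subset heven).and (h3.imp (IsArith.atNode h2)))
  | _ + 4 => exact IsArith.const fun W hW => Pr.const hW _

theorem exists_isBranchCode (Q : TreeForcing) :
    ∃ e : ℕ → Real, ∀ i, IsBranchCode (e i) (asReal (selectRel Q i)) := by
  choose e he using fun i => exists_branch_code (isArith_selectRel Q i).neg
  exact ⟨e, he⟩

/-! ### Strengthening conditions into dense sets inside a candidate -/

/-- The set `D ∈ M` is a dense set of conditions of the forcing `Q` of `M`. -/
structure IsDenseIn (Q : TreeForcing) (M D : ZFSet.{u}) : Prop where
  mem : D ∈ M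
  cond : ∀ z ∈ D, ∃ p, IsCond Q p ∧ nodeReal p ∈ realsOf M ∧ realSet (nodeReal p) = z
  dense : ∀ p, IsCond Q p → nodeReal p ∈ realsOf M →
    ∃ d, nodeReal d ∈ realsOf M ∧ realSet (nodeReal d) ∈ D ∧ d ⊆ p

namespace IsDenseIn

variable {Q : TreeForcing} {M D : ZFSet.{u}} (hD : IsDenseIn Q M D)
include hD

theorem real : ∀ z ∈ D, ∃ x ∈ realsOf M, realSet x = z := fun z hz =>
  let ⟨_, _, h, e⟩ := hD.cond z hz; ⟨_, h, e⟩

theorem nodeReal_treeOf {x : Real} (hx : realSet x ∈ D) : nodeReal (treeOf x) = x := by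
  obtain ⟨p, -, -, h⟩ := hD.cond _ hx
  rw [← realSet_inj.1 h, treeOf_nodeReal]

theorem isCond {x : Real} (hx : realSet x ∈ D) : IsCond Q (treeOf x) := by
  obtain ⟨p, hp, -, h⟩ := hD.cond _ hx
  rwa [← realSet_inj.1 h, treeOf_nodeReal]

end IsDenseIn

theorem pr_mem_treeOf_joinSeq {W : Set Real} (hW : ArithClosed W) {b : ℕ → Real}
    (hb : joinSeq b ∈ W) :
    Pr W (fun c : Node × Node => c.2 ∈ treeOf (b (Encodable.encode c.1))) := by
  have h : Pr W (fun c : Node × Node =>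
      joinSeq b (Nat.pair (Encodable.encode c.1) (Encodable.encode c.2)) = 1) :=
    Pr.eq hW (Fn.real hW hb (Fn.natPair hW (Fn.encode_comp hW (Fn.fst hW))
      (Fn.encode_comp hW (Fn.snd hW)))) (Fn.const hW 1)
  refine h.congr fun c => ?_
  rw [mem_treeOf]
  simp [joinSeq]

/-- A family in `D` that is indexed by the nodes in `F ∈ W` extends to a sequence in `D`. -/
theorem exists_listing {Q : TreeForcing} {M D : ZFSet.{u}} (hD : IsDenseIn Q M D)
    (hW : ArithClosed (realsOf M)) {F : Set Node} (hF : nodeReal F ∈ realsOf M)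
    (hne : F.Nonempty) {b : ℕ → Real} (hb : joinSeq b ∈ realsOf M)
    (hbD : ∀ t ∈ F, realSet (b (Encodable.encode t)) ∈ D) :
    ∃ b' : ℕ → Set Node, joinSeq (fun i => nodeReal (b' i)) ∈ realsOf M ∧
      (∀ i, realSet (nodeReal (b' i)) ∈ D) ∧
        ∀ t ∈ F, ∃ i, b' i = treeOf (b (Encodable.encode t)) := by
  classical
  obtain ⟨t₀, ht₀⟩ := hne
  let g : ℕ → ℕ := fun k => if ofNat Node k ∈ F then k else Encodable.encode t₀
  have hg : Fn (realsOf M) g := by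
    have hm : Pr (realsOf M) (fun c : ℕ × ℕ => ofNat Node c.1 ∈ F) :=
      Pr.mem hW hF (Fn.comp hW (Fn.decode hW) (Fn.fst hW))
    refine Fn.of_graph hW ((Pr.or hW (Pr.and hW hm (Pr.eq hW (Fn.fst hW) (Fn.snd hW)))
      (Pr.and hW (Pr.not hW hm) (Pr.eq hW (Fn.const hW (Encodable.encode t₀))
      (Fn.snd hW)))).congr fun c => ?_)
    simp only [g]
    split_ifs with h <;> simp [h]
  have hgD : ∀ i, realSet (b (g i)) ∈ D := by
    intro i
    simp only [g]
    split_ifs with h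
    · simpa using hbD _ h
    · exact hbD _ ht₀
  refine ⟨fun i => treeOf (b (g i)), ?_, fun i => ?_, fun t ht => ⟨Encodable.encode t, ?_⟩⟩
  · simp only [hD.nodeReal_treeOf (hgD _)]
    have h : Fn (realsOf M) (fun k : ℕ => joinSeq b (Nat.pair (g k.unpair.1) k.unpair.2)) :=
      Fn.real hW hb (Fn.natPair hW (Fn.comp hW hg (Fn.unpairFst hW (Fn.id hW)))
        (Fn.unpairSnd hW (Fn.id hW)))
    have e : (fun k : ℕ => joinSeq b (Nat.pair (g k.unpair.1) k.unpair.2)) =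
        joinSeq (fun i => b (g i)) := by
      funext k
      simp [joinSeq]
    rw [e] at h
    exact h
  · rw [hD.nodeReal_treeOf (hgD i)]
    exact hgD i
  · simp [g, ht]

theorem nodeReal_nextLevel_mem {W : Set Real} (hW : ArithClosed W) {p : Set Node}
    (hp : nodeReal p ∈ W) (n : ℕ) : nodeReal (nextLevel p n) ∈ W := by
  have hs := nodeReal_splN_mem hW hp n
  have h : Pr W (fun t : Node => t ∈ p ∧ ∃ s : Node, s ∈ splN p n ∧ ∃ m : ℕ, t = s ++ [m]) := by
    with_reducible repeat' (first | exact Fn.id hW | apply Fn.proj₁ hW | apply Fn.proj₂ hW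
                                  | apply Fn.snoc hW | apply Pr.and hW | apply Pr.ex hW
                                  | apply Pr.mem hW hp | apply Pr.mem hW hs | apply Pr.eq hW)
  exact nodeReal_mem_iff.2 h

/-- Sacks, Miller and Rosłanowski conditions are strengthened into the dense set above the
immediate successors of the `n`-th splitting level. -/
theorem exists_leN_of_ne_laver {Q : TreeForcing} (hQ : Q ≠ .laver) {M D : ZFSet.{u}}
    (hM : IsRich M (selectRel Q 1)) (hD : IsDenseIn Q M D) {p : Set Node} (hp : IsCond Q p)
    (hpW : nodeReal p ∈ realsOf M) (n : ℕ) :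
    ∃ q, IsCond Q q ∧ nodeReal q ∈ realsOf M ∧ LeN n q p ∧
      ∃ b : ℕ → Set Node, joinSeq (fun i => nodeReal (b i)) ∈ realsOf M ∧
        (∀ i, realSet (nodeReal (b i)) ∈ D) ∧ epdFront (realsOf M) b q ∧
        epdSplit (realsOf M) b q := by
  have hW := hM.closed
  obtain ⟨b, hb, hbsel⟩ := hM.choice _ hpW D hD.mem hD.real
  have hd : ∀ t ∈ nextLevel p n, realSet (b (Encodable.encode t)) ∈ D ∧
      treeOf (b (Encodable.encode t)) ⊆ restr p t := by
    intro t ht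
    obtain ⟨d, hdW, hdD, hdt⟩ := hD.dense _ (isCond_restr hp ht.1) (nodeReal_restr_mem hW hpW t)
    obtain ⟨-, h2, h3⟩ := hbsel (Encodable.encode t)
      ⟨nodeReal d, hdW, hdD, fun _ _ => by simpa [selectRel] using hdt⟩
    exact ⟨h2, by simpa [selectRel] using h3 _ hpW⟩
  have hd' : ∀ t ∈ nextLevel p n, IsCond Q (treeOf (b (Encodable.encode t))) ∧
      treeOf (b (Encodable.encode t)) ⊆ restr p t := fun t ht =>
    ⟨hD.isCond (hd t ht).1, (hd t ht).2⟩
  have hF := nodeReal_nextLevel_mem hW hpW n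
  have hA := isAmalgam_nextLevel hp hd'
  obtain ⟨b', hb', hbD', hbF⟩ := exists_listing hD hW hF hA.nonempty hb fun t ht => (hd t ht).1
  refine ⟨_, isCond_amalg_nextLevel hp hd' hQ,
    nodeReal_amalg_mem hW hF (pr_mem_treeOf_joinSeq hW hb), leN_amalg_nextLevel hp hd',
    b', hb', hbD', ⟨_, hF, front_nextLevel hp hd' hQ _, fun t ht => ?_⟩, n + 1, fun s hs => ?_⟩
  · rw [hA.restr_eq ht]
    exact hbF t ht
  · obtain ⟨t, ht, he⟩ := restr_splN_amalg_nextLevel hp hd' hs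
    rw [he]
    exact hbF t ht

/-- A node with infinitely many good immediate successors is good. -/
theorem isGood_of_infinite {W : Set Real} (hW : ArithClosed W) {A p : Set Node}
    (hX : nodeReal {t | IsGood W A p t} ∈ W) {b : ℕ → Real} (hb : joinSeq b ∈ W)
    (hgood : ∀ t, IsGood W A p t → IsLaverAt (treeOf (b (Encodable.encode t))) t ∧
      treeOf (b (Encodable.encode t)) ⊆ p ∧ IsBarIn W A (treeOf (b (Encodable.encode t))) t)
    {v : Node} (hinf : {m | IsGood W A p (v ++ [m])}.Infinite) : IsGood W A p v := by
  let S : Set ℕ := {m | IsGood W A p (v ++ [m])}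
  let d : Node → Set Node := fun t => treeOf (b (Encodable.encode t))
  have hF : nodeReal {u | ∃ m ∈ S, u = v ++ [m]} ∈ W := by
    refine nodeReal_mem_iff.2 (Pr.ex hW (P := fun (u : Node) (m : ℕ) =>
      v ++ [m] ∈ {t | IsGood W A p t} ∧ u = v ++ [m]) ?_)
    exact Pr.and hW (Pr.mem hW hX (Fn.snoc hW (Fn.const hW v) (Fn.snd hW)))
      (Pr.eq hW (Fn.fst hW) (Fn.snoc hW (Fn.const hW v) (Fn.snd hW)))
  have hl : ∀ m ∈ S, IsLaverAt (d (v ++ [m])) (v ++ [m]) := fun m hm => (hgood _ hm).1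
  refine ⟨amalg {u | ∃ m ∈ S, u = v ++ [m]} d,
    nodeReal_amalg_mem hW hF (pr_mem_treeOf_joinSeq hW hb), isLaverAt_amalg_snoc hl hinf, ?_,
    isBarIn_amalg_snoc hl hinf fun m hm => (hgood _ hm).2.2⟩
  rintro w ⟨_, ⟨m, hm, rfl⟩, hw⟩
  exact (hgood _ hm).2.1 hw

theorem nodeReal_badPart_mem {W : Set Real} (hW : ArithClosed W) {A p : Set Node}
    (hp : nodeReal p ∈ W) (hX : nodeReal {t | IsGood W A p t} ∈ W) (t : Node) :
    nodeReal (badPart W A p t) ∈ W := by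
  have hr := nodeReal_restr_mem hW hp t
  have h : Pr W (fun v : Node => v ∈ restr p t ∧ ∀ w : Node, t <+: w → w <+: v →
      ¬ w ∈ {t | IsGood W A p t}) := by
    with_reducible repeat' (first | exact Fn.id hW | apply Fn.proj₁ hW | apply Fn.proj₂ hW
                                  | apply Fn.const hW | apply Pr.and hW | apply Pr.not hW
                                  | apply Pr.imp hW | apply Pr.all hW | apply Pr.prefix hW
                                  | apply Pr.mem hW hX | apply Pr.mem hW hr)
  exact nodeReal_mem_iff.2 h

theorem nodeReal_barFront_mem {W : Set Real} (hW : ArithClosed W) {A p : Set Node}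
    (hA : nodeReal A ∈ W) (hp : nodeReal p ∈ W) (n : ℕ) {b : Node → Set Node}
    (hb : Pr W (fun c : Node × Node => c.2 ∈ b c.1)) : nodeReal (barFront A p n b) ∈ W := by
  have hs := nodeReal_splN_mem hW hp n
  have hbc : Pr W (fun c : Node × Node => c.1 ∈ b c.2) :=
    Pr.comp hW hb (Fn.pair hW (Fn.snd hW) (Fn.fst hW))
  have h : Pr W (fun u : Node => u ∈ A ∧ ∃ s : Node, s ∈ splN p n ∧ s <+: u ∧ u ∈ b s ∧
      ∀ v : Node, s <+: v → v <+: u → ¬ v = u → ¬ v ∈ A) := by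
    with_reducible repeat' (first | exact Fn.id hW | exact hbc | apply Fn.proj₁ hW
                                  | apply Fn.proj₂ hW | apply Pr.and hW | apply Pr.ex hW
                                  | apply Pr.not hW | apply Pr.imp hW | apply Pr.all hW
                                  | apply Pr.prefix hW | apply Pr.mem hW hA | apply Pr.mem hW hs
                                  | apply Pr.eq hW)
  exact nodeReal_mem_iff.2 h

section

variable {M D : ZFSet.{u}} (h2 : IsRich M (selectRel .laver 2)) (h3 : IsRich M (selectRel .laver 3))
  (hD : IsDenseIn .laver M D) {p : Set Node} {σ : Node} (hp : IsLaverAt p σ)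
  (hpW : nodeReal p ∈ realsOf M)
include h2 h3 hD hp hpW

/-- Laver conditions are strengthened along the bar of the stems of conditions in the dense set.
All nodes above the stem are good for this bar: a node with infinitely many good successors is
good, so a bad node would be the stem of a condition without good nodes at or above its stem,
and this condition would have no strengthening in the dense set. -/
theorem exists_leN_laver (n : ℕ) :
    ∃ q, IsCond .laver q ∧ nodeReal q ∈ realsOf M ∧ LeN n q p ∧
      ∃ b : ℕ → Set Node, joinSeq (fun i => nodeReal (b i)) ∈ realsOf M ∧
        (∀ i, realSet (nodeReal (b i)) ∈ D) ∧ epdFront (realsOf M) b q := by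
  have hW := h2.closed
  -- the stems of conditions in the dense set below `p`
  obtain ⟨d, hd, hdsel⟩ := h2.choice _ hpW D hD.mem hD.real
  let A : Set Node :=
    {u | (sectionOf M D (selectRel .laver 2) (Encodable.encode u) (nodeReal p)).Nonempty}
  have hA : nodeReal A ∈ realsOf M := by
    have := h2.dom _ hpW D hD.mem hD.real
    rw [nodeReal_eq_chi]
    simpa [A] using this
  have hdA : ∀ u ∈ A, realSet (d (Encodable.encode u)) ∈ D ∧
      IsLaverAt (treeOf (d (Encodable.encode u))) u ∧ treeOf (d (Encodable.encode u)) ⊆ p := by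
    intro u hu
    obtain ⟨-, h, h'⟩ := hdsel _ hu
    have h'' := h' _ hpW
    simp only [selectRel, Denumerable.ofNat_encode, treeOf_nodeReal] at h''
    exact ⟨h, isLaverAt_iff.2 ⟨hD.isCond h, h''.2⟩, h''.1⟩
  have hAmem : ∀ q u, nodeReal q ∈ realsOf M → realSet (nodeReal q) ∈ D → q ⊆ p → IsStem q u →
      u ∈ A := by
    intro q u hqW hqD hqp hu
    exact ⟨nodeReal q, hqW, hqD, fun _ _ => by simpa [selectRel] using ⟨hqp, hu⟩⟩
  -- the good nodes
  obtain ⟨R, hRM, hR⟩ := h3.reals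
  have hpA := joinPair_mem hW hpW hA
  obtain ⟨b, hb, hbsel⟩ := h3.choice _ hpA R hRM fun z hz => (hR z).1 hz
  have hgood_iff : ∀ t, IsGood (realsOf M) A p t ↔
      (sectionOf M R (selectRel .laver 3) (Encodable.encode t)
        (joinPair (nodeReal p) (nodeReal A))).Nonempty := by
    intro t
    constructor
    · rintro ⟨q, hqW, hq, hqp, hbar⟩
      refine ⟨nodeReal q, hqW, (hR _).2 ⟨_, hqW, rfl⟩, fun x hx => ?_⟩
      simp only [selectRel, Denumerable.ofNat_encode, treeOf_nodeReal, evenPart_joinPair,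
        oddPart_joinPair]
      exact ⟨hq, hqp, hbar x hx⟩
    · rintro ⟨q, hqW, -, hq⟩
      simp only [selectRel, Denumerable.ofNat_encode, treeOf_nodeReal, evenPart_joinPair,
        oddPart_joinPair] at hq
      exact ⟨treeOf q, nodeReal_mem_iff.2 (Pr.mem_treeOf hW hqW (Fn.id hW)), (hq q hqW).1,
        (hq q hqW).2.1, fun x hx => (hq x hx).2.2⟩
  have hbgood : ∀ t, IsGood (realsOf M) A p t → b (Encodable.encode t) ∈ realsOf M ∧
      IsLaverAt (treeOf (b (Encodable.encode t))) t ∧ treeOf (b (Encodable.encode t)) ⊆ p ∧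
      IsBarIn (realsOf M) A (treeOf (b (Encodable.encode t))) t := by
    intro t ht
    obtain ⟨h, -, h'⟩ := hbsel _ ((hgood_iff t).1 ht)
    simp only [selectRel, Denumerable.ofNat_encode, treeOf_nodeReal, evenPart_joinPair,
      oddPart_joinPair] at h'
    exact ⟨h, (h' _ h).1, (h' _ h).2.1, fun x hx => (h' x hx).2.2⟩
  have hX : nodeReal {t | IsGood (realsOf M) A p t} ∈ realsOf M := by
    have := h3.dom _ hpA R hRM fun z hz => (hR z).1 hz
    rw [nodeReal_eq_chi]
    simpa [hgood_iff] using this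
  have hbPr := pr_mem_treeOf_joinSeq hW hb
  have hstep : ∀ v ∈ p, σ <+: v → {m | IsGood (realsOf M) A p (v ++ [m])}.Infinite →
      IsGood (realsOf M) A p v := fun v _ _ hinf =>
    isGood_of_infinite hW hX hb (fun t ht => (hbgood t ht).2) hinf
  have hall : ∀ t ∈ p, σ <+: t → IsGood (realsOf M) A p t := by
    intro t ht hσ
    by_contra hbad
    have hL := isLaverAt_badPart hp hstep ht hσ hbad
    have hLW := nodeReal_badPart_mem hW hpW hX t
    obtain ⟨q, hqW, hqD, hq⟩ := hD.dense _ hL.isCond hLW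
    have hqc := hD.isCond hqD
    rw [treeOf_nodeReal] at hqc
    obtain ⟨u, hu, -⟩ := hqc.2
    have hqp : q ⊆ p := fun v hv => (hq hv).1.1
    have htu : t <+: u := (hL.mem_spl_iff.1 (spl_mono hq ⟨hu.1, hu.2.1⟩)).2
    refine (hq hu.1).2 u htu List.prefix_rfl ⟨q, hqW, isLaverAt_iff.2 ⟨hqc, hu⟩, hqp, ?_⟩
    intro x _ hx
    have hxu : initSeg x u.length = u := by
      rcases hu.2.2 _ (hx u.length) with h | h
      · exact h.eq_of_length (by simp)
      · exact (h.eq_of_length (by simp)).symm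
    exact ⟨u.length, le_rfl, hxu.symm ▸ hAmem q u hqW hqD hqp hu⟩
  have hlev : ∀ s ∈ splN p n, IsGood (realsOf M) A p s := fun s hs =>
    hall s hs.1.1 (hp.mem_spl_iff.1 hs.1).2
  have hS : IsBarSystem (realsOf M) A p σ n (fun t => treeOf (b (Encodable.encode t)))
      (fun u => treeOf (d (Encodable.encode u))) := by
    refine ⟨hp, fun s hs => (hbgood s (hlev s hs)).2.1,
      fun s hs => (hbgood s (hlev s hs)).2.2.2, fun s hs v hv => ?_,
      fun u hu => (hdA u hu).2.1, fun u hu => (hdA u hu).2.2⟩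
    have hL := (hbgood s (hlev s hs)).2.1
    exact exists_branch_of_hasSplitting hW (nodeReal_mem_iff.2
      (Pr.mem_treeOf hW (hbgood s (hlev s hs)).1 (Fn.id hW))) hL.isTree hL.isCond.hasSplitting hv
  have hF : nodeReal (barFront A p n fun t => treeOf (b (Encodable.encode t))) ∈ realsOf M :=
    nodeReal_barFront_mem hW hA hpW n hbPr
  obtain ⟨b', hb', hbD', hbF⟩ := exists_listing hD hW hF hS.isAmalgam.nonempty hd
    fun u hu => (hdA u hu.1).1
  refine ⟨_, hS.isLaverAt_amalg.isCond, nodeReal_amalg_mem hW hF (pr_mem_treeOf_joinSeq hW hd),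
    hS.leN, b', hb', hbD', _, hF, hS.front, fun u hu => ?_⟩
  rw [hS.isAmalgam.restr_eq hu]
  exact hbF u hu

end

/-! ### Effective Axiom A and Suslin⁺ -/

/-- The density requirement of effective Axiom A, for all four forcings. -/
theorem exists_leN {Q : TreeForcing} {M D : ZFSet.{u}} (hM : ∀ i, IsRich M (selectRel Q i))
    (hD : IsDenseIn Q M D) {p : Set Node} (hp : IsCond Q p) (hpW : nodeReal p ∈ realsOf M) (n : ℕ) :
    ∃ q, IsCond Q q ∧ nodeReal q ∈ realsOf M ∧ LeN n q p ∧
      ∃ b : ℕ → Set Node, joinSeq (fun i => nodeReal (b i)) ∈ realsOf M ∧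
        (∀ i, realSet (nodeReal (b i)) ∈ D) ∧ epdFront (realsOf M) b q ∧
        (Q ≠ .laver → epdSplit (realsOf M) b q) := by
  by_cases hQ : Q = .laver
  · subst hQ
    obtain ⟨hT, σ, hσ, hinf⟩ := id hp
    obtain ⟨q, hq, hqW, hqp, b, hb, hbD, h⟩ :=
      exists_leN_laver (hM 2) (hM 3) hD ⟨hT, hσ, hinf⟩ hpW n
    exact ⟨q, hq, hqW, hqp, b, hb, hbD, h, fun h => absurd rfl h⟩
  · obtain ⟨q, hq, hqW, hqp, b, hb, hbD, h, h'⟩ := exists_leN_of_ne_laver hQ (hM 1) hD hp hpW n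
    exact ⟨q, hq, hqW, hqp, b, hb, hbD, h, fun _ => h'⟩

/-- The real `r` codes the forcing `Q` and the relation `E`, and all candidates with respect to
`T` that contain `r` satisfy the closure properties for the relations of `Q`. -/
structure IsAdequate (T : setLang.Theory) (Q : TreeForcing) (E : EpdRel) (r : Real) : Prop where
  code : IsCodeOf Q E (codeAt r)
  sound : IsSoundFor Q E
  rich : ∀ M : ZFSet.{u}, IsCandidate T r M → ∀ i, IsRich M (selectRel Q i)

namespace IsAdequate

variable {T : setLang.Theory} {Q : TreeForcing} {E : EpdRel} {r : Real}
  (h : IsAdequate.{u} T Q E r)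
include h

theorem definesOrder : DefinesOrder.{u} T Q r :=
  ⟨definesOrderIn h.code arithClosed_univ, fun M hM => definesOrderIn h.code (h.rich M hM 0).closed⟩

theorem definesAxiomA : DefinesAxiomA.{u} T Q E r :=
  ⟨definesAxiomAIn h.code arithClosed_univ,
    fun M hM => definesAxiomAIn h.code (h.rich M hM 0).closed⟩

theorem isCodedForcing : IsCodedForcing.{u} T r := by
  refine ⟨orderIn h.code arithClosed_univ, epdSoundIn h.code arithClosed_univ h.sound,
    fun M hM => ?_⟩
  have hR := h.rich M hM 0
  refine ⟨orderIn h.code hR.closed, epdSoundIn h.code hR.closed h.sound, ?_⟩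
  obtain ⟨Z, hZM, hZ⟩ := hR.reals
  have h0 := hR.closed.basic 0
  obtain ⟨F, hFM, hF⟩ := hR.fiber _ h0 Z hZM (fun z hz => (hZ z).1 hz) 0
  refine ⟨F, hFM, fun z => (hF z).trans (exists_congr fun x => and_congr_left fun _ => ?_)⟩
  rw [mem_cCond_iff h.code hR.closed]
  exact ⟨fun hx => ⟨hx.1, hx.2.2 _ h0⟩, fun hx => ⟨hx.1, (hZ _).2 ⟨x, hx.1, rfl⟩, fun _ _ => hx.2⟩⟩

theorem isDenseIn {M D : ZFSet.{u}} (hM : IsCandidate T r M) (hD : IsDenseSubsetIn r M D) :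
    IsDenseIn Q M D := by
  have hW := (h.rich M hM 0).closed
  refine ⟨hD.1, fun z hz => ?_, fun p hp hpW => ?_⟩
  · obtain ⟨x, hx, rfl⟩ := hD.2.1 z hz
    obtain ⟨hxW, p, hp, rfl⟩ := (mem_cCond_iff h.code hW).1 hx
    exact ⟨p, hp, hxW, rfl⟩
  · obtain ⟨x, hx, hxD, hle⟩ := hD.2.2 _ (nodeReal_mem_cCond h.code hW hp hpW)
    obtain ⟨hxW, d, -, rfl⟩ := (mem_cCond_iff h.code hW).1 hx
    exact ⟨d, hxW, hxD, (cLe_nodeReal_iff h.code hW hpW hxW).1 hle⟩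

theorem effectiveAxiomA (hE : ∀ W b p, epdFront W b p → (Q ≠ .laver → epdSplit W b p) → E W b p) :
    EffectiveAxiomA.{u} T r where
  coded := h.isCodedForcing
  fusion a ha hle := by
    have hu := arithClosed_univ
    have ha' := fun n => ((mem_cCond_iff h.code hu).1 (ha n)).2
    choose p hp hpa using ha'
    obtain rfl : (fun n => nodeReal (p n)) = a := funext hpa
    have hq := isCond_iInter hp fun n =>
      (cLeN_nodeReal_iff h.code hu (Set.mem_univ _) (Set.mem_univ _)).1 (hle n)
    exact ⟨nodeReal (⋂ n, p n), nodeReal_mem_cCond h.code hu hq (Set.mem_univ _), fun n =>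
      (cLe_nodeReal_iff h.code hu (Set.mem_univ _) (Set.mem_univ _)).2 (Set.iInter_subset _ n)⟩
  dense M hM x hx n D hD := by
    have hW := (h.rich M hM 0).closed
    obtain ⟨hxW, p, hp, rfl⟩ := (mem_cCond_iff h.code hW).1 hx
    obtain ⟨q, hq, hqW, hqp, b, hb, hbD, hf, hs⟩ :=
      exists_leN (h.rich M hM) (h.isDenseIn hM hD) hp hxW n
    exact ⟨nodeReal q, nodeReal_mem_cCond h.code hW hq hqW,
      (cLeN_nodeReal_iff h.code hW hxW hqW).2 hqp, _, hb, hbD,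
      (cEpd_nodeReal_iff h.code hW hb hqW).2 (hE _ _ _ hf hs)⟩

end IsAdequate

/-- A front of a candidate stays a front in `V`: a branch that avoids it could be found in the
candidate. -/
theorem IsRich.front_absolute {M : ZFSet.{u}} {B : ℕ → Real → Real → Real → Prop}
    (hM : IsRich M B) {F p : Set Node} (hp : nodeReal p ∈ realsOf M) (hT : IsTree p)
    (hF : nodeReal F ∈ realsOf M) (h : FrontIn (realsOf M) F p) : FrontIn Set.univ F p := by
  have hW := hM.closed
  refine ⟨h.1, h.2.1, fun x _ hx => ?_⟩
  by_contra hcon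
  push Not at hcon
  -- the tree of the nodes of `p` that the front does not cut off
  let S : Set Node := {s | s ∈ p ∧ ∀ t : Node, t <+: s → ¬ t ∈ F}
  have hS : nodeReal S ∈ realsOf M := by
    have hS' : Pr (realsOf M) (fun s : Node => s ∈ p ∧ ∀ t : Node, t <+: s → ¬ t ∈ F) := by
      with_reducible repeat' (first | exact Fn.id hW | apply Fn.proj₁ hW | apply Fn.proj₂ hW
                                    | apply Pr.and hW | apply Pr.not hW | apply Pr.imp hW
                                    | apply Pr.all hW | apply Pr.prefix hW | apply Pr.mem hW hp
                                    | apply Pr.mem hW hF)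
    exact nodeReal_mem_iff.2 hS'
  obtain ⟨y, hy, hyS⟩ := hM.exists_branch hS
    (fun s t ht hst => ⟨hT.mem_of_prefix ht.1 hst, fun u hu => ht.2 u (hu.trans hst)⟩)
    (x := x) fun n => ⟨hx n, fun t ht htF => hcon t.length (prefix_initSeg ht ▸ htF)⟩
  obtain ⟨n, hn⟩ := h.2.2 y hy fun n => (hyS n).1
  exact (hyS n).2 _ List.prefix_rfl hn

/-- The steps of the fusion run through all sets of the candidate, which is countable. -/
theorem IsAdequate.suslinPlus {T : setLang.Theory} {Q : TreeForcing} {r : Real}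
    (h : IsAdequate.{u} T Q epdSub r) : SuslinPlus.{u} T r where
  coded := h.isCodedForcing
  generic M hM x hx := by
    have hu := arithClosed_univ
    have hR := h.rich M hM
    have hW := (hR 0).closed
    obtain ⟨hxW, p₀, hp₀, rfl⟩ := (mem_cCond_iff h.code hW).1 hx
    obtain ⟨D, hD⟩ := hM.countable.exists_eq_range ⟨_, hxW⟩
    have hstep : ∀ (n : ℕ) (p : {p : Set Node // IsCond Q p ∧ nodeReal p ∈ realsOf M}),
        ∃ q : {p : Set Node // IsCond Q p ∧ nodeReal p ∈ realsOf M}, LeN n q.1 p.1 ∧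
          (IsDenseIn Q M (D n) → ∃ b : ℕ → Set Node, (∀ i, realSet (nodeReal (b i)) ∈ D n) ∧
            epdFront (realsOf M) b q.1) := by
      intro n p
      by_cases hd : IsDenseIn Q M (D n)
      · obtain ⟨q, hq, hqW, hqp, b, -, hbD, hf, -⟩ := exists_leN hR hd p.2.1 p.2.2 n
        exact ⟨⟨q, hq, hqW⟩, hqp, fun _ => ⟨b, hbD, hf⟩⟩
      · exact ⟨p, ⟨subset_rfl, rfl⟩, fun hd' => absurd hd' hd⟩
    choose next hle hnext using hstep
    let a : ℕ → {p : Set Node // IsCond Q p ∧ nodeReal p ∈ realsOf M} := fun n =>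
      Nat.rec ⟨p₀, hp₀, hxW⟩ (fun n p => next n p) n
    have hq : IsCond Q (⋂ n, (a n).1) :=
      isCond_iInter (fun n => (a n).2.1) fun n => hle n (a n)
    have hsub : ∀ n, (⋂ n, (a n).1) ⊆ (a n).1 := fun n => Set.iInter_subset _ n
    refine ⟨nodeReal (⋂ n, (a n).1), nodeReal_mem_cCond h.code hu hq (Set.mem_univ _),
      (cLe_nodeReal_iff h.code hu (Set.mem_univ _) (Set.mem_univ _)).2 (hsub 0), fun E hE => ?_⟩
    have hEd := h.isDenseIn hM hE
    obtain ⟨n, rfl⟩ : E ∈ Set.range D := hD ▸ hE.1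
    obtain ⟨b, hbD, F, hF, hfront, hb⟩ := hnext n (a n) hEd
    have hfrontV := (hR 0).front_absolute (a (n + 1)).2.2 (a (n + 1)).2.1.isTree hF hfront
    -- an enumeration of the dense set
    have hcount : {d : Set Node | realSet (nodeReal d) ∈ D n}.Countable := by
      refine (hM.countable.preimage (f := fun d : Set Node => realSet (nodeReal d))
        fun _ _ e => nodeReal_injective (realSet_inj.1 e)).mono fun d hd => ?_
      exact hM.transitive.mem_trans hd hEd.mem
    obtain ⟨d₀, -, hd₀, -⟩ := hEd.dense p₀ hp₀ hxW
    obtain ⟨d, hd⟩ := hcount.exists_eq_range ⟨d₀, hd₀⟩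
    have hd' : ∀ c, realSet (nodeReal c) ∈ D n ↔ ∃ i, d i = c := fun c => by
      have : c ∈ {d : Set Node | realSet (nodeReal d) ∈ D n} ↔ c ∈ Set.range d := by rw [hd]
      exact this
    refine ⟨fun i => nodeReal (d i), fun z => ⟨fun hz => ?_, ?_⟩, ?_⟩
    · obtain ⟨c, -, -, rfl⟩ := hEd.cond z hz
      obtain ⟨i, rfl⟩ := (hd' c).1 hz
      exact ⟨i, rfl⟩
    · rintro ⟨i, rfl⟩
      exact (hd' _).2 ⟨i, rfl⟩
    -- In `V` the front in `a (n + 1)` restricts to a front in the intersection.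
    · refine (cEpd_nodeReal_iff h.code hu (Set.mem_univ _) (Set.mem_univ _)).2
        ⟨F ∩ ⋂ n, (a n).1, Set.mem_univ _, ⟨Set.inter_subset_right,
        fun s hs t ht => hfrontV.2.1 s hs.1 t ht.1, fun y _ hy => ?_⟩, fun t ht => ?_⟩
      · obtain ⟨k, hk⟩ := hfrontV.2.2 y (Set.mem_univ _) fun k => hsub (n + 1) (hy k)
        exact ⟨k, hk, hy k⟩
      · obtain ⟨i, hi⟩ := hb t ht.1
        obtain ⟨j, hj⟩ := (hd' _).1 (hbD i)
        exact ⟨j, by rw [hj, hi]; exact restr_mono (hsub (n + 1)) t⟩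

/-- One finite set of axioms works for all four forcings and all relations with a `Σ¹₂` code: the
parameter consists of the codes of the relations and of a table of recursive functions. -/
theorem exists_isAdequate : ∃ T₀ : setLang.Theory, T₀.Finite ∧ T₀ ⊆ ZFCminus ∧
    ∀ T : setLang.Theory, T₀ ⊆ T → ∀ (Q : TreeForcing) (E : EpdRel), HasSigma12Code E →
      IsSoundFor Q E → ∃ r, IsAdequate.{u} T Q E r := by
  obtain ⟨T₀, hfin, hsub, hT₀⟩ := Ensured.isRich.{u}
  refine ⟨T₀, hfin, hsub, fun T hT Q E hE hs => ?_⟩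
  obtain ⟨c, hc⟩ := exists_isCodeOf Q hE
  obtain ⟨e, he⟩ := exists_isBranchCode Q
  exact ⟨mkParam c (tableOf e), isCodeOf_mkParam hc _, hs, fun M hM =>
    hT₀ M hM.transitive (hM.models.weaken hT) c e _ he hM.param_mem⟩

end EffAxiomA

theorem mainTheorem4 :
    ∃ T₀ : EffAxiomA.setLang.Theory, T₀.Finite ∧ T₀ ⊆ EffAxiomA.ZFCminus ∧
      ∀ T : EffAxiomA.setLang.Theory, T₀ ⊆ T → ∀ Q : EffAxiomA.TreeForcing,
        (∃ r : EffAxiomA.Real,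
          EffAxiomA.DefinesOrder.{u} T Q r ∧
          EffAxiomA.DefinesAxiomA.{u} T Q EffAxiomA.epdFront r ∧
          EffAxiomA.EffectiveAxiomA.{u} T r) ∧
        (Q ≠ EffAxiomA.TreeForcing.laver → ∃ r : EffAxiomA.Real,
          EffAxiomA.DefinesOrder.{u} T Q r ∧
          EffAxiomA.DefinesAxiomA.{u} T Q EffAxiomA.epdSplit r ∧
          EffAxiomA.EffectiveAxiomA.{u} T r) ∧
        (∃ r : EffAxiomA.Real,
          EffAxiomA.DefinesOrder.{u} T Q r ∧ EffAxiomA.SuslinPlus.{u} T r) := by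
  obtain ⟨T₀, hfin, hsub, h⟩ := EffAxiomA.exists_isAdequate.{u}
  refine ⟨T₀, hfin, hsub, fun T hT Q => ⟨?_, fun hQ => ?_, ?_⟩⟩
  · obtain ⟨r, hr⟩ := h T hT Q _ EffAxiomA.hasSigma12Code_epdFront (EffAxiomA.isSoundFor_epdFront Q)
    exact ⟨r, hr.definesOrder, hr.definesAxiomA, hr.effectiveAxiomA fun _ _ _ hf _ => hf⟩
  · obtain ⟨r, hr⟩ := h T hT Q _ EffAxiomA.hasSigma12Code_epdSplit (EffAxiomA.isSoundFor_epdSplit Q)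
    exact ⟨r, hr.definesOrder, hr.definesAxiomA, hr.effectiveAxiomA fun _ _ _ _ hs => hs hQ⟩
  · obtain ⟨r, hr⟩ := h T hT Q _ EffAxiomA.hasSigma12Code_epdSub (EffAxiomA.isSoundFor_epdSub Q)
    exact ⟨r, hr.definesOrder, hr.suslinPlus⟩
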